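/- All graphs are finite and simple, and have at least one vertex. The $k$-deck of a graph $G$ is the multiset of isomorphism classes of the subgraphs of $G$ induced by its $k$-element vertex subsets. $G$ is $k$-deck reconstructible if every graph with the same $k$-deck as $G$ is isomorphic to $G$, and $\rho(G)$ is the least $k$ such that $G$ is $k$-deck reconstructible. $P_j$ and $C_j$ denote the path and the cycle with $j$ vertices, and components are compared up to isomorphism. Let $G$ be a graph with maximum degree at most $2$ that is not one of the cycles $C_3, C_4, C_5$. Let $m\ge m'$ be the numbers of vertices in two largest components of $G$ (with $m'=0$ if $G$ is connected). Let $\epsilon=1$ if $P_m$ is a component of $G$, and $\epsilon=0$ otherwise. Let - $\epsilon'=2$ if $m'<m-1$ and $P_{m'}$ is a component of $G$; - $\epsilon'=1$ if $m'=m-1$ and $P_{m'}$ is a component of $G$, or if $m'<m$ and $P_{m'-1}$ but not $P_{m'}$ is a component of $G$, or if $m'=m$ and at least two components of $G$ are isomorphic to $P_m$; - $\epsilon'=0$ otherwise. (Components are nonempty, so $P_0$ is never a component.) Put $$k_G=\max\{\lfloor m/2\rfloor+\epsilon,\; m'+\epsilon'\}.$$ Let $\mathcal F$ be the family of graphs with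 maximum degree at most $2$ that have an isolated vertex and moreover have a component with at least five vertices, or a component $C_4$, or components $P_4$ and $C_3$, or at least four components $C_3$ and at least four components $P_1$. Then $\rho(G)=4$ if $k_G=3$ and $G\in\mathcal F$, and $\rho(G)=k_G$ in all other cases. -/

import Mathlib

noncomputable section

/-- The isomorphism class of a graph, recorded as the set of all graphs on `Fin k` isomorphic
to it. For graphs with exactly `k` vertices, two graphs are isomorphic if and only if
their classes are equal. -/
def isoClass {V : Type*} (k : ℕ) (G : SimpleGraph V) : Set (SimpleGraph (Fin k)) :=
  {F | Nonempty (F ≃g G)}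

/-- The `k`-deck of `G`: the multiset of the isomorphism classes of the subgraphs of `G` induced
by the `k`-element vertex sets. -/
def kDeck {V : Type*} [Fintype V] (G : SimpleGraph V) (k : ℕ) :
    Multiset (Set (SimpleGraph (Fin k))) :=
  ((Finset.univ : Finset V).powersetCard k).val.map
    (fun S => isoClass k (G.induce (S : Set V)))

/-- `G` is `k`-deck reconstructible: every finite graph with the same `k`-deck as `G`
is isomorphic to `G`. Up to isomorphism, the finite graphs are the graphs on `Fin n`,
for all `n`. -/
def DeckReconstructible {V : Type*} [Fintype V] (G : SimpleGraph V) (k : ℕ) : Prop :=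
  ∀ (n : ℕ) (H : SimpleGraph (Fin n)), kDeck H k = kDeck G k → Nonempty (H ≃g G)

/-- `r` is the least `k` such that `G` is `k`-deck reconstructible. -/
def IsRho {V : Type*} [Fintype V] (G : SimpleGraph V) (r : ℕ) : Prop :=
  IsLeast {k : ℕ | DeckReconstructible G k} r

/-- The number of components of `G` that are isomorphic to `F`. -/
def componentCount {V W : Type*} (G : SimpleGraph V) (F : SimpleGraph W) : ℕ :=
  Nat.card {c : G.ConnectedComponent // Nonempty (c.toSimpleGraph ≃g F)}

/-- `F` is (isomorphic to) a component of `G`. As components are nonempty, the path with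
no vertices is never a component. -/
def HasComponent {V W : Type*} (G : SimpleGraph V) (F : SimpleGraph W) : Prop :=
  ∃ c : G.ConnectedComponent, Nonempty (c.toSimpleGraph ≃g F)

/-- The multiset of the numbers of vertices of the components of `G`. -/
def componentOrders {V : Type*} [Fintype V] (G : SimpleGraph V) : Multiset ℕ :=
  letI : Fintype G.ConnectedComponent := Fintype.ofFinite _
  (Finset.univ : Finset G.ConnectedComponent).val.map (fun c => Nat.card c.supp)

/-- The number `m` of vertices of a largest component of `G`. -/
def largestOrder {V : Type*} [Fintype V] (G : SimpleGraph V) : ℕ :=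
  (componentOrders G).sup

/-- The number of vertices of a second largest component of `G` (the largest entry
of the multiset of component orders after one copy of the largest order is removed),
and `0` if there is only one component. -/
def secondOrder {V : Type*} [Fintype V] (G : SimpleGraph V) : ℕ :=
  ((componentOrders G).erase (largestOrder G)).sup

open Classical in
/-- The parameter `ε`. -/
def epsOne {V : Type*} [Fintype V] (G : SimpleGraph V) : ℕ :=
  if HasComponent G (SimpleGraph.pathGraph (largestOrder G)) then 1 else 0

open Classical in
/-- The second parameter `ε`, for the second largest component. If the second largest order is
`0` or `1`, then the path with one vertex fewer is the empty path,
which is never a component. -/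
def epsTwo {V : Type*} [Fintype V] (G : SimpleGraph V) : ℕ :=
  let m := largestOrder G
  let q := secondOrder G
  if q + 1 < m ∧ HasComponent G (SimpleGraph.pathGraph q) then 2
  else if (q + 1 = m ∧ HasComponent G (SimpleGraph.pathGraph q)) ∨
      (q < m ∧ HasComponent G (SimpleGraph.pathGraph (q - 1)) ∧
        ¬ HasComponent G (SimpleGraph.pathGraph q)) ∨
      (q = m ∧ 2 ≤ componentCount G (SimpleGraph.pathGraph m)) then 1
  else 0

/-- The number `k_G`. -/
def kNumber {V : Type*} [Fintype V] (G : SimpleGraph V) : ℕ :=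
  max (largestOrder G / 2 + epsOne G) (secondOrder G + epsTwo G)

/-- The exceptional family: `G` has an isolated vertex, and it also has a component with at least
five vertices, or a component that is a 4-cycle, or components `P₄` and `C₃`, or four
components `C₃` and four components `P₁`. -/
def InExceptionalFamily {V : Type*} (G : SimpleGraph V) : Prop :=
  HasComponent G (SimpleGraph.pathGraph 1) ∧
    ((∃ c : G.ConnectedComponent, 5 ≤ Nat.card c.supp) ∨
      HasComponent G (SimpleGraph.cycleGraph 4) ∨
      (HasComponent G (SimpleGraph.pathGraph 4) ∧ HasComponent G (SimpleGraph.cycleGraph 3)) ∨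
      (4 ≤ componentCount G (SimpleGraph.cycleGraph 3) ∧
        4 ≤ componentCount G (SimpleGraph.pathGraph 1)))

end

/-! For `1 ≤ k ≤ |V|` the `k`-deck carries the same information as the numbers of induced copies of
the connected graphs with at most `k` vertices. Downwards this is double counting
(`embCount_eq_of_le`). Conversely, the product of the counts of two parts of a disconnected graph is
the sum of the counts of all ways to glue the parts, which yields the disconnected counts by
induction (`patternCount_eq_of_connected`). In a graph of maximum degree at most 2 only paths and
cycles matter: `P_o` contains `max(o+1-j, 0)` copies of `P_j`, and `C_o` contains `o` of them if `j
< o` and none otherwise. The problem becomes arithmetic of component sizes.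

Upper bound. The first difference of the path totals, corrected by `j+1` for each `C_{j+1}`, counts
the path components with at least `j` vertices (`longPaths_add`). Hence the `k`-deck shows all
cycles up to `k` vertices and all paths up to `k-2`. The rest must be read off from the number `x`
of paths with at least `k-1` vertices and the number `T` of induced `P_k`. This succeeds under
`FewLong` (`shapeCount_high`), and the corrections `ε`, `ε'` in `k_G` are what is needed to
guarantee `FewLong` for `k ≥ k_G` (`LargeEnough.fewLong`). A competitor `H` could still have a
vertex of degree at least 3. For `k ≥ 4` its neighbourhood is seen in the deck. For `k = 3` one uses
that the sum of `(d-1)(d-2)` over all degrees is twice the number of isolated vertices of `G`;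
outside the exceptional family this excludes such a vertex. For `k = 2` there are too few edges or
vertices.

Lower bound. One or two components are exchanged so that the small counts stay equal: shift a vertex
between two paths, open a cycle into a path, merge two cycles, or split a path or a cycle. For the
exceptional family with `k_G = 3`, some components together with isolated vertices are exchanged for
a graph with a vertex of degree 3 and the same numbers of vertices, edges, induced `P_3` and
triangles; so `k = 3` fails, while `k = 4` works by the upper bound. -/

namespace DeckReconstruction

open SimpleGraph

universe u v w

/-- The number of embeddings of `F` as an induced subgraph of `G`. -/
noncomputable def embCount {W : Type*} {V : Type*} (F : SimpleGraph W) (G : SimpleGraph V) : ℕ :=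
  Nat.card (F ↪g G)

/-! ### Embedding counts under isomorphism -/

section Congr

variable {W W' V V' : Type*} {F : SimpleGraph W} {F' : SimpleGraph W'} {G : SimpleGraph V}
  {G' : SimpleGraph V'}

theorem embCount_congr_left (e : F ≃g F') (G : SimpleGraph V) : embCount F G = embCount F' G :=
  Nat.card_congr
    { toFun := fun f => f.comp e.symm.toEmbedding
      invFun := fun f => f.comp e.toEmbedding
      left_inv := fun f => by ext; simp
      right_inv := fun f => by ext; simp }

theorem embCount_congr_right (F : SimpleGraph W) (e : G ≃g G') : embCount F G = embCount F G' :=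
  Nat.card_congr
    { toFun := fun f => e.toEmbedding.comp f
      invFun := fun f => e.symm.toEmbedding.comp f
      left_inv := fun f => by ext; simp
      right_inv := fun f => by ext; simp }

end Congr

/-! ### Counts of connected graphs determine all counts -/

section Pattern

variable {W : Type w} {V : Type u}

/-- The pattern of coincidences and adjacencies of a map into the vertices of a graph. -/
def patternOf (G : SimpleGraph V) (h : W → V) : W → W → Prop × Prop :=
  fun x y => (h x = h y, G.Adj (h x) (h y))

/-- The number of maps with a given pattern. -/
noncomputable def patternCount (G : SimpleGraph V) (π : W → W → Prop × Prop) : ℕ :=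
  Nat.card {h : W → V // patternOf G h = π}

/-- The pattern of the embeddings of `F`. -/
def graphPattern (F : SimpleGraph W) : W → W → Prop × Prop :=
  fun x y => (x = y, F.Adj x y)

/-- The restriction of a pattern to a subset. -/
def restrictPattern (A : Set W) (π : W → W → Prop × Prop) : A → A → Prop × Prop :=
  fun x y => π x y

theorem patternOf_eq_graphPattern_iff {G : SimpleGraph V} {F : SimpleGraph W} {h : W → V} :
    patternOf G h = graphPattern F ↔
      Function.Injective h ∧ ∀ x y, G.Adj (h x) (h y) ↔ F.Adj x y := by
  simp only [patternOf, graphPattern, funext_iff, Prod.mk.injEq, eq_iff_iff]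
  exact ⟨fun H => ⟨fun x y e => (H x y).1.1 e, fun x y => (H x y).2⟩,
    fun H x y => ⟨H.1.eq_iff, H.2 x y⟩⟩

theorem patternCount_graphPattern (G : SimpleGraph V) (F : SimpleGraph W) :
    patternCount G (graphPattern F) = embCount F G :=
  Nat.card_congr
    { toFun := fun h =>
        ⟨⟨h.1, (patternOf_eq_graphPattern_iff.1 h.2).1⟩,
          (patternOf_eq_graphPattern_iff.1 h.2).2 _ _⟩
      invFun := fun f =>
        ⟨f, patternOf_eq_graphPattern_iff.2 ⟨f.injective, fun _ _ => f.map_adj_iff⟩⟩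
      left_inv := fun _ => rfl
      right_inv := fun _ => rfl }

theorem patternCount_eq_zero {G : SimpleGraph V} {π : W → W → Prop × Prop}
    (h : ∀ f : W → V, patternOf G f ≠ π) : patternCount G π = 0 := by
  have : IsEmpty {f : W → V // patternOf G f = π} := ⟨fun f => h f.1 f.2⟩
  exact Nat.card_of_isEmpty

/-- A vertex `y` forced to coincide with `x`, and consistent with it, carries no information and can
be dropped. This turns non-injective gluings into patterns on fewer vertices. -/
theorem patternCount_restrict (G : SimpleGraph V) {π : W → W → Prop × Prop} {x y : W}
    (hxy : x ≠ y) (h1 : (π y x).1) (hl : ∀ z, π y z = π x z) (hr : ∀ z, π z y = π z x) :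
    patternCount G π = patternCount G (restrictPattern {z | z ≠ y} π) := by
  classical
  refine Nat.card_congr (Equiv.ofBijective
    (fun h => ⟨fun z => h.1 z, by ext1 a; ext1 b; exact congrFun (congrFun h.2 a) b⟩) ⟨?_, ?_⟩)
  · rintro ⟨f, hf⟩ ⟨g, hg⟩ hfg
    have key : ∀ z, z ≠ y → f z = g z := fun z hz => congrFun (congrArg Subtype.val hfg) ⟨z, hz⟩
    have hfy : f y = f x := by
      have := congrArg Prod.fst (congrFun (congrFun hf y) x); exact (this ▸ h1 :)
    have hgy : g y = g x := by
      have := congrArg Prod.fst (congrFun (congrFun hg y) x); exact (this ▸ h1 :)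
    ext z
    by_cases hz : z = y
    · subst hz; simp [hfy, hgy, key x hxy]
    · exact key z hz
  · rintro ⟨f, hf⟩
    let r : W → {z | z ≠ y} := fun z => if hz : z = y then ⟨x, hxy⟩ else ⟨z, hz⟩
    have hπ : ∀ a b, π (r a) (r b) = π a b := by
      intro a b
      by_cases ha : a = y <;> by_cases hb : b = y <;> simp [r, ha, hb, hl, hr]
    refine ⟨⟨fun z => f (r z), ?_⟩, ?_⟩
    · ext1 a; ext1 b
      rw [← hπ a b]
      exact congrFun (congrFun hf (r a)) (r b)
    · ext z
      have : r z = z := by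
        have := z.2
        simp only [Set.mem_ofPred_eq] at this
        simp [r, this]
      simp [this]

theorem exists_graphPattern {G : SimpleGraph V} {h : W → V}
    (hinj : ∀ x y, x ≠ y → ¬ (patternOf G h x y).1) :
    ∃ F : SimpleGraph W, patternOf G h = graphPattern F := by
  refine ⟨G.comap h, patternOf_eq_graphPattern_iff.2 ⟨fun x y e => ?_, fun x y => by simp⟩⟩
  by_contra hne
  exact hinj x y hne e

theorem card_pairs (G : SimpleGraph V) [Finite V] [Finite W] (A : Set W)
    (ρ : A → A → Prop × Prop) (σ : (Aᶜ : Set W) → (Aᶜ : Set W) → Prop × Prop) :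
    Nat.card {h : W → V // restrictPattern A (patternOf G h) = ρ ∧
      restrictPattern Aᶜ (patternOf G h) = σ} = patternCount G ρ * patternCount G σ := by
  classical
  rw [patternCount, patternCount, ← Nat.card_prod]
  let e := (Equiv.piEquivPiSubtypeProd (fun z => z ∈ A) (fun _ : W => V))
  exact Nat.card_congr
    { toFun := fun h => (⟨fun z => h.1 z, h.2.1⟩, ⟨fun z => h.1 z, h.2.2⟩)
      invFun := fun p => ⟨e.symm (p.1.1, p.2.1), by
        constructor
        · refine Eq.trans ?_ p.1.2
          ext1 a; ext1 b
          simp [restrictPattern, patternOf, e, Equiv.piEquivPiSubtypeProd]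
        · refine Eq.trans ?_ p.2.2
          ext1 a; ext1 b
          have ha : a.1 ∉ A := a.2
          have hb : b.1 ∉ A := b.2
          simp [restrictPattern, patternOf, e, Equiv.piEquivPiSubtypeProd, ha, hb]⟩
      left_inv := fun h => by
        ext z
        by_cases hz : z ∈ A <;> simp [e, Equiv.piEquivPiSubtypeProd, hz]
      right_inv := fun p => by
        ext z
        · simp [e, Equiv.piEquivPiSubtypeProd]
        · have hz : z.1 ∉ A := z.2
          simp [e, Equiv.piEquivPiSubtypeProd, hz] }

open Classical in
theorem card_pairs_eq_sum (G : SimpleGraph V) [Finite V] [Fintype W]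
    (Q : (W → W → Prop × Prop) → Prop) :
    Nat.card {h : W → V // Q (patternOf G h)} =
      ∑ π ∈ (Finset.univ : Finset (W → W → Prop × Prop)).filter Q, patternCount G π := by
  have := Fintype.ofFinite V
  simp only [patternCount, Nat.card_eq_fintype_card, Fintype.card_subtype]
  rw [Finset.card_eq_sum_card_fiberwise (f := patternOf G)
    (t := (Finset.univ : Finset (W → W → Prop × Prop)).filter Q)]
  · refine Finset.sum_congr rfl fun π hπ => congrArg _ ?_
    ext h
    simp only [Finset.mem_filter, Finset.mem_univ, true_and] at hπ ⊢
    exact ⟨fun H => H.2, fun H => ⟨H ▸ hπ, H⟩⟩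
  · intro h hh
    simpa using hh

end Pattern

/-- Counts of connected induced subgraphs determine the counts of all induced subgraphs. -/
theorem patternCount_eq_of_connected {V : Type u} {V' : Type v} [Finite V] [Finite V']
    {G : SimpleGraph V} {H : SimpleGraph V'} {k : ℕ}
    (hconn : ∀ j ≤ k, ∀ F : SimpleGraph (Fin j), F.Connected → embCount F G = embCount F H)
    (n : ℕ) (hn : n ≤ k) (W : Type) [Finite W] (hW : Nat.card W = n) (π : W → W → Prop × Prop) :
    patternCount G π = patternCount H π := by
  classical
  induction n using Nat.strong_induction_on generalizing W with
  | _ n ih =>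
    have step : ∀ π : W → W → Prop × Prop, (∃ x y, x ≠ y ∧ (π y x).1) →
        patternCount G π = patternCount H π := by
      rintro π ⟨x, y, hxy, h1⟩
      -- If the other entries do not reflect the coincidence of `x` and `y`, no map has this
      -- pattern.
      by_cases hl : (∀ z, π y z = π x z) ∧ ∀ z, π z y = π z x
      · rw [patternCount_restrict G hxy h1 hl.1 hl.2, patternCount_restrict H hxy h1 hl.1 hl.2]
        have hlt : Nat.card {z : W | z ≠ y} < n := by
          rw [← hW]
          exact Finite.card_subtype_lt (x := y) (by simp)
        exact ih _ hlt (by omega) _ rfl _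
      · have keyG : ∀ f : W → V, patternOf G f ≠ π := by
          rintro f rfl
          have e : f y = f x := h1
          exact hl ⟨fun z => by simp [patternOf, e], fun z => by simp [patternOf, e]⟩
        have keyH : ∀ f : W → V', patternOf H f ≠ π := by
          rintro f rfl
          have e : f y = f x := h1
          exact hl ⟨fun z => by simp [patternOf, e], fun z => by simp [patternOf, e]⟩
        rw [patternCount_eq_zero keyG, patternCount_eq_zero keyH]
    -- A pattern without coincidences is that of a graph or is not realized at all, so only graph
    -- patterns remain.
    have step2 : ∀ Q : (W → W → Prop × Prop) → Prop,
        (∀ F : SimpleGraph W, Q (graphPattern F) →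
          patternCount G (graphPattern F) = patternCount H (graphPattern F)) →
        ∀ π, Q π → patternCount G π = patternCount H π := by
      intro Q hQ π hπ
      by_cases h : ∃ x y, x ≠ y ∧ (π y x).1
      · exact step π h
      push Not at h
      by_cases hF : ∃ F : SimpleGraph W, π = graphPattern F
      · obtain ⟨F, rfl⟩ := hF
        exact hQ F hπ
      · rw [patternCount_eq_zero, patternCount_eq_zero]
        · rintro f rfl
          exact hF (exists_graphPattern fun x y hxy => h y x hxy.symm)
        · rintro f rfl
          exact hF (exists_graphPattern fun x y hxy => h y x hxy.symm)
    have main : ∀ F : SimpleGraph W,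
        patternCount G (graphPattern F) = patternCount H (graphPattern F) := by
      intro F
      -- Induction downwards on the edge set: gluing the parts of a disconnected graph injectively,
      -- but in another way, only adds edges.
      have wf : WellFoundedGT (SimpleGraph W) := inferInstance
      induction F using wf.induction with
      | _ F ihF =>
        by_cases hF : F.Connected
        · rw [patternCount_graphPattern, patternCount_graphPattern]
          let e : W ≃ Fin n := Finite.equivFinOfCardEq hW
          let i : F ≃g F.map e.toEmbedding := Iso.map e F
          rw [embCount_congr_left i, embCount_congr_left i]
          exact hconn n hn _ (i.connected_iff.1 hF)
        -- The empty graph is not connected, yet has exactly one embedding into every graph.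
        rcases isEmpty_or_nonempty W with hW0 | hW0
        · have a1 : ∀ {U : Type u} (K : SimpleGraph U), patternCount K (graphPattern F) = 1 := by
            intro U K
            have : Unique {h : W → U // patternOf K h = graphPattern F} :=
              { default := ⟨isEmptyElim, Subsingleton.elim _ _⟩
                uniq := fun _ => Subsingleton.elim _ _ }
            exact Nat.card_unique
          have a2 : ∀ {U : Type v} (K : SimpleGraph U), patternCount K (graphPattern F) = 1 := by
            intro U K
            have : Unique {h : W → U // patternOf K h = graphPattern F} :=
              { default := ⟨isEmptyElim, Subsingleton.elim _ _⟩
                uniq := fun _ => Subsingleton.elim _ _ }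
            exact Nat.card_unique
          rw [a1, a2]
        have : ¬ F.Preconnected := fun h => hF ⟨h⟩
        simp only [SimpleGraph.Preconnected, not_forall] at this
        obtain ⟨a, b, hab⟩ := this
        let A : Set W := {z | F.Reachable a z}
        have hcross : ∀ x y, x ∈ A → y ∉ A → ¬ F.Adj x y :=
          fun x y hx hy hadj => hy (hx.trans hadj.reachable)
        have cA : Nat.card A < n := by
          rw [← hW]; exact Finite.card_subtype_lt (x := b) hab
        have cA' : Nat.card (Aᶜ : Set W) < n := by
          rw [← hW]; exact Finite.card_subtype_lt (x := a) (fun h => h (Reachable.refl a))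
        let Q : (W → W → Prop × Prop) → Prop := fun π =>
          restrictPattern A π = restrictPattern A (graphPattern F) ∧
          restrictPattern Aᶜ π = restrictPattern Aᶜ (graphPattern F)
        have := Fintype.ofFinite W
        have eG := card_pairs_eq_sum G Q
        have eH := card_pairs_eq_sum H Q
        rw [card_pairs] at eG eH
        -- By induction the product of the counts of the two parts is the same for both graphs, so
        -- the two sums over gluings agree. All terms but that of `F` are known to agree, hence this
        -- one does too.
        rw [ih _ cA (by omega) _ rfl, ih _ cA' (by omega) _ rfl, eH] at eG
        have hmem : graphPattern F ∈
            (Finset.univ : Finset (W → W → Prop × Prop)).filter Q := by simp [Q]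
        rw [← Finset.add_sum_erase _ _ hmem, ← Finset.add_sum_erase _ _ hmem] at eG
        have hrest : ∀ π, (Q π ∧ π ≠ graphPattern F) → patternCount G π = patternCount H π := by
          refine step2 _ ?_
          rintro F' ⟨⟨h1, h2⟩, hne⟩
          apply ihF
          refine lt_of_le_of_ne ?_ (fun h => hne (by rw [h]))
          intro x y hadj
          by_cases hx : x ∈ A
          · have hy : y ∈ A := by_contra fun hy => hcross x y hx hy hadj
            have := congrArg Prod.snd (congrFun (congrFun h1 ⟨x, hx⟩) ⟨y, hy⟩)
            exact Eq.mpr this hadj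
          · have hy : y ∈ Aᶜ := fun hy => hcross y x hy hx hadj.symm
            have := congrArg Prod.snd (congrFun (congrFun h2 ⟨x, hx⟩) ⟨y, hy⟩)
            exact Eq.mpr this hadj
        have hsum : ∑ π ∈ ((Finset.univ : Finset (W → W → Prop × Prop)).filter Q).erase
            (graphPattern F), patternCount G π = ∑ π ∈ ((Finset.univ :
            Finset (W → W → Prop × Prop)).filter Q).erase (graphPattern F), patternCount H π := by
          refine Finset.sum_congr rfl fun π hπ => hrest π ?_
          simp only [Finset.mem_erase, Finset.mem_filter, Finset.mem_univ, true_and] at hπ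
          exact ⟨hπ.2, hπ.1⟩
        rw [hsum] at eG
        omega
    exact step2 (fun _ => True) (fun F _ => main F) π trivial

theorem embCount_eq_of_connected {V : Type u} {V' : Type v} [Finite V] [Finite V']
    {G : SimpleGraph V} {H : SimpleGraph V'} {k : ℕ}
    (hconn : ∀ j ≤ k, ∀ F : SimpleGraph (Fin j), F.Connected → embCount F G = embCount F H)
    {j : ℕ} (hj : j ≤ k) (F : SimpleGraph (Fin j)) : embCount F G = embCount F H := by
  rw [← patternCount_graphPattern, ← patternCount_graphPattern]
  exact patternCount_eq_of_connected hconn j hj (Fin j) (by simp) _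

/-! ### Decks and embedding counts -/

theorem mem_isoClass {V : Type*} {k : ℕ} {F : SimpleGraph (Fin k)} {G : SimpleGraph V} :
    F ∈ isoClass k G ↔ Nonempty (F ≃g G) := Iff.rfl

theorem isoClass_eq_of_mem {V : Type*} {k : ℕ} {F : SimpleGraph (Fin k)} {G : SimpleGraph V}
    (h : F ∈ isoClass k G) : isoClass k G = isoClass k F := by
  obtain ⟨e⟩ := h
  ext F'
  exact ⟨fun ⟨e'⟩ => ⟨e'.trans e.symm⟩, fun ⟨e'⟩ => ⟨e'.trans e⟩⟩

theorem kDeck_def {V : Type*} [Fintype V] (G : SimpleGraph V) (k : ℕ) :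
    kDeck G k = ((Finset.univ : Finset V).powersetCard k).val.map
      (fun S : Finset V => isoClass k (G.induce (S : Set V))) := by
  unfold kDeck
  simp only [Multiset.bind_def, Multiset.pure_def, Multiset.bind_singleton, Multiset.map_map,
    Function.comp_def]

theorem exists_mem_isoClass {V : Type*} {k : ℕ} (G : SimpleGraph V) (S : Finset V)
    (hS : S.card = k) : ∃ F : SimpleGraph (Fin k), F ∈ isoClass k (G.induce (S : Set V)) := by
  let e : (S : Set V) ≃ Fin k := Finite.equivFinOfCardEq (by simpa using hS)
  exact ⟨_, ⟨(Iso.map e (G.induce (S : Set V))).symm⟩⟩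

theorem card_iso_eq {W V : Type*} {F : SimpleGraph W} {G : SimpleGraph V} (h : Nonempty (F ≃g G)) :
    Nat.card (F ≃g G) = Nat.card (F ≃g F) := by
  obtain ⟨e⟩ := h
  exact Nat.card_congr
    { toFun := fun f => f.trans e.symm
      invFun := fun f => f.trans e
      left_inv := fun f => by ext; simp
      right_inv := fun f => by ext; simp }

theorem card_aut_pos {W : Type*} [Finite W] (F : SimpleGraph W) : 0 < Nat.card (F ≃g F) := by
  have : Finite (F ≃g F) := Finite.of_injective _ RelIso.toEquiv_injective
  have : Nonempty (F ≃g F) := ⟨RelIso.refl _⟩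
  exact Nat.card_pos

theorem finite_embedding {W V : Type*} [Finite W] [Finite V] (F : SimpleGraph W)
    (G : SimpleGraph V) : Finite (F ↪g G) := Finite.of_injective _ DFunLike.coe_injective

theorem card_embedding_range {W V : Type*} [Fintype W] [Fintype V] (F : SimpleGraph W)
    (G : SimpleGraph V) (S : Finset V) :
    Nat.card {f : F ↪g G // Finset.univ.map f.toEmbedding = S} =
      Nat.card (F ≃g G.induce (S : Set V)) := by
  have hrange : ∀ e : F ≃g G.induce (S : Set V), Finset.univ.map
      ((Embedding.induce (S : Set V)).comp e.toEmbedding).toEmbedding = S := by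
    intro e
    ext x
    simp only [Finset.mem_map, Finset.mem_univ, true_and]
    constructor
    · rintro ⟨y, rfl⟩
      exact (e y).2
    · intro hx
      exact ⟨e.symm ⟨x, hx⟩, by simp⟩
  refine (Nat.card_congr (Equiv.ofBijective (fun e => ⟨(Embedding.induce (S : Set V)).comp
    e.toEmbedding, hrange e⟩) ⟨?_, ?_⟩)).symm
  · intro e e' h
    ext x
    have := congrArg (fun f => (Subtype.val f) x) h
    simpa using this
  · rintro ⟨f, rfl⟩
    have hb : Function.Bijective (fun x => (⟨f x, by simp⟩ :
        ((Finset.univ.map f.toEmbedding : Finset V) : Set V))) := by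
      constructor
      · intro x y h
        exact f.injective (congrArg Subtype.val h)
      · rintro ⟨x, hx⟩
        simp only [Finset.coe_map, Finset.coe_univ, Set.image_univ, Set.mem_range] at hx
        obtain ⟨y, rfl⟩ := hx
        exact ⟨y, rfl⟩
    refine ⟨⟨Equiv.ofBijective _ hb, ?_⟩, ?_⟩
    · intro a b
      simp
    · ext x
      simp

open Classical in
theorem embCount_eq_sum {V : Type*} [Fintype V] (G : SimpleGraph V) {k : ℕ}
    (F : SimpleGraph (Fin k)) : embCount F G =
      ((kDeck G k).map (fun X => if F ∈ X then Nat.card (F ≃g F) else 0)).sum := by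
  have := finite_embedding F G
  have := Fintype.ofFinite (F ↪g G)
  rw [kDeck_def, Multiset.map_map]
  change _ = Finset.sum ((Finset.univ : Finset V).powersetCard k) _
  rw [embCount, Nat.card_eq_fintype_card, ← Finset.card_univ,
    Finset.card_eq_sum_card_fiberwise (f := fun f : F ↪g G => Finset.univ.map f.toEmbedding)
      (t := (Finset.univ : Finset V).powersetCard k)]
  · refine Finset.sum_congr rfl fun S _ => ?_
    have := card_embedding_range F G S
    rw [Nat.card_eq_fintype_card, Fintype.card_subtype] at this
    rw [this]
    simp only [Function.comp, mem_isoClass]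
    split_ifs with h
    · exact card_iso_eq h
    · have : IsEmpty (F ≃g G.induce (S : Set V)) := not_nonempty_iff.1 h
      simp
  · intro f _
    simp [Finset.mem_powersetCard]

theorem embCount_eq_of_kDeck_eq {V V' : Type*} [Fintype V] [Fintype V'] {G : SimpleGraph V}
    {H : SimpleGraph V'} {k : ℕ} (h : kDeck H k = kDeck G k) (F : SimpleGraph (Fin k)) :
    embCount F H = embCount F G := by
  rw [embCount_eq_sum, embCount_eq_sum, h]

theorem exists_mem_of_mem_kDeck {V : Type*} [Fintype V] {G : SimpleGraph V}
    {k : ℕ} {X : Set (SimpleGraph (Fin k))} (hX : X ∈ kDeck G k) :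
    ∃ F : SimpleGraph (Fin k), X = isoClass k F := by
  simp only [kDeck_def, Multiset.mem_map, Finset.mem_val, Finset.mem_powersetCard] at hX
  obtain ⟨S, ⟨_, hS⟩, rfl⟩ := hX
  obtain ⟨F, hF⟩ := exists_mem_isoClass G S hS
  exact ⟨F, isoClass_eq_of_mem hF⟩

open Classical in
-- Every class in the deck is the class of a graph on `Fin k`, so containing `F` means being the
-- class of `F`. Each card isomorphic to `F` is the range of as many embeddings as `F` has
-- automorphisms.
theorem embCount_eq_count {V : Type*} [Fintype V] (G : SimpleGraph V) {k : ℕ}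
    (F : SimpleGraph (Fin k)) :
    embCount F G = (kDeck G k).count (isoClass k F) * Nat.card (F ≃g F) := by
  rw [embCount_eq_sum]
  generalize hD : kDeck G k = D
  have hmem : ∀ X ∈ D, (F ∈ X ↔ isoClass k F = X) := by
    intro X hX
    obtain ⟨F', rfl⟩ := exists_mem_of_mem_kDeck (hD ▸ hX)
    exact ⟨fun h => (isoClass_eq_of_mem h).symm, fun h => h ▸ ⟨RelIso.refl _⟩⟩
  clear hD
  induction D using Multiset.induction with
  | empty => simp
  | cons a s ih =>
    have ih := ih fun X hX => hmem X (Multiset.mem_cons_of_mem hX)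
    have ha := hmem a (Multiset.mem_cons_self a s)
    by_cases h : F ∈ a
    · have h' := ha.1 h
      rw [Multiset.map_cons, Multiset.sum_cons, ih, if_pos h, h', Multiset.count_cons_self]
      ring
    · have : ¬ isoClass k F = a := fun h' => h (ha.2 h')
      rw [Multiset.map_cons, Multiset.sum_cons, ih, if_neg h, Multiset.count_cons_of_ne this,
        zero_add]

theorem kDeck_eq_of_embCount_eq {V V' : Type*} [Fintype V] [Fintype V'] {G : SimpleGraph V}
    {H : SimpleGraph V'} {k : ℕ} (h : ∀ F : SimpleGraph (Fin k), embCount F H = embCount F G) :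
    kDeck H k = kDeck G k := by
  classical
  have key : ∀ F : SimpleGraph (Fin k),
      (kDeck H k).count (isoClass k F) = (kDeck G k).count (isoClass k F) := by
    intro F
    have := h F
    rw [embCount_eq_count, embCount_eq_count] at this
    exact Nat.eq_of_mul_eq_mul_right (card_aut_pos F) this
  ext X
  by_cases hX : ∃ F : SimpleGraph (Fin k), X = isoClass k F
  · obtain ⟨F, rfl⟩ := hX
    exact key F
  · rw [Multiset.count_eq_zero_of_notMem fun h => hX (exists_mem_of_mem_kDeck h),
      Multiset.count_eq_zero_of_notMem fun h => hX (exists_mem_of_mem_kDeck h)]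

theorem card_kDeck {V : Type*} [Fintype V] (G : SimpleGraph V) (k : ℕ) :
    (kDeck G k).card = (Fintype.card V).choose k := by
  simp [kDeck_def]

/-- The size of a nonempty deck reveals the number of vertices. This is why reconstruction is always
run with `k ≤ |V|`. -/
theorem eq_of_choose_eq {n n' k : ℕ} (hk : 1 ≤ k) (hkn : k ≤ n) (h : n'.choose k = n.choose k) :
    n' = n := by
  have mono : ∀ a b, k ≤ b → a < b → a.choose k < b.choose k := by
    intro a b hb hab
    obtain ⟨b, rfl⟩ : ∃ c, b = c + 1 := ⟨b - 1, by omega⟩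
    obtain ⟨k, rfl⟩ : ∃ c, k = c + 1 := ⟨k - 1, by omega⟩
    have h1 : a.choose (k + 1) ≤ b.choose (k + 1) := Nat.choose_le_choose _ (by omega)
    have h2 : 0 < b.choose k := Nat.choose_pos (by omega)
    rw [Nat.choose_succ_succ']
    omega
  have hpos : 0 < n'.choose k := h ▸ Nat.choose_pos hkn
  have hkn' : k ≤ n' := by
    by_contra hlt
    rw [Nat.choose_eq_zero_of_lt (by omega)] at hpos
    omega
  rcases lt_trichotomy n' n with hlt | heq | hlt
  · exact absurd h (mono _ _ hkn hlt).ne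
  · exact heq
  · exact absurd h.symm (mono _ _ hkn' hlt).ne

theorem card_eq_of_kDeck_eq {V V' : Type*} [Fintype V] [Fintype V'] {G : SimpleGraph V}
    {H : SimpleGraph V'} {k : ℕ} (hk : 1 ≤ k) (hkn : k ≤ Fintype.card V)
    (h : kDeck H k = kDeck G k) : Fintype.card V' = Fintype.card V := by
  have := congrArg Multiset.card h
  rw [card_kDeck, card_kDeck] at this
  exact eq_of_choose_eq hk hkn this

/-- Injective maps on `Option W` whose restriction to `W` is an embedding of `F`, counted
in terms of the restriction. -/
theorem card_extensions {W : Type w} {V : Type u} [Fintype W] [Fintype V] (F : SimpleGraph W)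
    (G : SimpleGraph V) :
    Nat.card {h : Option W → V // Function.Injective h ∧
      ∀ x y, G.Adj (h (some x)) (h (some y)) ↔ F.Adj x y} =
      embCount F G * (Fintype.card V - Fintype.card W) := by
  classical
  have := finite_embedding F G
  have := Fintype.ofFinite (F ↪g G)
  have e : {h : Option W → V // Function.Injective h ∧
      ∀ x y, G.Adj (h (some x)) (h (some y)) ↔ F.Adj x y} ≃
      Σ f : F ↪g G, {v : V // v ∉ Set.range f} :=
    { toFun := fun h => ⟨⟨⟨fun x => h.1 (some x),
          fun x y hxy => Option.some_injective _ (h.2.1 hxy)⟩, h.2.2 _ _⟩,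
        ⟨h.1 none, by
          rintro ⟨x, hx⟩
          exact Option.some_ne_none x (h.2.1 hx)⟩⟩
      invFun := fun p => ⟨fun o => o.elim p.2.1 p.1, by
        constructor
        · rintro (_ | x) (_ | y) hxy
          · rfl
          · exact absurd ⟨y, hxy.symm⟩ p.2.2
          · exact absurd ⟨x, hxy⟩ p.2.2
          · exact congrArg some (p.1.injective hxy)
        · intro x y
          exact p.1.map_adj_iff⟩
      left_inv := fun h => by
        ext o
        cases o <;> rfl
      right_inv := fun p => rfl }
  rw [Nat.card_congr e, Nat.card_sigma]
  have : ∀ f : F ↪g G, Nat.card {v : V // v ∉ Set.range f} =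
      Fintype.card V - Fintype.card W := by
    intro f
    rw [Nat.card_eq_fintype_card, Fintype.card_subtype_compl]
    congr 1
    exact Fintype.card_range f
  simp only [this, Finset.sum_const, smul_eq_mul, Finset.card_univ, embCount,
    Nat.card_eq_fintype_card]

/-- An extended map induces exactly one graph on `Option W` that restricts to `F`. Together with
`card_extensions` this is the double count that passes from `j + 1` to `j` vertices. -/
theorem card_extensions_eq_sum {W : Type w} {V : Type u} [Fintype W] [Fintype V]
    (F : SimpleGraph W) (G : SimpleGraph V)
    [Fintype {F' : SimpleGraph (Option W) // F'.comap some = F}] :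
    Nat.card {h : Option W → V // Function.Injective h ∧
      ∀ x y, G.Adj (h (some x)) (h (some y)) ↔ F.Adj x y} =
      ∑ F' : {F' : SimpleGraph (Option W) // F'.comap some = F}, embCount F'.1 G := by
  have := fun F' : {F' : SimpleGraph (Option W) // F'.comap some = F} =>
    finite_embedding F'.1 G
  unfold embCount
  rw [← Nat.card_sigma]
  have hp : ∀ (p : Σ F' : {F' : SimpleGraph (Option W) // F'.comap some = F}, F'.1 ↪g G) x y,
      G.Adj (p.2 (some x)) (p.2 (some y)) ↔ F.Adj x y := by
    rintro ⟨⟨F', rfl⟩, f⟩ x y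
    exact f.map_adj_iff
  refine (Nat.card_congr (Equiv.ofBijective
    (fun p => ⟨p.2, p.2.injective, hp p⟩) ⟨?_, ?_⟩)).symm
  · rintro ⟨⟨F', h⟩, f⟩ ⟨⟨F'', h'⟩, f'⟩ he
    have he : (f : Option W → V) = f' := congrArg Subtype.val he
    have : F' = F'' := by
      ext x y
      rw [← f.map_adj_iff, ← f'.map_adj_iff, he]
    subst this
    have : f = f' := DFunLike.coe_injective he
    rw [this]
  · rintro ⟨h, hi, ha⟩
    exact ⟨⟨⟨G.comap h, by ext x y; simpa using ha x y⟩, ⟨⟨h, hi⟩, Iff.rfl⟩⟩, rfl⟩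

/-- Counts of the induced subgraphs with `k` vertices determine the counts of
the induced subgraphs with fewer vertices. -/
theorem embCount_eq_of_le {V : Type u} {V' : Type v} [Fintype V] [Fintype V']
    {G : SimpleGraph V} {H : SimpleGraph V'} (hcard : Fintype.card V' = Fintype.card V)
    {k : ℕ} (hk : k ≤ Fintype.card V)
    (h : ∀ F : SimpleGraph (Fin k), embCount F H = embCount F G)
    {j : ℕ} (hj : j ≤ k) (F : SimpleGraph (Fin j)) : embCount F H = embCount F G := by
  classical
  induction hd : k - j generalizing j with
  | zero =>
    obtain rfl : j = k := by omega
    exact h F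
  | succ d ih =>
    have key : embCount F H * (Fintype.card V' - Fintype.card (Fin j)) =
        embCount F G * (Fintype.card V - Fintype.card (Fin j)) := by
      rw [← card_extensions, ← card_extensions, card_extensions_eq_sum, card_extensions_eq_sum]
      refine Finset.sum_congr rfl fun F' _ => ?_
      let e : Option (Fin j) ≃ Fin (j + 1) := Fintype.equivFinOfCardEq (by simp)
      rw [embCount_congr_left (Iso.map e F'.1), embCount_congr_left (Iso.map e F'.1)]
      exact ih (by omega) _ (by omega)
    rw [hcard, Fintype.card_fin] at key
    exact Nat.eq_of_mul_eq_mul_right (by omega) key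

/-- Equal `k`-decks give equal counts of all induced subgraphs with at most `k` vertices. -/
theorem embCount_eq_of_kDeck_eq_of_le {V : Type u} {V' : Type v} [Fintype V] [Fintype V']
    {G : SimpleGraph V} {H : SimpleGraph V'} {k : ℕ} (hk : 1 ≤ k) (hkn : k ≤ Fintype.card V)
    (h : kDeck H k = kDeck G k) {j : ℕ} (hj : j ≤ k) (F : SimpleGraph (Fin j)) :
    embCount F H = embCount F G :=
  embCount_eq_of_le (card_eq_of_kDeck_eq hk hkn h) hkn (embCount_eq_of_kDeck_eq h) hj F

/-- Equal counts of connected graphs with at most `k` vertices give equal `j`-decks. -/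
theorem kDeck_eq_of_connected {V : Type u} {V' : Type v} [Fintype V] [Fintype V']
    {G : SimpleGraph V} {H : SimpleGraph V'} {k : ℕ}
    (hconn : ∀ j ≤ k, ∀ F : SimpleGraph (Fin j), F.Connected → embCount F H = embCount F G)
    {j : ℕ} (hj : j ≤ k) : kDeck H j = kDeck G j :=
  kDeck_eq_of_embCount_eq fun F => embCount_eq_of_connected hconn hj F

/-! ### Connected graphs of maximum degree at most two -/

/-- Every vertex has at most two neighbours. -/
def DegLeTwo {V : Type*} (G : SimpleGraph V) : Prop :=
  ∀ v a b c, G.Adj v a → G.Adj v b → G.Adj v c → a = b ∨ a = c ∨ b = c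

theorem DegLeTwo.of_embedding {V W : Type*} {G : SimpleGraph V} {F : SimpleGraph W}
    (hG : DegLeTwo G) (f : F ↪g G) : DegLeTwo F := by
  intro v a b c ha hb hc
  have := hG (f v) (f a) (f b) (f c) (f.map_adj_iff.2 ha) (f.map_adj_iff.2 hb) (f.map_adj_iff.2 hc)
  simpa using this

theorem cycleGraph_adj_iff {n : ℕ} (hn : 3 ≤ n) (u v : Fin n) :
    (cycleGraph n).Adj u v ↔ u.val + 1 = v.val ∨ v.val + 1 = u.val ∨
      (u.val = 0 ∧ v.val + 1 = n) ∨ (v.val = 0 ∧ u.val + 1 = n) := by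
  have key : ∀ a b : Fin n, (a - b).val = 1 ↔ b.val + 1 = a.val ∨ (a.val = 0 ∧ b.val + 1 = n) := by
    intro a b
    have ha := a.2
    have hb := b.2
    rw [Fin.sub_def]
    simp only
    rcases le_or_gt b.val a.val with h | h
    · have : n - b.val + a.val = (a.val - b.val) + n := by omega
      rw [this, Nat.add_mod_right, Nat.mod_eq_of_lt (by omega)]
      omega
    · rw [Nat.mod_eq_of_lt (by omega)]
      omega
  rw [cycleGraph_adj', key, key]
  tauto

/-- A longest path in a connected graph of maximum degree at most two visits all vertices,
and the only possible further edge joins its ends. -/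
theorem exists_spanning_path {V : Type*} [Finite V] {G : SimpleGraph V} (hG : G.Connected)
    (hd : DegLeTwo G) : ∃ f : Fin (Nat.card V) ≃ V, ∀ i i' : Fin (Nat.card V), i < i' →
      (i.val + 1 = i'.val → G.Adj (f i) (f i')) ∧
      (G.Adj (f i) (f i') → i.val + 1 = i'.val ∨ (i.val = 0 ∧ i'.val + 1 = Nat.card V)) := by
  classical
  have hne : Nonempty V := hG.nonempty
  have := Fintype.ofFinite V
  -- Paths with `n` vertices, not necessarily induced; a longest one is taken.
  let P : ℕ → Prop := fun n => ∃ f : ℕ → V, (∀ i j, i < n → j < n → f i = f j → i = j) ∧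
    ∀ i, i + 1 < n → G.Adj (f i) (f (i + 1))
  have hP1 : P 1 := ⟨fun _ => hne.some, by omega, by omega⟩
  have hPle : ∀ n, P n → n ≤ Nat.card V := by
    rintro n ⟨f, hf, -⟩
    have : Function.Injective (fun i : Fin n => f i) := fun i j h => Fin.ext (hf i j i.2 j.2 h)
    simpa using Fintype.card_le_of_injective _ this
  obtain ⟨n, hPn, hmax⟩ : ∃ n, P n ∧ ∀ m, P m → m ≤ n := by
    have h1 : 1 ≤ Nat.card V := hPle 1 hP1
    exact ⟨Nat.findGreatest P (Nat.card V), Nat.findGreatest_spec h1 hP1,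
      fun m hm => Nat.le_findGreatest (hPle m hm) hm⟩
  have hn1 : 1 ≤ n := hmax 1 hP1
  obtain ⟨f, hinj, hadj⟩ := hPn
  -- An edge leaving the longest path would either extend it at an end or give an inner vertex a
  -- third neighbour.
  have hsurj : ∀ w, ∃ i < n, f i = w := by
    by_contra hcon
    push Not at hcon
    obtain ⟨w, hw⟩ := hcon
    obtain ⟨p⟩ := hG.preconnected (f 0) w
    obtain ⟨d, -, ⟨i, hi, hdi⟩, hd2⟩ := p.exists_boundary_dart {v | ∃ i < n, f i = v}
      ⟨0, by omega, rfl⟩ (fun ⟨i, hi, h⟩ => hw i hi h)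
    have hdadj := d.adj
    rw [← hdi] at hdadj
    have hx : ∀ i, i < n → f i ≠ d.snd := fun i hi h => hd2 ⟨i, hi, h⟩
    generalize d.snd = x at hdadj hx
    by_cases h0 : i = 0
    · subst h0
      have : P (n + 1) := by
        refine ⟨fun m => if m = 0 then x else f (m - 1), ?_, ?_⟩
        · intro a b ha hb hab
          by_cases ha0 : a = 0 <;> by_cases hb0 : b = 0
          · omega
          · simp only [ha0, hb0, if_true, if_false] at hab
            exact absurd hab.symm (hx _ (by omega))
          · simp only [ha0, hb0, if_true, if_false] at hab
            exact absurd hab (hx _ (by omega))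
          · simp only [ha0, hb0, if_false] at hab
            have := hinj _ _ (by omega) (by omega) hab
            omega
        · intro m hm
          by_cases hm0 : m = 0
          · subst hm0
            simpa using hdadj.symm
          · obtain ⟨m, rfl⟩ : ∃ c, m = c + 1 := ⟨m - 1, by omega⟩
            simpa using hadj m (by omega)
      have := hmax _ this
      omega
    by_cases hl : i + 1 = n
    · have : P (n + 1) := by
        refine ⟨fun m => if m = n then x else f m, ?_, ?_⟩
        · intro a b ha hb hab
          by_cases ha0 : a = n <;> by_cases hb0 : b = n
          · omega
          · simp only [ha0, hb0, if_true, if_false] at hab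
            exact absurd hab.symm (hx _ (by omega))
          · simp only [ha0, hb0, if_true, if_false] at hab
            exact absurd hab (hx _ (by omega))
          · simp only [ha0, hb0, if_false] at hab
            exact hinj _ _ (by omega) (by omega) hab
        · intro m hm
          by_cases hm0 : m + 1 = n
          · obtain rfl : m = i := by omega
            simpa [hm0, show m ≠ n by omega] using hdadj
          · simpa [hm0, show m ≠ n by omega] using hadj m (by omega)
      have := hmax _ this
      omega
    have h1 : G.Adj (f i) (f (i - 1)) := by
      have := hadj (i - 1) (by omega)
      rw [show i - 1 + 1 = i by omega] at this
      exact this.symm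
    rcases hd _ _ _ _ h1 (hadj i (by omega)) hdadj with h | h | h
    · have := hinj _ _ (by omega) (by omega) h
      omega
    · exact hx _ (by omega) h
    · exact hx _ (by omega) h
  have hbij : Function.Bijective (fun i : Fin n => f i) :=
    ⟨fun i j h => Fin.ext (hinj i j i.2 j.2 h), fun w => by
      obtain ⟨i, hi, h⟩ := hsurj w
      exact ⟨⟨i, hi⟩, h⟩⟩
  obtain rfl : n = Nat.card V := by simpa using Nat.card_congr (Equiv.ofBijective _ hbij)
  refine ⟨Equiv.ofBijective _ hbij, ?_⟩
  rintro ⟨i, hi⟩ ⟨j, hj⟩ hij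
  simp only [Fin.mk_lt_mk, Equiv.ofBijective_apply] at hij ⊢
  refine ⟨?_, fun h => ?_⟩
  · rintro rfl
    exact hadj i hj
  by_contra hcon
  push Not at hcon
  -- An edge outside the path that does not join its two ends has an inner vertex as an end, which
  -- would get a third neighbour.
  by_cases hi0 : i = 0
  · subst hi0
    have h1 : G.Adj (f j) (f (j - 1)) := by
      have := hadj (j - 1) (by omega)
      rw [show j - 1 + 1 = j by omega] at this
      exact this.symm
    have h2 := hcon.2 rfl
    rcases hd _ _ _ _ h1 (hadj j (by omega)) h.symm with h | h | h
    all_goals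
      have := hinj _ _ (by omega) (by omega) h
      omega
  · have h1 : G.Adj (f i) (f (i - 1)) := by
      have := hadj (i - 1) (by omega)
      rw [show i - 1 + 1 = i by omega] at this
      exact this.symm
    rcases hd _ _ _ _ h1 (hadj i (by omega)) h with h | h | h
    all_goals
      have := hinj _ _ (by omega) (by omega) h
      omega

/-- A finite connected graph of maximum degree at most two is a path or a cycle. -/
theorem path_or_cycle {V : Type*} [Finite V] {G : SimpleGraph V} (hG : G.Connected)
    (hd : DegLeTwo G) : Nonempty (G ≃g pathGraph (Nat.card V)) ∨
      (3 ≤ Nat.card V ∧ Nonempty (G ≃g cycleGraph (Nat.card V))) := by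
  obtain ⟨f, hf⟩ := exists_spanning_path hG hd
  -- On two vertices the edge joining the ends is the path itself; only from three vertices on does
  -- it close a cycle.
  by_cases h : 3 ≤ Nat.card V ∧ ∃ i i' : Fin (Nat.card V), i.val = 0 ∧ i'.val + 1 = Nat.card V ∧
      G.Adj (f i) (f i')
  · right
    obtain ⟨h3, i₀, i₁, h0, h1, hadj⟩ := h
    refine ⟨h3, ⟨(RelIso.symm ⟨f, ?_⟩)⟩⟩
    intro a b
    rw [cycleGraph_adj_iff h3]
    rcases lt_trichotomy a b with hab | rfl | hab
    · constructor
      · intro H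
        have := (hf a b hab).2 H
        tauto
      · have hab' : a.val < b.val := hab
        rintro (H | H | H | H)
        · exact (hf a b hab).1 H
        · omega
        · rw [show a = i₀ from Fin.ext (by omega), show b = i₁ from Fin.ext (by omega)]
          exact hadj
        · omega
    · simp
      omega
    · constructor
      · intro H
        have := (hf b a hab).2 H.symm
        tauto
      · have hab' : b.val < a.val := hab
        rintro (H | H | H | H)
        · omega
        · exact ((hf b a hab).1 H).symm
        · omega
        · rw [show b = i₀ from Fin.ext (by omega), show a = i₁ from Fin.ext (by omega)]
          exact hadj.symm
  · left
    push Not at h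
    have hf' : ∀ i i' : Fin (Nat.card V), i < i' → (G.Adj (f i) (f i') ↔ i.val + 1 = i'.val) := by
      intro i i' hii
      refine ⟨fun H => ?_, (hf i i' hii).1⟩
      rcases (hf i i' hii).2 H with h' | h'
      · exact h'
      · by_contra hne
        have hii' : i.val < i'.val := hii
        exact h (by omega) i i' h'.1 h'.2 H
    refine ⟨(RelIso.symm ⟨f, ?_⟩)⟩
    intro a b
    rw [pathGraph_adj]
    rcases lt_trichotomy a b with hab | rfl | hab
    · rw [hf' a b hab]
      have hab' : a.val < b.val := hab
      omega
    · simp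
    · rw [G.adj_comm, hf' b a hab]
      have hab' : b.val < a.val := hab
      omega

theorem pathGraph_degLeTwo (n : ℕ) : DegLeTwo (pathGraph n) := by
  intro v a b c
  simp only [pathGraph_adj, Fin.ext_iff]
  omega

theorem cycleGraph_degLeTwo {n : ℕ} (hn : 3 ≤ n) : DegLeTwo (cycleGraph n) := by
  intro v a b c
  simp only [cycleGraph_adj_iff hn, Fin.ext_iff]
  omega

theorem pathGraph_connected' {n : ℕ} (hn : 1 ≤ n) : (pathGraph n).Connected := by
  obtain ⟨n, rfl⟩ : ∃ c, n = c + 1 := ⟨n - 1, by omega⟩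
  exact pathGraph_connected n

theorem cycleGraph_connected' {n : ℕ} (hn : 1 ≤ n) : (cycleGraph n).Connected := by
  obtain ⟨n, rfl⟩ : ∃ c, n = c + 1 := ⟨n - 1, by omega⟩
  exact cycleGraph_connected

theorem exists_two_neighbors_cycleGraph {n : ℕ} (hn : 3 ≤ n) (i : Fin n) :
    ∃ a b, a ≠ b ∧ (cycleGraph n).Adj i a ∧ (cycleGraph n).Adj i b := by
  have hi := i.2
  simp only [cycleGraph_adj_iff hn, ne_eq, Fin.ext_iff]
  by_cases h0 : i.val = 0
  · exact ⟨⟨1, by omega⟩, ⟨n - 1, by omega⟩, by simp; omega, by simp; omega, by simp; omega⟩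
  by_cases h1 : i.val + 1 = n
  · exact ⟨⟨0, by omega⟩, ⟨i.val - 1, by omega⟩, by simp; omega, by simp; omega, by simp; omega⟩
  · exact ⟨⟨i.val + 1, by omega⟩, ⟨i.val - 1, by omega⟩, by simp; omega, by simp, by simp; omega⟩

/-- A cycle embedded in a connected graph of maximum degree at most two is the whole graph. -/
theorem iso_of_cycleGraph_embedding {V : Type*} {G : SimpleGraph V} (hG : G.Connected)
    (hd : DegLeTwo G) {n : ℕ} (hn : 3 ≤ n) (f : cycleGraph n ↪g G) :
    Nonempty (G ≃g cycleGraph n) := by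
  have hsurj : Function.Surjective f := by
    intro w
    by_contra hw
    obtain ⟨p⟩ := hG.preconnected (f ⟨0, by omega⟩) w
    obtain ⟨d, -, ⟨i, hdi⟩, hd2⟩ := p.exists_boundary_dart (Set.range f) ⟨_, rfl⟩ hw
    have hdadj := d.adj
    rw [← hdi] at hdadj
    obtain ⟨a, b, hab, ha, hb⟩ := exists_two_neighbors_cycleGraph hn i
    rcases hd _ _ _ _ (f.map_adj_iff.2 ha) (f.map_adj_iff.2 hb) hdadj with h | h | h
    · exact hab (f.injective h)
    · exact hd2 ⟨_, h⟩
    · exact hd2 ⟨_, h⟩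
  exact ⟨RelIso.symm ⟨Equiv.ofBijective f ⟨f.injective, hsurj⟩, f.map_adj_iff⟩⟩

theorem not_iso_path_cycle {a n : ℕ} (hn : 3 ≤ n) : ¬ Nonempty (pathGraph a ≃g cycleGraph n) := by
  rintro ⟨e⟩
  have hc : a = n := by simpa using Fintype.card_congr e.toEquiv
  subst hc
  obtain ⟨x, y, hxy, hx, hy⟩ := exists_two_neighbors_cycleGraph hn (e ⟨0, by omega⟩)
  have hx' : (pathGraph a).Adj ⟨0, by omega⟩ (e.symm x) := by
    rw [← e.map_adj_iff]; simpa using hx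
  have hy' : (pathGraph a).Adj ⟨0, by omega⟩ (e.symm y) := by
    rw [← e.map_adj_iff]; simpa using hy
  rw [pathGraph_adj] at hx' hy'
  apply hxy
  apply e.symm.injective
  apply Fin.ext
  simp only at hx' hy'
  omega

/-! ### Induced paths in paths and cycles -/

/-- A sequence with steps `±1` that never turns back is an arithmetic progression. -/
theorem arith_of_steps {R : Type*} [CommRing R] (g : ℕ → R) (j : ℕ)
    (h1 : ∀ i, i + 1 < j → g (i + 1) = g i + 1 ∨ g (i + 1) = g i - 1)
    (h2 : ∀ i, i + 2 < j → g (i + 2) ≠ g i) :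
    (∀ i < j, g i = g 0 + i) ∨ ∀ i < j, g i = g 0 - i := by
  induction j with
  | zero => left; intro i hi; omega
  | succ j ih =>
    have ih := ih (fun i hi => h1 i (by omega)) (fun i hi => h2 i (by omega))
    by_cases hj0 : j = 0
    · left
      intro i hi
      obtain rfl : i = 0 := by omega
      simp
    by_cases hj1 : j = 1
    · subst hj1
      rcases h1 0 (by omega) with h | h
      · left
        intro i hi
        interval_cases i
        · simp
        · simpa using h
      · right
        intro i hi
        interval_cases i
        · simp
        · simpa using h
    obtain ⟨m, rfl⟩ : ∃ c, j = c + 2 := ⟨j - 2, by omega⟩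
    have hs := h1 (m + 1) (by omega)
    have hb := h2 m (by omega)
    rcases ih with ih | ih
    · left
      intro i hi
      rcases Nat.lt_succ_iff_lt_or_eq.1 hi with h | rfl
      · exact ih i h
      have e1 := ih m (by omega)
      have e2 := ih (m + 1) (by omega)
      rcases hs with hs | hs
      · rw [hs, e2]; push_cast; ring
      · exact absurd (by rw [hs, e2, e1]; push_cast; ring) hb
    · right
      intro i hi
      rcases Nat.lt_succ_iff_lt_or_eq.1 hi with h | rfl
      · exact ih i h
      have e1 := ih m (by omega)
      have e2 := ih (m + 1) (by omega)
      rcases hs with hs | hs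
      · exact absurd (by rw [hs, e2, e1]; push_cast; ring) hb
      · rw [hs, e2]; push_cast; ring

theorem embCount_path_one {V : Type*} (G : SimpleGraph V) :
    embCount (pathGraph 1) G = Nat.card V :=
  Nat.card_congr
    { toFun := fun f => f 0
      invFun := fun v => ⟨⟨fun _ => v, fun _ _ _ => Subsingleton.elim _ _⟩, by
        intro a b
        rw [Subsingleton.elim a b]
        simp⟩
      left_inv := fun f => by
        ext i
        rw [Subsingleton.elim i 0]
        rfl
      right_inv := fun v => rfl }

/-- The increasing and decreasing embeddings of a path into a path. -/
def pathEmbPath (j a : ℕ) (b : Bool) (s : Fin (a + 1 - j)) : pathGraph j ↪g pathGraph a where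
  toFun i := ⟨if b then s.val + i.val else s.val + (j - 1 - i.val), by
    have := s.2
    have := i.2
    split_ifs <;> omega⟩
  inj' x y h := by
    have := x.2
    have := y.2
    cases b <;> simp [Fin.ext_iff] at h ⊢ <;> omega
  map_rel_iff' {x y} := by
    have := x.2
    have := y.2
    cases b <;> simp [pathGraph_adj] <;> omega

/-- An embedded path is monotone by `arith_of_steps`, so it is given by its lowest vertex and its
direction. The two directions differ because `j ≥ 2`. -/
theorem embCount_path_path {j : ℕ} (hj : 2 ≤ j) (a : ℕ) :
    embCount (pathGraph j) (pathGraph a) = 2 * (a + 1 - j) := by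
  have hcard : Nat.card (Bool × Fin (a + 1 - j)) = 2 * (a + 1 - j) := by simp
  rw [← hcard]
  refine (Nat.card_congr (Equiv.ofBijective (fun p => pathEmbPath j a p.1 p.2) ⟨?_, ?_⟩)).symm
  · rintro ⟨b, s⟩ ⟨b', s'⟩ h
    have h0 := congrArg (fun f => (f ⟨0, by omega⟩).val) h
    have h1 := congrArg (fun f => (f ⟨1, by omega⟩).val) h
    simp only [pathEmbPath, RelEmbedding.coe_mk, Function.Embedding.coeFn_mk] at h0 h1
    cases b <;> cases b' <;> simp [Fin.ext_iff] at h0 h1 ⊢ <;> omega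
  · intro f
    let g : ℕ → ℤ := fun i => if h : i < j then ((f ⟨i, h⟩).val : ℤ) else 0
    have hg : ∀ i (h : i < j), g i = ((f ⟨i, h⟩).val : ℤ) := fun i h => dif_pos h
    have hstep := arith_of_steps g j
      (by
        intro i hi
        rw [hg i (by omega), hg (i + 1) hi]
        have : (pathGraph a).Adj (f ⟨i, by omega⟩) (f ⟨i + 1, hi⟩) := by
          rw [f.map_adj_iff, pathGraph_adj]; simp
        rw [pathGraph_adj] at this
        omega)
      (by
        intro i hi h
        rw [hg i (by omega), hg (i + 2) hi] at h
        have := f.injective (Fin.ext (by exact_mod_cast h))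
        simp at this)
    have hl := (f ⟨j - 1, by omega⟩).2
    have hl' := hg (j - 1) (by omega)
    have h0' := hg 0 (by omega)
    rcases hstep with h | h
    · have e := h (j - 1) (by omega)
      refine ⟨(true, ⟨(f ⟨0, by omega⟩).val, by omega⟩), ?_⟩
      ext i
      have := h i i.2
      rw [hg i i.2] at this
      simp only [pathEmbPath, RelEmbedding.coe_mk, Function.Embedding.coeFn_mk, if_true]
      simp only [Fin.eta] at this
      omega
    · have e := h (j - 1) (by omega)
      have hf0 := (f ⟨0, by omega⟩).2
      -- On a decreasing path the lowest vertex is the image of the last one.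
      refine ⟨(false, ⟨(f ⟨j - 1, by omega⟩).val, by omega⟩), ?_⟩
      ext i
      have := h i i.2
      have hi := i.2
      rw [hg i i.2] at this
      simp only [Fin.eta] at this
      simp [pathEmbPath]
      omega

section Cycle

open Fin.CommRing

theorem natCast_fin_inj {m a b : ℕ} (ha : a < m + 3) (hb : b < m + 3) :
    ((a : Fin (m + 3)) = (b : Fin (m + 3))) ↔ a = b := by
  constructor
  · intro h
    have := congrArg Fin.val h
    rwa [Fin.val_natCast, Fin.val_natCast, Nat.mod_eq_of_lt ha, Nat.mod_eq_of_lt hb] at this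
  · rintro rfl; rfl

/-- The bound is `m + 2` and not `m + 3`: for `a = 0`, `b = m + 2` the difference is 1 by wrapping
around. -/
theorem natCast_fin_sub_eq_one {m a b : ℕ} (ha : a < m + 2) (hb : b < m + 2) :
    (a : Fin (m + 3)) - (b : Fin (m + 3)) = 1 ↔ b + 1 = a := by
  rw [sub_eq_iff_eq_add', ← Nat.cast_add_one, natCast_fin_inj (by omega) (by omega)]
  omega

theorem cycle_add_adj {m : ℕ} (s : Fin (m + 3)) {a b : ℕ} (ha : a < m + 2) (hb : b < m + 2) :
    (cycleGraph (m + 3)).Adj (s + (a : Fin (m + 3))) (s + (b : Fin (m + 3))) ↔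
      a + 1 = b ∨ b + 1 = a := by
  rw [cycleGraph_adj, add_sub_add_left_eq_sub, add_sub_add_left_eq_sub,
    natCast_fin_sub_eq_one ha hb, natCast_fin_sub_eq_one hb ha]
  tauto

theorem cycle_sub_adj {m : ℕ} (s : Fin (m + 3)) {a b : ℕ} (ha : a < m + 2) (hb : b < m + 2) :
    (cycleGraph (m + 3)).Adj (s - (a : Fin (m + 3))) (s - (b : Fin (m + 3))) ↔
      a + 1 = b ∨ b + 1 = a := by
  rw [cycleGraph_adj, sub_sub_sub_cancel_left, sub_sub_sub_cancel_left,
    natCast_fin_sub_eq_one ha hb, natCast_fin_sub_eq_one hb ha]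

/-- The embeddings of a path into a longer cycle. -/
def pathEmbCycle {j m : ℕ} (hj : j < m + 3) (b : Bool) (s : Fin (m + 3)) :
    pathGraph j ↪g cycleGraph (m + 3) where
  toFun i := if b then s + (i.val : Fin (m + 3)) else s - (i.val : Fin (m + 3))
  inj' x y h := by
    have := x.2
    have := y.2
    apply Fin.ext
    rw [← natCast_fin_inj (m := m) (by omega) (by omega)]
    cases b
    · simpa using h
    · simpa using h
  map_rel_iff' {x y} := by
    have := x.2
    have := y.2
    cases b
    · simpa [pathGraph_adj] using cycle_sub_adj s (by omega) (by omega)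
    · simpa [pathGraph_adj] using cycle_add_adj s (by omega) (by omega)

/-- In the ring `Fin (m + 3)` adjacency means a difference of `±1` and injectivity forbids turning
back, so `arith_of_steps` applies. -/
theorem path_embedding_cycle_form {j m : ℕ}
    (f : pathGraph j ↪g cycleGraph (m + 3)) (hj0 : 0 < j) :
    (∀ i : Fin j, f i = f ⟨0, hj0⟩ + (i.val : Fin (m + 3))) ∨
      (∀ i : Fin j, f i = f ⟨0, hj0⟩ - (i.val : Fin (m + 3))) := by
  let g : ℕ → Fin (m + 3) := fun i => if h : i < j then f ⟨i, h⟩ else 0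
  have hg : ∀ i (h : i < j), g i = f ⟨i, h⟩ := fun i h => dif_pos h
  have hstep := arith_of_steps g j
    (by
      intro i hi
      rw [hg i (by omega), hg (i + 1) hi]
      have : (cycleGraph (m + 3)).Adj (f ⟨i, by omega⟩) (f ⟨i + 1, hi⟩) := by
        rw [f.map_adj_iff, pathGraph_adj]; simp
      rw [cycleGraph_adj] at this
      rcases this with h | h
      · right; rw [← h]; ring
      · left; rw [← h]; ring)
    (by
      intro i hi h
      rw [hg i (by omega), hg (i + 2) hi] at h
      have := f.injective h
      simp at this)
  rw [hg 0 hj0] at hstep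
  refine hstep.imp (fun h i => ?_) (fun h i => ?_)
  · rw [← h i i.2, hg i i.2]
  · rw [← h i i.2, hg i i.2]

theorem embCount_path_cycle_of_lt {j a : ℕ} (hj : 2 ≤ j) (ha : 3 ≤ a) (hja : j < a) :
    embCount (pathGraph j) (cycleGraph a) = 2 * a := by
  obtain ⟨m, rfl⟩ : ∃ c, a = c + 3 := ⟨a - 3, by omega⟩
  have hcard : Nat.card (Bool × Fin (m + 3)) = 2 * (m + 3) := by simp
  rw [← hcard]
  refine (Nat.card_congr (Equiv.ofBijective (fun p => pathEmbCycle hja p.1 p.2) ⟨?_, ?_⟩)).symm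
  · rintro ⟨b, s⟩ ⟨b', s'⟩ h
    have h0 := congrArg (fun f => f ⟨0, by omega⟩) h
    have h1 := congrArg (fun f => f ⟨1, by omega⟩) h
    -- The modulus is at least 3, so the second vertex tells the two directions apart.
    have h2 : (1 : Fin (m + 3)) ≠ -1 := by
      intro h
      have : (2 : ℕ) = (0 : ℕ) :=
        (natCast_fin_inj (m := m) (a := 2) (b := 0) (by omega) (by omega)).1 (by
          push_cast
          rw [← one_add_one_eq_two]
          nth_rewrite 1 [h]
          ring)
      omega
    simp only [pathEmbCycle, RelEmbedding.coe_mk, Function.Embedding.coeFn_mk] at h0 h1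
    have hs : s = s' := by cases b <;> cases b' <;> simpa using h0
    subst hs
    cases b <;> cases b'
    · rfl
    · exact absurd (by simpa [sub_eq_add_neg] using h1.symm) h2
    · exact absurd (by simpa [sub_eq_add_neg] using h1) h2
    · rfl
  · intro f
    rcases path_embedding_cycle_form f (by omega) with h | h
    · refine ⟨(true, f ⟨0, by omega⟩), ?_⟩
      apply DFunLike.ext
      intro i
      rw [h i]
      rfl
    · refine ⟨(false, f ⟨0, by omega⟩), ?_⟩
      apply DFunLike.ext
      intro i
      rw [h i]
      rfl

theorem embCount_path_cycle_of_ge {j a : ℕ} (ha : 3 ≤ a) (hja : a ≤ j) :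
    embCount (pathGraph j) (cycleGraph a) = 0 := by
  obtain ⟨m, rfl⟩ : ∃ c, a = c + 3 := ⟨a - 3, by omega⟩
  have : IsEmpty (pathGraph j ↪g cycleGraph (m + 3)) := by
    refine ⟨fun f => ?_⟩
    obtain rfl : j = m + 3 := by
      have := Fintype.card_le_of_injective _ f.injective
      simp at this
      omega
    -- A path through all vertices of the cycle would close up: its ends become adjacent, so it is
    -- not induced.
    have key : (cycleGraph (m + 3)).Adj (f ⟨0, by omega⟩) (f ⟨m + 2, by omega⟩) := by
      have e : ((m + 2 : ℕ) : Fin (m + 3)) = -1 := by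
        rw [eq_neg_iff_add_eq_zero, ← Nat.cast_add_one]
        exact Fin.natCast_self _
      rw [cycleGraph_adj]
      rcases path_embedding_cycle_form f (by omega) with h | h
      · left; rw [h ⟨m + 2, _⟩, e]; ring
      · right; rw [h ⟨m + 2, _⟩, e]; ring
    rw [f.map_adj_iff, pathGraph_adj] at key
    simp at key
  exact Nat.card_of_isEmpty

end Cycle

/-! ### Path and cycle counts of a connected graph -/

/-- The number of induced paths with `j` vertices in a path (`c = False`) or a cycle (`c = True`)
with `o` vertices. -/
def pathNum (j o : ℕ) (c : Prop) [Decidable c] : ℕ :=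
  if c then (if j < o then o else 0) else o + 1 - j

/-- A connected graph is a cycle. -/
def IsCyc {V : Type*} (G : SimpleGraph V) : Prop :=
  3 ≤ Nat.card V ∧ Nonempty (G ≃g cycleGraph (Nat.card V))

theorem iso_path_of_not_isCyc {V : Type*} [Finite V] {G : SimpleGraph V} (hG : G.Connected)
    (hd : DegLeTwo G) (h : ¬ IsCyc G) : Nonempty (G ≃g pathGraph (Nat.card V)) :=
  (path_or_cycle hG hd).resolve_right h

theorem not_isCyc_of_iso_path {V : Type*} {G : SimpleGraph V} {a : ℕ}
    (h : Nonempty (G ≃g pathGraph a)) : ¬ IsCyc G := by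
  rintro ⟨h3, ⟨e⟩⟩
  obtain ⟨e'⟩ := h
  exact not_iso_path_cycle h3 ⟨e'.symm.trans e⟩

open Classical in
theorem embCount_path {V : Type*} [Finite V] {G : SimpleGraph V} (hG : G.Connected)
    (hd : DegLeTwo G) {j : ℕ} (hj : 1 ≤ j) :
    embCount (pathGraph j) G = (if j = 1 then 1 else 2) * pathNum j (Nat.card V) (IsCyc G) := by
  rcases Nat.eq_or_lt_of_le hj with rfl | hj'
  · rw [embCount_path_one]
    unfold pathNum
    by_cases h : IsCyc G
    · have := h.1
      simp [h]
      omega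
    · simp [h]
  rw [if_neg (by omega)]
  unfold pathNum
  by_cases h : IsCyc G
  · rw [if_pos h]
    obtain ⟨h3, ⟨e⟩⟩ := h
    rw [embCount_congr_right _ e]
    split_ifs with hlt
    · exact embCount_path_cycle_of_lt hj' h3 hlt
    · exact embCount_path_cycle_of_ge h3 (by omega)
  · rw [if_neg h]
    obtain ⟨e⟩ := iso_path_of_not_isCyc hG hd h
    rw [embCount_congr_right _ e, embCount_path_path hj']

open Classical in
-- An embedded cycle exhausts a connected graph of maximum degree at most two. The number of
-- automorphisms of the cycle stays unevaluated; later only its positivity, and its value 6 for the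
-- triangle, are used.
theorem embCount_cycle {V : Type*} [Finite V] {G : SimpleGraph V} (hG : G.Connected)
    (hd : DegLeTwo G) {j : ℕ} (hj : 3 ≤ j) :
    embCount (cycleGraph j) G =
      (if IsCyc G ∧ Nat.card V = j then 1 else 0) * embCount (cycleGraph j) (cycleGraph j) := by
  split_ifs with h
  · obtain ⟨⟨h3, ⟨e⟩⟩, rfl⟩ := h
    rw [embCount_congr_right _ e, one_mul]
  · have : IsEmpty (cycleGraph j ↪g G) := by
      refine ⟨fun f => h ?_⟩
      obtain ⟨e⟩ := iso_of_cycleGraph_embedding hG hd hj f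
      obtain rfl : Nat.card V = j := by simpa using Nat.card_congr e.toEquiv
      exact ⟨⟨hj, ⟨e⟩⟩, rfl⟩
    rw [zero_mul]
    exact Nat.card_of_isEmpty

theorem embCount_cycle_self_pos (j : ℕ) : 0 < embCount (cycleGraph j) (cycleGraph j) := by
  have := finite_embedding (cycleGraph j) (cycleGraph j)
  have : Nonempty (cycleGraph j ↪g cycleGraph j) := ⟨RelEmbedding.refl _⟩
  exact Nat.card_pos

/-- To compare the counts of connected graphs of maximum degree at most two it suffices
to treat paths and cycles. -/
theorem forall_connected_of_path_cycle {p : ∀ j, SimpleGraph (Fin j) → Prop} {k : ℕ}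
    (hiso : ∀ j (F F' : SimpleGraph (Fin j)), Nonempty (F ≃g F') → p j F' → p j F)
    (hpath : ∀ j, 1 ≤ j → j ≤ k → p j (pathGraph j))
    (hcyc : ∀ j, 3 ≤ j → j ≤ k → p j (cycleGraph j))
    {j : ℕ} (hj : j ≤ k) (F : SimpleGraph (Fin j)) (hF : F.Connected) (hd : DegLeTwo F) : p j F := by
  have hj1 : 1 ≤ j := by
    have := hF.nonempty
    by_contra h
    obtain rfl : j = 0 := by omega
    exact this.elim Fin.elim0
  have h := path_or_cycle hF hd
  rw [Nat.card_eq_fintype_card, Fintype.card_fin] at h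
  rcases h with h | ⟨h3, h⟩
  · exact hiso _ _ _ h (hpath j hj1 hj)
  · exact hiso _ _ _ h (hcyc j h3 hj)

/-! ### Additivity over components -/

theorem mk_eq_of_embedding {V W : Type*} {F : SimpleGraph W} {G : SimpleGraph V}
    (hF : F.Connected) {U : Set V} (f : F ↪g G.induce U) (x y : W) :
    G.connectedComponentMk (f x).1 = G.connectedComponentMk (f y).1 :=
  ConnectedComponent.sound
    ((hF.preconnected x y).map ((Embedding.induce U).toHom.comp f.toHom))

/-- A connected graph embeds in a union of components through one of them. -/
theorem embCount_induce_components {V W : Type*} [Finite V] [Finite W] {F : SimpleGraph W}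
    (hF : F.Connected) (G : SimpleGraph V) (T : Finset G.ConnectedComponent) :
    embCount F (G.induce {v | G.connectedComponentMk v ∈ T}) =
      ∑ c ∈ T, embCount F c.toSimpleGraph := by
  classical
  have hfin := fun c : G.ConnectedComponent => finite_embedding F c.toSimpleGraph
  rw [← Finset.sum_coe_sort]
  unfold embCount
  rw [← Nat.card_sigma]
  have x₀ : W := hF.nonempty.some
  let incl : ∀ c : T, c.1.toSimpleGraph ↪g G.induce {v | G.connectedComponentMk v ∈ T} := fun c =>
    { toFun := fun v => ⟨v.1, by
        have h : G.connectedComponentMk v.1 = c.1 := v.2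
        change G.connectedComponentMk v.1 ∈ T
        rw [h]
        exact c.2⟩
      inj' := fun a b h => Subtype.ext (congrArg (fun z => z.1) h)
      map_rel_iff' := Iff.rfl }
  refine (Nat.card_congr (Equiv.ofBijective (fun p => (incl p.1).comp p.2) ⟨?_, ?_⟩)).symm
  · rintro ⟨c, f⟩ ⟨c', f'⟩ h
    have hx : ∀ x, (f x).1 = (f' x).1 := fun x => congrArg (fun g => (g x).1) h
    have hcc : c = c' := by
      apply Subtype.ext
      rw [← show G.connectedComponentMk (f x₀).1 = c.1 from (f x₀).2,
        ← show G.connectedComponentMk (f' x₀).1 = c'.1 from (f' x₀).2, hx]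
    subst hcc
    have : f = f' := by
      ext x
      exact hx x
    rw [this]
  · intro f
    refine ⟨⟨⟨G.connectedComponentMk (f x₀).1, (f x₀).2⟩,
      ⟨⟨fun x => ⟨(f x).1, mk_eq_of_embedding hF f x x₀⟩, fun x y h => ?_⟩, ?_⟩⟩, ?_⟩
    · exact f.injective (Subtype.ext (congrArg (fun z => z.1) h))
    · intro a b
      exact f.map_adj_iff
    · ext x
      rfl

theorem embCount_eq_sum_components {V W : Type*} [Finite V] [Finite W] {F : SimpleGraph W}
    (hF : F.Connected) (G : SimpleGraph V) [Fintype G.ConnectedComponent] :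
    embCount F G = ∑ c : G.ConnectedComponent, embCount F c.toSimpleGraph := by
  rw [← embCount_induce_components hF]
  refine (embCount_congr_right F ⟨Equiv.subtypeUnivEquiv ?_, Iff.rfl⟩).symm
  intro v
  simp

theorem embCount_sum {V V' W : Type*} [Finite V] [Finite V'] [Finite W] {F : SimpleGraph W}
    (hF : F.Connected) (G : SimpleGraph V) (H : SimpleGraph V') :
    embCount F (G ⊕g H) = embCount F G + embCount F H := by
  have h1 := finite_embedding F G
  have h2 := finite_embedding F H
  have x₀ : W := hF.nonempty.some
  unfold embCount
  rw [← Nat.card_sum]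
  refine (Nat.card_congr (Equiv.ofBijective (Sum.elim (fun f => Embedding.sumInl.comp f)
    (fun f => Embedding.sumInr.comp f)) ⟨?_, ?_⟩)).symm
  · rintro (f | f) (f' | f') h
    · refine congrArg Sum.inl ?_
      ext x
      exact Sum.inl_injective (congrArg (fun g => g x) h)
    · exact absurd (congrArg (fun g => g x₀) h) (by simp)
    · exact absurd (congrArg (fun g => g x₀) h) (by simp)
    · refine congrArg Sum.inr ?_
      ext x
      exact Sum.inr_injective (congrArg (fun g => g x) h)
  · intro f
    -- No edge crosses between the summands, so a connected graph lands on one side.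
    have key : ∀ x y, (f x).isLeft = (f y).isLeft := by
      intro x y
      obtain ⟨p⟩ := hF.preconnected x y
      induction p with
      | nil => rfl
      | cons h p ih =>
        rw [← ih]
        have := f.map_adj_iff.2 h
        revert this
        rename_i a b c
        rcases f a with u | u <;> rcases f b with w | w <;> simp
    rcases h0 : (f x₀).isLeft with _ | _
    · have hx : ∀ x, ∃ v, f x = Sum.inr v := by
        intro x
        have := key x x₀
        rw [h0] at this
        exact Sum.isRight_iff.1 (by simpa using this)
      choose g hg using hx
      refine ⟨Sum.inr ⟨⟨g, fun x y h => f.injective (by rw [hg, hg, h])⟩, ?_⟩, ?_⟩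
      · intro a b
        rw [← f.map_adj_iff, hg, hg]
        simp only [SimpleGraph.sum_adj]
        rfl
      · ext1 x
        exact (hg x).symm
    · have hx : ∀ x, ∃ v, f x = Sum.inl v := by
        intro x
        have := key x x₀
        rw [h0] at this
        exact Sum.isLeft_iff.1 (by simpa using this)
      choose g hg using hx
      refine ⟨Sum.inl ⟨⟨g, fun x y h => f.injective (by rw [hg, hg, h])⟩, ?_⟩, ?_⟩
      · intro a b
        rw [← f.map_adj_iff, hg, hg]
        simp only [SimpleGraph.sum_adj]
        rfl
      · ext1 x
        exact (hg x).symm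

/-- Graphs with matching components are isomorphic. -/
theorem iso_of_components {V V' : Type*} {G : SimpleGraph V} {H : SimpleGraph V'}
    (e : G.ConnectedComponent ≃ H.ConnectedComponent)
    (h : ∀ c, Nonempty (c.toSimpleGraph ≃g (e c).toSimpleGraph)) : Nonempty (G ≃g H) := by
  let i := fun c => (h c).some
  let f : V → V' := fun v => (i (G.connectedComponentMk v) ⟨v, rfl⟩).1
  have hf : ∀ (c : G.ConnectedComponent) (v : V) (hv : v ∈ c), f v = (i c ⟨v, hv⟩).1 := by
    rintro c v hv
    obtain rfl : G.connectedComponentMk v = c := hv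
    rfl
  have hmk : ∀ v, H.connectedComponentMk (f v) = e (G.connectedComponentMk v) :=
    fun v => (i (G.connectedComponentMk v) ⟨v, rfl⟩).2
  have hinj : Function.Injective f := by
    intro v w hvw
    have hc : G.connectedComponentMk w = G.connectedComponentMk v :=
      e.injective (by rw [← hmk, ← hmk, hvw])
    rw [hf _ v rfl, hf (G.connectedComponentMk v) w hc] at hvw
    exact congrArg Subtype.val ((i _).injective (Subtype.ext hvw))
  have hsurj : Function.Surjective f := by
    intro w
    obtain ⟨c, hc⟩ := e.surjective (H.connectedComponentMk w)
    refine ⟨((i c).symm ⟨w, hc.symm⟩).1, ?_⟩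
    rw [hf c _ ((i c).symm ⟨w, hc.symm⟩).2]
    simp
  refine ⟨⟨Equiv.ofBijective f ⟨hinj, hsurj⟩, ?_⟩⟩
  intro a b
  change H.Adj (f a) (f b) ↔ G.Adj a b
  by_cases hab : G.connectedComponentMk b = G.connectedComponentMk a
  · rw [hf _ a rfl, hf (G.connectedComponentMk a) b hab]
    exact (i (G.connectedComponentMk a)).map_adj_iff (v := ⟨a, rfl⟩) (w := ⟨b, hab⟩)
  · constructor
    · intro h
      have := ConnectedComponent.sound h.reachable
      rw [hmk, hmk] at this
      exact absurd (e.injective this).symm hab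
    · intro h
      exact absurd (ConnectedComponent.sound h.reachable).symm hab

theorem DegLeTwo.component {V : Type*} {G : SimpleGraph V} (hG : DegLeTwo G)
    (c : G.ConnectedComponent) : DegLeTwo c.toSimpleGraph :=
  hG.of_embedding (Embedding.induce c.supp)

section Counts

variable {V : Type*} [Finite V] (G : SimpleGraph V) [Fintype G.ConnectedComponent]

open Classical in
/-- The number of induced paths with `j` vertices in a graph of maximum degree at most two. -/
noncomputable def pathTotal (j : ℕ) : ℕ :=
  ∑ c : G.ConnectedComponent, pathNum j (Nat.card c) (IsCyc c.toSimpleGraph)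

open Classical in
/-- The number of cycle components with `j` vertices. -/
noncomputable def cycleTotal (j : ℕ) : ℕ :=
  (Finset.univ.filter fun c : G.ConnectedComponent =>
    IsCyc c.toSimpleGraph ∧ Nat.card c = j).card

variable {G}

theorem embCount_path_eq_pathTotal (hd : DegLeTwo G) {j : ℕ} (hj : 1 ≤ j) :
    embCount (pathGraph j) G = (if j = 1 then 1 else 2) * pathTotal G j := by
  rw [embCount_eq_sum_components (pathGraph_connected' hj), pathTotal, Finset.mul_sum]
  exact Finset.sum_congr rfl fun c _ =>
    embCount_path c.connected_toSimpleGraph (hd.component c) hj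

theorem embCount_cycle_eq_cycleTotal (hd : DegLeTwo G) {j : ℕ} (hj : 3 ≤ j) :
    embCount (cycleGraph j) G =
      cycleTotal G j * embCount (cycleGraph j) (cycleGraph j) := by
  rw [embCount_eq_sum_components (cycleGraph_connected' (by omega)), cycleTotal,
    Finset.card_filter, Finset.sum_mul]
  exact Finset.sum_congr rfl fun c _ =>
    embCount_cycle c.connected_toSimpleGraph (hd.component c) hj

end Counts

/-! ### Recovering component sizes from path and cycle totals -/

section Shape

variable {ι : Type*} [Fintype ι] (o : ι → ℕ) (c : ι → Prop) [DecidablePred c]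

/-- The number of paths with at least `j` vertices. -/
def longPaths (j : ℕ) : ℕ := (Finset.univ.filter fun i => ¬ c i ∧ j ≤ o i).card

/-- The number of components with `a` vertices that are paths or cycles, respectively. -/
def shapeCount (a : ℕ) (b : Prop) [Decidable b] : ℕ :=
  (Finset.univ.filter fun i => o i = a ∧ (c i ↔ b)).card

/-- From `j` to `j + 1` a path with at least `j` vertices loses one subpath and shorter paths lose
none. Cycles keep their contribution, except `C_{j+1}`, whose contribution drops from `j + 1` to 0.
-/
theorem longPaths_add (j : ℕ) : longPaths o c j + ∑ i, pathNum (j + 1) (o i) (c i) +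
    (j + 1) * shapeCount o c (j + 1) True = ∑ i, pathNum j (o i) (c i) := by
  rw [longPaths, shapeCount, Finset.card_filter, Finset.card_filter, Finset.mul_sum,
    ← Finset.sum_add_distrib, ← Finset.sum_add_distrib]
  refine Finset.sum_congr rfl fun i _ => ?_
  unfold pathNum
  by_cases h : c i
  · simp only [h, not_true_eq_false, false_and, if_false, if_true, and_true]
    split_ifs <;> omega
  · simp only [h, not_false_eq_true, true_and, if_false, iff_true, and_false]
    split_ifs <;> omega

theorem shapeCount_add_longPaths (j : ℕ) :
    shapeCount o c j False + longPaths o c (j + 1) = longPaths o c j := by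
  rw [longPaths, shapeCount, longPaths, Finset.card_filter, Finset.card_filter, Finset.card_filter,
    ← Finset.sum_add_distrib]
  refine Finset.sum_congr rfl fun i _ => ?_
  by_cases h : c i
  · simp [h]
  · simp only [h, not_false_eq_true, and_true, true_and]
    split_ifs <;> omega

/-- The number of long paths with `a` vertices, computed from the number `x` of long paths and
the number `T` of induced paths with `k` vertices. -/
def highPath (k x T a : ℕ) : ℕ :=
  if T ≤ 1 then (if a = k then T else if a + 1 = k then x - T else 0)
  else if x = 0 then 0 else if a + 1 = T + k then 1 else 0

/-- The number of long cycles with `a` vertices, computed in the same way. -/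
def highCycle (x T a : ℕ) : ℕ :=
  if T ≤ 1 then 0 else if x = 0 then (if a = T then 1 else 0) else 0

/-- There are few enough long components for their sizes to be determined. -/
def FewLong (k x T : ℕ) : Prop := (x = 0 ∧ T ≤ 2 * k + 1) ∨ (x = 1 ∧ T ≤ k) ∨ T ≤ 1

variable {o c}

/-- A cycle with more than `k` vertices adds its length to `T`, a path with `o ≥ k` vertices adds `o
+ 1 - k`. If `T ≤ 1`, there are no such cycles, and the long paths are `T` copies of `P_k` and `x -
T` of `P_{k-1}`. Otherwise `x = 0` leaves a single cycle, of length `T`, and `x = 1` with `T ≤ k`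
leaves a single path, with `T + k - 1` vertices. -/
theorem shapeCount_high {k x T : ℕ} (hk : 2 ≤ k) (hx : longPaths o c (k - 1) = x)
    (hT : ∑ i, pathNum k (o i) (c i) = T) (hD : FewLong k x T) :
    (∀ a, k ≤ a + 1 → shapeCount o c a False = highPath k x T a) ∧
      ∀ a, k < a → shapeCount o c a True = highCycle x T a := by
  classical
  have hle : ∀ i, pathNum k (o i) (c i) ≤ T := fun i => by
    rw [← hT]
    exact Finset.single_le_sum (f := fun i => pathNum k (o i) (c i)) (fun _ _ => Nat.zero_le _)
      (Finset.mem_univ i)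
  have hcyc : T ≤ k → ∀ i, c i → o i ≤ k := by
    intro hTk i hi
    have := hle i
    simp only [pathNum, hi, if_true] at this
    split_ifs at this <;> omega
  by_cases hT1 : T ≤ 1
  · have hpath : ∀ i, ¬ c i → o i ≤ k := by
      intro i hi
      have := hle i
      simp only [pathNum, hi, if_false] at this
      omega
    have hkk : shapeCount o c k False = T := by
      rw [← hT, shapeCount, Finset.card_filter]
      refine Finset.sum_congr rfl fun i _ => ?_
      unfold pathNum
      by_cases h : c i
      · have := hcyc (by omega) i h
        simp [h, this]
      · have := hpath i h
        simp only [h, and_true, if_false]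
        split_ifs <;> omega
    have hkm : longPaths o c k = T := by
      have h1 := shapeCount_add_longPaths o c k
      have h2 : longPaths o c (k + 1) = 0 := by
        rw [longPaths, Finset.card_eq_zero, Finset.filter_eq_empty_iff]
        rintro i - ⟨h, h'⟩
        have := hpath i h
        omega
      omega
    constructor
    · intro a ha
      simp only [highPath, hT1, if_true]
      split_ifs with h1 h2
      · rw [h1, hkk]
      · have h3 := shapeCount_add_longPaths o c a
        rw [h2, hkm, show a = k - 1 by omega, hx] at h3
        rw [show a = k - 1 by omega]
        omega
      · rw [shapeCount, Finset.card_eq_zero, Finset.filter_eq_empty_iff]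
        rintro i - ⟨rfl, h⟩
        have := hpath i (by simpa using h)
        omega
    · intro a ha
      simp only [highCycle, hT1, if_true]
      rw [shapeCount, Finset.card_eq_zero, Finset.filter_eq_empty_iff]
      rintro i - ⟨rfl, h⟩
      have := hcyc (by omega) i (by simpa using h)
      omega
  rcases hD with ⟨rfl, hT2⟩ | ⟨rfl, hTk⟩ | h
  · have hpath : ∀ i, ¬ c i → o i + 1 < k := by
      intro i hi
      by_contra hcon
      rw [longPaths, Finset.card_eq_zero, Finset.filter_eq_empty_iff] at hx
      exact hx (Finset.mem_univ i) ⟨hi, by omega⟩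
    constructor
    · intro a ha
      simp only [highPath, hT1, if_true, if_false]
      rw [shapeCount, Finset.card_eq_zero, Finset.filter_eq_empty_iff]
      rintro i - ⟨rfl, h⟩
      have := hpath i (by simpa using h)
      omega
    · intro a ha
      simp only [highCycle, hT1, if_true, if_false]
      obtain ⟨i₀, -, hi₀⟩ : ∃ i ∈ Finset.univ, pathNum k (o i) (c i) ≠ 0 := by
        apply Finset.exists_ne_zero_of_sum_ne_zero
        omega
      have hc₀ : c i₀ := by
        by_contra h
        have := hpath i₀ h
        simp only [pathNum, h, if_false] at hi₀
        omega
      have ho₀ : k < o i₀ := by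
        simp only [pathNum, hc₀, if_true] at hi₀
        by_contra h
        simp [h] at hi₀
      have hp₀ : pathNum k (o i₀) (c i₀) = o i₀ := by simp [pathNum, hc₀, ho₀]
      -- Two cycles longer than `k` would contribute at least `2 * k + 2` to `T`.
      have hzero : ∀ i, i ≠ i₀ → c i → o i ≤ k := by
        intro i hne hi
        by_contra h
        have h1 : pathNum k (o i) (c i) = o i := by simp [pathNum, hi, not_le.1 h]
        have h2 : pathNum k (o i) (c i) + pathNum k (o i₀) (c i₀) ≤ T := by
          rw [← hT, ← Finset.sum_pair (f := fun i => pathNum k (o i) (c i)) hne]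
          exact Finset.sum_le_sum_of_subset (Finset.subset_univ _)
        omega
      have hTo : T = o i₀ := by
        rw [← hT, ← hp₀]
        refine Finset.sum_eq_single i₀ (fun i _ hne => ?_) (by simp)
        unfold pathNum
        by_cases h : c i
        · have := hzero i hne h
          simp [h, this]
        · have := hpath i h
          simp only [h, if_false]
          omega
      have hfil : (Finset.univ.filter fun i => o i = a ∧ (c i ↔ True)) =
          if a = T then {i₀} else ∅ := by
        ext i
        simp only [Finset.mem_filter, Finset.mem_univ, true_and, iff_true]
        by_cases hi : i = i₀
        · subst hi
          split_ifs <;> simp [hc₀] <;> omega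
        · have : ¬ (o i = a ∧ c i) := fun h => by
            have := hzero i hi h.2
            omega
          simp only [this, false_iff]
          split_ifs <;> simp [hi]
      rw [shapeCount, hfil]
      split_ifs <;> simp
  · obtain ⟨i₀, hi₀⟩ := Finset.card_eq_one.1 hx
    have hmem : ∀ i, (¬ c i ∧ k - 1 ≤ o i) ↔ i = i₀ := by
      intro i
      rw [← Finset.mem_singleton, ← hi₀]
      simp
    have h₀ := (hmem i₀).2 rfl
    have hTo : T = o i₀ + 1 - k := by
      rw [← hT, show o i₀ + 1 - k = pathNum k (o i₀) (c i₀) by simp [pathNum, h₀.1]]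
      refine Finset.sum_eq_single i₀ (fun i _ hne => ?_) (by simp)
      unfold pathNum
      by_cases h : c i
      · have := hcyc hTk i h
        simp [h, this]
      · have : ¬ k - 1 ≤ o i := fun h' => hne ((hmem i).1 ⟨h, h'⟩)
        simp only [h, if_false]
        omega
    constructor
    · intro a ha
      simp only [highPath, hT1, if_false, one_ne_zero]
      have hfil : (Finset.univ.filter fun i => o i = a ∧ (c i ↔ False)) =
          if a + 1 = T + k then {i₀} else ∅ := by
        ext i
        simp only [Finset.mem_filter, Finset.mem_univ, true_and, iff_false]
        by_cases hi : i = i₀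
        · subst hi
          split_ifs <;> simp [h₀.1] <;> omega
        · have : ¬ (o i = a ∧ ¬ c i) := fun h => hi ((hmem i).1 ⟨h.2, by omega⟩)
          simp only [this, false_iff]
          split_ifs <;> simp [hi]
      rw [shapeCount, hfil]
      split_ifs <;> simp
    · intro a ha
      simp only [highCycle, hT1, if_false, one_ne_zero]
      rw [shapeCount, Finset.card_eq_zero, Finset.filter_eq_empty_iff]
      rintro i - ⟨rfl, h⟩
      have := hcyc hTk i (by simpa using h)
      omega
  · omega

/-- The maps `i ↦ (o i, c i)` and `i ↦ (o' i, c' i)` have fibres of equal size, and bijections of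
the fibres are put together. -/
theorem exists_equiv_of_shapeCount {ι' : Type*} [Fintype ι'] {o' : ι' → ℕ} {c' : ι' → Prop}
    [DecidablePred c']
    (hp : ∀ a, shapeCount o c a False = shapeCount o' c' a False)
    (hcy : ∀ a, shapeCount o c a True = shapeCount o' c' a True) :
    ∃ e : ι ≃ ι', ∀ i, o' (e i) = o i ∧ (c' (e i) ↔ c i) := by
  classical
  have key : ∀ p : ℕ × Prop, Nonempty ({i // (o i, c i) = p} ≃ {i // (o' i, c' i) = p}) := by
    rintro ⟨a, b⟩
    rw [← Fintype.card_eq, Fintype.card_subtype, Fintype.card_subtype]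
    simp only [Prod.mk.injEq, eq_iff_iff]
    by_cases hb : b
    · have := hcy a
      unfold shapeCount at this
      simpa [hb] using this
    · have := hp a
      unfold shapeCount at this
      simpa [hb] using this
  let E := fun p => (key p).some
  refine ⟨(Equiv.sigmaFiberEquiv (fun i => (o i, c i))).symm.trans
    ((Equiv.sigmaCongrRight E).trans (Equiv.sigmaFiberEquiv (fun i => (o' i, c' i)))), fun i => ?_⟩
  have h := (E (o i, c i) ⟨i, rfl⟩).2
  simp only [Prod.mk.injEq, eq_iff_iff] at h
  exact h

/-- Shapes with few long components are determined by the numbers of their induced paths and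
cycles with at most `k` vertices. -/
theorem exists_equiv_of_totals {ι' : Type*} [Fintype ι'] {o' : ι' → ℕ} {c' : ι' → Prop}
    [DecidablePred c'] {k : ℕ} (hk : 2 ≤ k) (ho : ∀ i, 1 ≤ o i) (ho' : ∀ i, 1 ≤ o' i)
    (hc : ∀ i, c i → 3 ≤ o i) (hc' : ∀ i, c' i → 3 ≤ o' i)
    (hp : ∀ j, 1 ≤ j → j ≤ k →
      ∑ i, pathNum j (o i) (c i) = ∑ i, pathNum j (o' i) (c' i))
    (hcy : ∀ j, 3 ≤ j → j ≤ k → shapeCount o c j True = shapeCount o' c' j True)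
    (hD : FewLong k (longPaths o c (k - 1)) (∑ i, pathNum k (o i) (c i))) :
    ∃ e : ι ≃ ι', ∀ i, o' (e i) = o i ∧ (c' (e i) ↔ c i) := by
  have hcy' : ∀ j, j ≤ k → shapeCount o c j True = shapeCount o' c' j True := by
    intro j hj
    by_cases h3 : 3 ≤ j
    · exact hcy j h3 hj
    have e1 : shapeCount o c j True = 0 := by
      rw [shapeCount, Finset.card_eq_zero, Finset.filter_eq_empty_iff]
      rintro i - ⟨rfl, h⟩
      exact h3 (hc i (by simpa using h))
    have e2 : shapeCount o' c' j True = 0 := by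
      rw [shapeCount, Finset.card_eq_zero, Finset.filter_eq_empty_iff]
      rintro i - ⟨rfl, h⟩
      exact h3 (hc' i (by simpa using h))
    rw [e1, e2]
  -- The difference at `j` involves totals for `j + 1`, so it is available only for `j < k`; a
  -- further difference gives the exact path sizes up to `k - 2`.
  have hlong : ∀ j, 1 ≤ j → j < k → longPaths o c j = longPaths o' c' j := by
    intro j h1 hj
    have e1 := longPaths_add o c j
    have e2 := longPaths_add o' c' j
    rw [hp (j + 1) (by omega) (by omega), hcy' (j + 1) (by omega), hp j h1 (by omega)] at e1
    omega
  obtain ⟨hG1, hG2⟩ := shapeCount_high hk rfl rfl hD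
  -- `x` and `T` agree for both shapes, so `FewLong` carries over and both have the same long
  -- components.
  rw [hlong (k - 1) (by omega) (by omega), hp k (by omega) le_rfl] at hD hG1 hG2
  obtain ⟨hH1, hH2⟩ := shapeCount_high hk rfl rfl hD
  apply exists_equiv_of_shapeCount
  · intro a
    by_cases ha0 : a = 0
    · subst ha0
      have e1 : shapeCount o c 0 False = 0 := by
        rw [shapeCount, Finset.card_eq_zero, Finset.filter_eq_empty_iff]
        rintro i - ⟨h, -⟩
        have := ho i
        omega
      have e2 : shapeCount o' c' 0 False = 0 := by
        rw [shapeCount, Finset.card_eq_zero, Finset.filter_eq_empty_iff]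
        rintro i - ⟨h, -⟩
        have := ho' i
        omega
      rw [e1, e2]
    by_cases ha : k ≤ a + 1
    · rw [hG1 a ha, hH1 a ha]
    · have e1 := shapeCount_add_longPaths o c a
      have e2 := shapeCount_add_longPaths o' c' a
      rw [hlong a (by omega) (by omega), hlong (a + 1) (by omega) (by omega)] at e1
      omega
  · intro a
    by_cases ha : k < a
    · rw [hG2 a ha, hH2 a ha]
    · exact hcy' a (by omega)

/-- The bounds on `k` in terms of the largest and the second largest size that make `k` at least
the parameter `k_G`. -/
structure LargeEnough (o : ι → ℕ) (c : ι → Prop) (k m q : ℕ) (t : ι) : Prop where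
  top : o t = m
  le_top : ∀ i, o i ≤ m
  le_second : ∀ i, i ≠ t → o i ≤ q
  half : m / 2 ≤ k
  half_path : (∃ i, ¬ c i ∧ o i = m) → m / 2 + 1 ≤ k
  second : q ≤ k
  second_path : q + 1 < m → (∃ i, ¬ c i ∧ o i = q) → q + 2 ≤ k
  second_path_pred : q + 1 = m → (∃ i, ¬ c i ∧ o i = q) → q + 1 ≤ k
  second_shorter : q < m → (∃ i, ¬ c i ∧ o i = q - 1) → (¬ ∃ i, ¬ c i ∧ o i = q) → q + 1 ≤ k
  second_twice : q = m → (∃ i i', i ≠ i' ∧ (¬ c i ∧ o i = m) ∧ ¬ c i' ∧ o i' = m) → q + 1 ≤ k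

/-- Suppose a path other than `t` has at least `k - 1` vertices. Then `q ≥ k - 1`, and the
conditions on the second size force `m ≤ k` and allow at most one `P_k`, so `T ≤ 1`. Otherwise all
components except `t` contribute nothing to `T`, and the conditions on half of `m` bound the
contribution of `t`. -/
theorem LargeEnough.fewLong {k m q : ℕ} {t : ι} (hk : 2 ≤ k) (h : LargeEnough o c k m q t) :
    FewLong k (longPaths o c (k - 1)) (∑ i, pathNum k (o i) (c i)) := by
  classical
  by_cases hex : ∃ i, i ≠ t ∧ ¬ c i ∧ k - 1 ≤ o i
  · obtain ⟨i, hit, hci, hki⟩ := hex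
    have hiq := h.le_second i hit
    have hqk := h.second
    have him := h.le_top i
    have hqc : q ≤ m → m ≤ k := by
      intro hqm
      rcases hqm.eq_or_lt with e | hlt
      · omega
      by_cases hpq : ∃ i, ¬ c i ∧ o i = q
      · by_cases h1 : q + 1 < m
        · have := h.second_path h1 hpq
          omega
        · have := h.second_path_pred (by omega) hpq
          omega
      · have hne : o i ≠ q := fun e => hpq ⟨i, hci, e⟩
        have := h.second_shorter hlt ⟨i, hci, by omega⟩ hpq
        omega
    have hmk : m ≤ k := by
      rcases le_total q m with h' | h'
      · exact hqc h'
      · omega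
    right; right
    have hval : ∀ j, pathNum k (o j) (c j) = if ¬ c j ∧ o j = k then 1 else 0 := by
      intro j
      have := h.le_top j
      unfold pathNum
      by_cases hj : c j
      · simp [hj]
        omega
      · simp only [hj, if_false, not_false_eq_true, true_and]
        split_ifs <;> omega
    simp only [hval]
    rw [← Finset.card_filter, Finset.card_le_one]
    intro a ha b hb
    simp only [Finset.mem_filter, Finset.mem_univ, true_and] at ha hb
    by_contra hab
    have ham := h.le_top a
    -- Of two copies of `P_k` one is not `t`, so `q ≥ k`, against `second_twice`.
    have hother : ∃ z, z ≠ t ∧ o z = k := by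
      by_cases hat : a = t
      · exact ⟨b, fun hbt => hab (hat.trans hbt.symm), hb.2⟩
      · exact ⟨a, hat, ha.2⟩
    obtain ⟨z, hzt, hz⟩ := hother
    have hzq := h.le_second z hzt
    have := h.second_twice (by omega)
      ⟨a, b, hab, ⟨ha.1, by omega⟩, hb.1, by omega⟩
    omega
  · push Not at hex
    have hrest : ∀ i, i ≠ t → pathNum k (o i) (c i) = 0 := by
      intro i hi
      have h1 := h.le_second i hi
      have h2 := h.second
      unfold pathNum
      by_cases hc : c i
      · simp [hc]
        omega
      · have := hex i hi hc
        simp only [hc, if_false]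
        omega
    rw [Finset.sum_eq_single t (fun i _ hi => hrest i hi) (by simp)]
    have htop := h.top
    by_cases hct : c t
    · left
      constructor
      · rw [longPaths, Finset.card_eq_zero, Finset.filter_eq_empty_iff]
        rintro i - ⟨hi, hi'⟩
        have := hex i (fun e => hi (e ▸ hct)) hi
        omega
      · have := h.half
        simp only [pathNum, hct, if_true]
        split_ifs <;> omega
    by_cases hlt : k - 1 ≤ o t
    · right; left
      have := h.half_path ⟨t, hct, htop⟩
      constructor
      · rw [longPaths, Finset.card_eq_one]
        refine ⟨t, ?_⟩
        ext i
        simp only [Finset.mem_filter, Finset.mem_univ, true_and, Finset.mem_singleton]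
        constructor
        · rintro ⟨hi, hi'⟩
          by_contra hne
          have := hex i hne hi
          omega
        · rintro rfl
          exact ⟨hct, hlt⟩
      · simp only [pathNum, hct, if_false]
        omega
    · left
      constructor
      · rw [longPaths, Finset.card_eq_zero, Finset.filter_eq_empty_iff]
        rintro i - ⟨hi, hi'⟩
        by_cases hit : i = t
        · subst hit
          exact hlt hi'
        · have := hex i hit hi
          omega
      · simp only [pathNum, hct, if_false]
        omega

end Shape

/-! ### The parameter `k_G` in terms of components -/

section Parameters

variable {V : Type*} [Fintype V] {G : SimpleGraph V}

theorem hasComponent_path_iff (hd : DegLeTwo G) (j : ℕ) : HasComponent G (pathGraph j) ↔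
    ∃ c : G.ConnectedComponent, ¬ IsCyc c.toSimpleGraph ∧ Nat.card c = j := by
  refine exists_congr fun c => ⟨fun h => ⟨not_isCyc_of_iso_path h, ?_⟩, ?_⟩
  · obtain ⟨e⟩ := h
    simpa using Nat.card_congr e.toEquiv
  · rintro ⟨h, rfl⟩
    exact iso_path_of_not_isCyc c.connected_toSimpleGraph (hd.component c) h

theorem iso_cycle_iff {V : Type*} {G : SimpleGraph V} {j : ℕ} (hj : 3 ≤ j) :
    Nonempty (G ≃g cycleGraph j) ↔ IsCyc G ∧ Nat.card V = j := by
  constructor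
  · rintro ⟨e⟩
    have h : Nat.card V = j := by simpa using Nat.card_congr e.toEquiv
    subst h
    exact ⟨⟨hj, ⟨e⟩⟩, rfl⟩
  · rintro ⟨h, rfl⟩
    exact h.2

theorem hasComponent_cycle_iff {V : Type*} {G : SimpleGraph V} {j : ℕ} (hj : 3 ≤ j) :
    HasComponent G (cycleGraph j) ↔
    ∃ c : G.ConnectedComponent, IsCyc c.toSimpleGraph ∧ Nat.card c = j :=
  exists_congr fun _ => iso_cycle_iff hj

open Classical in
theorem componentCount_path [Fintype G.ConnectedComponent] (hd : DegLeTwo G) (j : ℕ) :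
    componentCount G (pathGraph j) = shapeCount (fun c : G.ConnectedComponent => Nat.card c)
      (fun c => IsCyc c.toSimpleGraph) j False := by
  rw [componentCount, shapeCount, Nat.card_eq_fintype_card, Fintype.card_subtype]
  congr 1
  ext c
  simp only [Finset.mem_filter, Finset.mem_univ, true_and, iff_false]
  constructor
  · intro h
    refine ⟨?_, not_isCyc_of_iso_path h⟩
    obtain ⟨e⟩ := h
    simpa using Nat.card_congr e.toEquiv
  · rintro ⟨rfl, h⟩
    exact iso_path_of_not_isCyc c.connected_toSimpleGraph (hd.component c) h

open Classical in
theorem componentCount_cycle {V : Type*} {G : SimpleGraph V} [Fintype G.ConnectedComponent]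
    {j : ℕ} (hj : 3 ≤ j) :
    componentCount G (cycleGraph j) = shapeCount (fun c : G.ConnectedComponent => Nat.card c)
      (fun c => IsCyc c.toSimpleGraph) j True := by
  rw [componentCount, shapeCount, Nat.card_eq_fintype_card, Fintype.card_subtype]
  congr 1
  ext c
  simp only [Finset.mem_filter, Finset.mem_univ, true_and, iff_true]
  rw [iso_cycle_iff hj, and_comm]

theorem card_component_pos (c : G.ConnectedComponent) : 1 ≤ Nat.card c := by
  have : Nonempty c := c.connected_toSimpleGraph.nonempty
  exact Nat.card_pos

/-- A largest component, and the size of a second largest component. -/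
theorem exists_largest [Nonempty V] (G : SimpleGraph V) : ∃ t : G.ConnectedComponent,
    Nat.card t = largestOrder G ∧
    (∀ c : G.ConnectedComponent, Nat.card c ≤ largestOrder G) ∧
    (∀ c : G.ConnectedComponent, c ≠ t → Nat.card c ≤ secondOrder G) ∧
    (secondOrder G = 0 ∨ ∃ u : G.ConnectedComponent, u ≠ t ∧ Nat.card u = secondOrder G) ∧
    secondOrder G ≤ largestOrder G := by
  classical
  -- The instance used in `componentOrders`, so that `hco` holds by `rfl`.
  let I : Fintype G.ConnectedComponent := Fintype.ofFinite _
  let o : G.ConnectedComponent → ℕ := fun c => Nat.card c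
  have hco : componentOrders G = Finset.univ.val.map o := rfl
  have hl : largestOrder G = Finset.univ.sup o := by
    rw [largestOrder, hco, Finset.sup_def]
  have hne : (Finset.univ : Finset G.ConnectedComponent).Nonempty :=
    ⟨G.connectedComponentMk (Classical.arbitrary V), Finset.mem_univ _⟩
  obtain ⟨t, -, ht⟩ := Finset.exists_mem_eq_sup _ hne o
  have hs : secondOrder G = (Finset.univ.erase t).sup o := by
    rw [secondOrder, hl, ht, hco, Finset.sup_def, Finset.erase_val,
      Multiset.map_erase_of_mem _ _ (Finset.mem_univ_val t)]
  refine ⟨t, by rw [hl, ht], fun c => ?_, fun c hc => ?_, ?_, ?_⟩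
  · rw [hl]
    exact Finset.le_sup (f := o) (Finset.mem_univ c)
  · rw [hs]
    exact Finset.le_sup (f := o) (Finset.mem_erase.2 ⟨hc, Finset.mem_univ c⟩)
  · rcases (Finset.univ.erase t).eq_empty_or_nonempty with h | h
    · left
      rw [hs, h]
      rfl
    · right
      obtain ⟨u, hu, hu'⟩ := Finset.exists_mem_eq_sup _ h o
      exact ⟨u, (Finset.mem_erase.1 hu).1, by rw [hs, hu']⟩
  · rw [hs, hl]
    exact Finset.sup_mono (Finset.subset_univ _)

theorem two_le_componentCount_iff (hd : DegLeTwo G) (j : ℕ) :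
    2 ≤ componentCount G (pathGraph j) ↔ ∃ c c' : G.ConnectedComponent, c ≠ c' ∧
      (¬ IsCyc c.toSimpleGraph ∧ Nat.card c = j) ∧ ¬ IsCyc c'.toSimpleGraph ∧ Nat.card c' = j := by
  classical
  let I : Fintype G.ConnectedComponent := Fintype.ofFinite _
  rw [componentCount_path hd, shapeCount, ← Nat.lt_iff_add_one_le, Finset.one_lt_card]
  simp only [Finset.mem_filter, Finset.mem_univ, true_and, iff_false]
  constructor
  · rintro ⟨a, ha, b, hb, hab⟩
    exact ⟨a, b, hab, ha.symm, hb.symm⟩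
  · rintro ⟨a, b, hab, ha, hb⟩
    exact ⟨a, ha.symm, b, hb.symm, hab⟩

theorem largeEnough_of_kNumber_le [Nonempty V] [Fintype G.ConnectedComponent] (hd : DegLeTwo G)
    {k : ℕ} (hk : kNumber G ≤ k) : ∃ t, LargeEnough (fun c : G.ConnectedComponent => Nat.card c)
      (fun c => IsCyc c.toSimpleGraph) k (largestOrder G) (secondOrder G) t := by
  obtain ⟨t, h1, h2, h3, -, h5⟩ := exists_largest G
  rw [kNumber, max_le_iff] at hk
  obtain ⟨hk1, hk2⟩ := hk
  refine ⟨t, ⟨h1, h2, h3, by omega, ?_, by omega, ?_, ?_, ?_, ?_⟩⟩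
  · intro h
    rw [epsOne, if_pos ((hasComponent_path_iff hd _).2 h)] at hk1
    exact hk1
  · intro h h'
    simp only [epsTwo] at hk2
    rw [if_pos ⟨h, (hasComponent_path_iff hd _).2 h'⟩] at hk2
    exact hk2
  · intro h h'
    simp only [epsTwo] at hk2
    rw [if_neg (by omega), if_pos (Or.inl ⟨h, (hasComponent_path_iff hd _).2 h'⟩)] at hk2
    exact hk2
  · intro h h' h''
    have hn : ¬ HasComponent G (pathGraph (secondOrder G)) :=
      fun H => h'' ((hasComponent_path_iff hd _).1 H)
    simp only [epsTwo] at hk2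
    rw [if_neg (fun H => hn H.2),
      if_pos (Or.inr (Or.inl ⟨h, (hasComponent_path_iff hd _).2 h', hn⟩))] at hk2
    exact hk2
  · intro h h'
    simp only [epsTwo] at hk2
    rw [if_neg (by omega),
      if_pos (Or.inr (Or.inr ⟨h, (two_le_componentCount_iff hd _).2 h'⟩))] at hk2
    exact hk2

/-- Among graphs of maximum degree at most two, the `k`-deck determines the graph
if `k` is at least the parameter `k_G`. -/
theorem iso_of_embCount_eq [Nonempty V] {V' : Type*} [Fintype V'] {H : SimpleGraph V'}
    (hG : DegLeTwo G) (hH : DegLeTwo H) {k : ℕ} (hk2 : 2 ≤ k) (hk : kNumber G ≤ k)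
    (hcount : ∀ j ≤ k, ∀ F : SimpleGraph (Fin j), embCount F H = embCount F G) :
    Nonempty (H ≃g G) := by
  classical
  let I : Fintype G.ConnectedComponent := Fintype.ofFinite _
  let I' : Fintype H.ConnectedComponent := Fintype.ofFinite _
  obtain ⟨t, ht⟩ := largeEnough_of_kNumber_le hG hk
  obtain ⟨e, he⟩ := exists_equiv_of_totals (o' := fun c : H.ConnectedComponent => Nat.card c)
    (c' := fun c : H.ConnectedComponent => IsCyc c.toSimpleGraph) hk2
    (fun c => card_component_pos c) (fun c => card_component_pos c)
    (fun _ h => h.1) (fun _ h => h.1)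
    (by
      intro j h1 hj
      have := hcount j hj (pathGraph j)
      rw [embCount_path_eq_pathTotal hG h1, embCount_path_eq_pathTotal hH h1] at this
      exact (Nat.eq_of_mul_eq_mul_left (by split_ifs <;> omega) this).symm)
    (by
      intro j h3 hj
      have := hcount j hj (cycleGraph j)
      rw [embCount_cycle_eq_cycleTotal hG h3, embCount_cycle_eq_cycleTotal hH h3] at this
      have := Nat.eq_of_mul_eq_mul_right (embCount_cycle_self_pos j) this
      simpa only [cycleTotal, shapeCount, iff_true, and_comm] using this.symm)
    (ht.fewLong hk2)
  obtain ⟨i⟩ := iso_of_components (G := G) (H := H) e (fun c => by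
    obtain ⟨h1, h2⟩ := he c
    by_cases hc : IsCyc c.toSimpleGraph
    · have hc' := h2.2 hc
      obtain ⟨i⟩ := hc.2
      obtain ⟨i'⟩ := hc'.2
      have h1 : Nat.card (e c) = Nat.card c := h1
      rw [h1] at i'
      exact ⟨i.trans i'.symm⟩
    · have hc' := fun h => hc (h2.1 h)
      obtain ⟨i⟩ := iso_path_of_not_isCyc c.connected_toSimpleGraph (hG.component c) hc
      obtain ⟨i'⟩ := iso_path_of_not_isCyc (e c).connected_toSimpleGraph (hH.component _) hc'
      have h1 : Nat.card (e c) = Nat.card c := h1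
      rw [h1] at i'
      exact ⟨i.trans i'.symm⟩)
  exact ⟨i.symm⟩

theorem sum_card_components (G : SimpleGraph V) [Fintype G.ConnectedComponent] :
    ∑ c : G.ConnectedComponent, Nat.card c = Fintype.card V := by
  classical
  have h := embCount_path_one G
  rw [embCount_eq_sum_components (pathGraph_connected' le_rfl)] at h
  rw [← Nat.card_eq_fintype_card, ← h]
  exact Finset.sum_congr rfl fun c _ => (embCount_path_one _).symm

/-- Needed because the deck is empty beyond `|V|`. The first and second size add up to at most
`|V|`, and `q + ε'` exceeds `m` only if `q = m`. -/
theorem kNumber_le_card [Nonempty V] : kNumber G ≤ Fintype.card V := by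
  classical
  let I : Fintype G.ConnectedComponent := Fintype.ofFinite _
  obtain ⟨t, h1, h2, h3, h4, h5⟩ := exists_largest G
  have hpos := card_component_pos t
  have hsum := sum_card_components G
  have hm : largestOrder G ≤ Fintype.card V := by
    rw [← h1, ← hsum]
    exact Finset.single_le_sum (f := fun c : G.ConnectedComponent => Nat.card c)
      (fun _ _ => Nat.zero_le _) (Finset.mem_univ t)
  have hmq : largestOrder G + secondOrder G ≤ Fintype.card V := by
    rcases h4 with h4 | ⟨u, hu, hu'⟩
    · omega
    · rw [← h1, ← hu', ← hsum,
        ← Finset.sum_pair (f := fun c : G.ConnectedComponent => Nat.card c) hu.symm]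
      exact Finset.sum_le_sum_of_subset (Finset.subset_univ _)
  rw [kNumber, max_le_iff]
  constructor
  · have : epsOne G ≤ 1 := by
      unfold epsOne; split_ifs <;> omega
    omega
  · simp only [epsTwo]
    split_ifs with ha hb
    · omega
    · rcases hb with hb | hb | hb <;> omega
    · omega

theorem iso_component_of_unique {V : Type*} {G : SimpleGraph V} {t : G.ConnectedComponent}
    (h : ∀ c, c = t) :
    Nonempty (G ≃g t.toSimpleGraph) := by
  refine ⟨RelIso.symm ⟨Equiv.subtypeUnivEquiv fun v => h (G.connectedComponentMk v), Iff.rfl⟩⟩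

/-- A connected `G` is a path or a cycle with at least six vertices. If the second size is 1, that
component is a `P_1`, and each position of `m` relative to 1 makes `ε'` positive. -/
theorem two_le_kNumber [Nonempty V] (hd : DegLeTwo G)
    (hcycle : ∀ j : ℕ, 3 ≤ j → j < 6 → ¬ Nonempty (G ≃g cycleGraph j))
    (hV : 2 ≤ Fintype.card V) : 2 ≤ kNumber G := by
  classical
  let I : Fintype G.ConnectedComponent := Fintype.ofFinite _
  obtain ⟨t, ht⟩ := largeEnough_of_kNumber_le hd le_rfl
  obtain ⟨t', h1, h2, h3, h4, h5⟩ := exists_largest G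
  have hpath1 : ∀ c : G.ConnectedComponent, Nat.card c ≤ 2 → ¬ IsCyc c.toSimpleGraph := by
    intro c hc h
    have : 3 ≤ Nat.card c := h.1
    omega
  have hsec := ht.second
  rcases h4 with h4 | ⟨u, hu, hu'⟩
  · have huniq : ∀ c, c = t' := by
      intro c
      by_contra hne
      have := h3 c hne
      have := card_component_pos c
      omega
    obtain ⟨e⟩ := iso_component_of_unique huniq
    have hcard : Fintype.card V = Nat.card t' := by
      rw [← Nat.card_eq_fintype_card]; exact Nat.card_congr e.toEquiv
    by_cases hc : IsCyc t'.toSimpleGraph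
    · have hc3 : 3 ≤ Nat.card t' := hc.1
      obtain ⟨e'⟩ := hc.2
      have : ¬ Nat.card t' < 6 := fun h => hcycle _ hc3 h ⟨e.trans e'⟩
      have := ht.half
      omega
    · have := ht.half_path ⟨t', hc, h1⟩
      omega
  · have hpos := card_component_pos u
    by_cases hq : secondOrder G = 1
    · have hup := hpath1 u (by omega)
      rcases Nat.lt_trichotomy (largestOrder G) 2 with hm | hm | hm
      · have ht' := hpath1 t' (by omega)
        have := ht.second_twice (by omega) ⟨u, t', hu, ⟨hup, by omega⟩, ht', h1⟩
        omega
      · have := ht.second_path_pred (by omega) ⟨u, hup, hu'⟩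
        omega
      · have := ht.second_path (by omega) ⟨u, hup, hu'⟩
        omega
    · omega

end Parameters

/-! ### Degree sums from induced subgraphs with at most three vertices -/

section SmallCounts

variable {V : Type*} (G : SimpleGraph V)

theorem embCount_path_two :
    embCount (pathGraph 2) G = Nat.card {p : V × V // G.Adj p.1 p.2} :=
  Nat.card_congr
    { toFun := fun f => ⟨(f 0, f 1), f.map_adj_iff.2 (by simp [pathGraph_adj])⟩
      invFun := fun p => ⟨⟨![p.1.1, p.1.2], by
          intro a b
          have h := p.2.ne
          have h' := p.2.ne'
          fin_cases a <;> fin_cases b <;> simp [h, h']⟩, by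
          intro a b
          have h := p.2
          have h' := p.2.symm
          change G.Adj (![p.1.1, p.1.2] a) (![p.1.1, p.1.2] b) ↔ _
          fin_cases a <;> fin_cases b <;> simp [pathGraph_adj, h, h']⟩
      left_inv := fun f => by
        ext i
        fin_cases i <;> rfl
      right_inv := fun p => rfl }

theorem embCount_path_three :
    embCount (pathGraph 3) G = Nat.card {p : V × V × V // G.Adj p.1 p.2.1 ∧ G.Adj p.1 p.2.2 ∧
      p.2.1 ≠ p.2.2 ∧ ¬ G.Adj p.2.1 p.2.2} :=
  Nat.card_congr
    { toFun := fun f => ⟨(f 1, f 0, f 2), f.map_adj_iff.2 (by simp [pathGraph_adj]),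
        f.map_adj_iff.2 (by simp [pathGraph_adj]), fun h => by simpa using f.injective h,
        fun h => by simpa [pathGraph_adj] using f.map_adj_iff.1 h⟩
      invFun := fun p => ⟨⟨![p.1.2.1, p.1.1, p.1.2.2], by
          intro a b
          obtain ⟨h1, h2, h3, -⟩ := p.2
          have h1' := h1.ne
          have h2' := h2.ne
          fin_cases a <;> fin_cases b <;> simp [h1', h2', h3, h1'.symm, h2'.symm, h3.symm]⟩, by
          intro a b
          obtain ⟨h1, h2, -, h4⟩ := p.2
          have h4' : ¬ G.Adj p.1.2.2 p.1.2.1 := fun h => h4 (G.adj_symm h)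
          change G.Adj (![p.1.2.1, p.1.1, p.1.2.2] a) (![p.1.2.1, p.1.1, p.1.2.2] b) ↔ _
          fin_cases a <;> fin_cases b <;>
            simp [pathGraph_adj, h1, h2, h4, h4', h1.symm, h2.symm]⟩
      left_inv := fun f => by
        ext i
        fin_cases i <;> rfl
      right_inv := fun p => rfl }

theorem embCount_cycle_three :
    embCount (cycleGraph 3) G = Nat.card {p : V × V × V // G.Adj p.1 p.2.1 ∧ G.Adj p.1 p.2.2 ∧
      p.2.1 ≠ p.2.2 ∧ G.Adj p.2.1 p.2.2} := by
  rw [cycleGraph_three_eq_top]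
  exact Nat.card_congr
    { toFun := fun f => ⟨(f 1, f 0, f 2), f.map_adj_iff.2 (by simp),
        f.map_adj_iff.2 (by simp), fun h => by simpa using f.injective h,
        f.map_adj_iff.2 (by simp)⟩
      invFun := fun p => ⟨⟨![p.1.2.1, p.1.1, p.1.2.2], by
          intro a b
          obtain ⟨h1, h2, h3, -⟩ := p.2
          have h1' := h1.ne
          have h2' := h2.ne
          fin_cases a <;> fin_cases b <;> simp [h1', h2', h3, h1'.symm, h2'.symm, h3.symm]⟩, by
          intro a b
          obtain ⟨h1, h2, -, h4⟩ := p.2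
          change G.Adj (![p.1.2.1, p.1.1, p.1.2.2] a) (![p.1.2.1, p.1.1, p.1.2.2] b) ↔ _
          fin_cases a <;> fin_cases b <;> simp [h1, h2, h4, h4.symm, h1.symm, h2.symm]⟩
      left_inv := fun f => by
        ext i
        fin_cases i <;> rfl
      right_inv := fun p => rfl }

open Classical in
theorem embCount_path_two_eq_sum [Fintype V] : embCount (pathGraph 2) G = ∑ v, G.degree v := by
  rw [embCount_path_two, ← G.dart_card_eq_sum_degrees, ← Nat.card_eq_fintype_card]
  exact Nat.card_congr
    { toFun := fun p => ⟨p.1, p.2⟩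
      invFun := fun d => ⟨d.toProd, d.adj⟩
      left_inv := fun _ => rfl
      right_inv := fun _ => rfl }

open Classical in
-- An ordered pair of distinct neighbours of `v` spans with `v` an induced path centred at `v` or a
-- triangle, according to whether the two are adjacent.
theorem embCount_three_eq_sum [Fintype V] : embCount (pathGraph 3) G + embCount (cycleGraph 3) G =
    ∑ v, (G.degree v * G.degree v - G.degree v) := by
  rw [embCount_path_three, embCount_cycle_three]
  have h : ∀ v, G.degree v * G.degree v - G.degree v =
      Nat.card {p : V × V // G.Adj v p.1 ∧ G.Adj v p.2 ∧ p.1 ≠ p.2} := by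
    intro v
    rw [← G.card_neighborFinset_eq_degree, ← Finset.offDiag_card, Nat.card_eq_fintype_card,
      Fintype.card_subtype]
    congr 1
    ext p
    simp [Finset.mem_offDiag]
  simp only [h]
  rw [← Nat.card_sigma, ← Nat.card_sum]
  refine Nat.card_congr
    { toFun := Sum.elim (fun p => ⟨p.1.1, p.1.2, p.2.1, p.2.2.1, p.2.2.2.1⟩)
        (fun p => ⟨p.1.1, p.1.2, p.2.1, p.2.2.1, p.2.2.2.1⟩)
      invFun := fun q => if hq : G.Adj q.2.1.1 q.2.1.2 then
          Sum.inr ⟨(q.1, q.2.1), q.2.2.1, q.2.2.2.1, q.2.2.2.2, hq⟩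
        else Sum.inl ⟨(q.1, q.2.1), q.2.2.1, q.2.2.2.1, q.2.2.2.2, hq⟩
      left_inv := ?_
      right_inv := ?_ }
  · rintro (p | p)
    · simp [p.2.2.2.2]
    · simp [p.2.2.2.2]
  · intro q
    by_cases hq : G.Adj q.2.1.1 q.2.1.2
    · simp [hq]
    · simp [hq]

open Classical in
/-- The sum of `(d - 1) * (d - 2)` over the degrees in terms of small induced subgraphs. -/
theorem sum_degree_eq [Fintype V] : ∑ v, ((G.degree v : ℤ) - 1) * ((G.degree v : ℤ) - 2) =
    (embCount (pathGraph 3) G + embCount (cycleGraph 3) G : ℕ) - 2 * embCount (pathGraph 2) G +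
      2 * Fintype.card V := by
  rw [embCount_three_eq_sum, embCount_path_two_eq_sum]
  push_cast
  have h : ∀ v, ((G.degree v * G.degree v - G.degree v : ℕ) : ℤ) =
      (G.degree v : ℤ) * G.degree v - G.degree v := fun v => by
    rw [Nat.cast_sub (Nat.le_mul_self _)]
    push_cast
    rfl
  simp only [h]
  rw [Finset.mul_sum, ← Finset.sum_sub_distrib,
    show (2 : ℤ) * (Fintype.card V : ℤ) = ∑ _v : V, 2 by simp; ring, ← Finset.sum_add_distrib]
  exact Finset.sum_congr rfl fun v _ => by ring

end SmallCounts

theorem embCount_top {W V : Type*} [Fintype W] [Fintype V] :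
    embCount (⊤ : SimpleGraph W) (⊤ : SimpleGraph V) =
      (Fintype.card V).descFactorial (Fintype.card W) := by
  classical
  rw [← Fintype.card_embedding_eq, ← Nat.card_eq_fintype_card]
  exact Nat.card_congr
    { toFun := fun f => f.toEmbedding
      invFun := fun f => ⟨f, by simp⟩
      left_inv := fun _ => rfl
      right_inv := fun _ => rfl }

theorem embCount_cycle_three_self : embCount (cycleGraph 3) (cycleGraph 3) = 6 := by
  rw [cycleGraph_three_eq_top, embCount_top]
  rfl

theorem embCount_le_of_embedding {W V V' : Type*} [Finite W] [Finite V'] (F : SimpleGraph W)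
    {G : SimpleGraph V} {H : SimpleGraph V'} (f : G ↪g H) : embCount F G ≤ embCount F H := by
  have := finite_embedding F H
  refine Nat.card_le_card_of_injective (fun g => f.comp g) fun g g' h => ?_
  ext x
  exact f.injective (congrArg (fun k => k x) h)

theorem injective_vec_four {α : Type*} {v a b c : α} (ha : v ≠ a) (hb : v ≠ b) (hc : v ≠ c)
    (hab : a ≠ b) (hac : a ≠ c) (hbc : b ≠ c) : Function.Injective ![v, a, b, c] := by
  intro x y
  fin_cases x <;> fin_cases y <;>
    simp [ha, hb, hc, hab, hac, hbc, ha.symm, hb.symm, hc.symm, hab.symm, hac.symm, hbc.symm]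

theorem exists_three_of_not_degLeTwo {V : Type*} {G : SimpleGraph V} (h : ¬ DegLeTwo G) :
    ∃ v a b c, G.Adj v a ∧ G.Adj v b ∧ G.Adj v c ∧ a ≠ b ∧ a ≠ c ∧ b ≠ c := by
  simp only [DegLeTwo] at h
  push Not at h
  exact h

theorem degLeTwo_iff_degree {V : Type*} [Fintype V] {G : SimpleGraph V} [DecidableRel G.Adj] :
    DegLeTwo G ↔ ∀ v, G.degree v ≤ 2 := by
  constructor
  · intro h v
    by_contra hlt
    rw [← G.card_neighborFinset_eq_degree] at hlt
    obtain ⟨a, ha, b, hb, c, hc, hab, hac, hbc⟩ := Finset.two_lt_card.1 (not_le.1 hlt)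
    simp only [mem_neighborFinset] at ha hb hc
    rcases h v a b c ha hb hc with h | h | h
    · exact hab h
    · exact hac h
    · exact hbc h
  · intro h
    by_contra hcon
    obtain ⟨v, a, b, c, ha, hb, hc, hab, hac, hbc⟩ := exists_three_of_not_degLeTwo hcon
    have : 2 < G.degree v := by
      rw [← G.card_neighborFinset_eq_degree, Finset.two_lt_card]
      exact ⟨a, by simpa, b, by simpa, c, by simpa, hab, hac, hbc⟩
    have := h v
    omega

/-! ### The deck forces maximum degree at most two -/

section Upper

variable {V V' : Type*} [Fintype V] [Fintype V'] {G : SimpleGraph V} {H : SimpleGraph V'}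

/-- A vertex of `H` and three of its neighbours induce a graph on four vertices that does not embed
in `G`. -/
theorem degLeTwo_of_four {V : Type*} {G : SimpleGraph V} (hG : DegLeTwo G)
    (h : ∀ F : SimpleGraph (Fin 4), embCount F H = embCount F G) : DegLeTwo H := by
  by_contra hcon
  obtain ⟨v, a, b, c, ha, hb, hc, hab, hac, hbc⟩ := exists_three_of_not_degLeTwo hcon
  have hinj := injective_vec_four ha.ne hb.ne hc.ne hab hac hbc
  let f : H.comap ![v, a, b, c] ↪g H := ⟨⟨_, hinj⟩, Iff.rfl⟩
  have hfin := finite_embedding (H.comap ![v, a, b, c]) H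
  have hpos : 0 < embCount (H.comap ![v, a, b, c]) H := by
    have : Nonempty (H.comap ![v, a, b, c] ↪g H) := ⟨f⟩
    exact Nat.card_pos
  rw [h] at hpos
  obtain ⟨g⟩ := (Nat.card_pos_iff.1 hpos).1
  rcases hG.of_embedding g 0 1 2 3 ha hb hc with h | h | h <;> simp at h

open Classical in
theorem degLeTwo_of_two [Nonempty V] (hG : DegLeTwo G)
    (hcycle : ∀ j : ℕ, 3 ≤ j → j < 6 → ¬ Nonempty (G ≃g cycleGraph j)) (hk : kNumber G ≤ 2)
    (h : ∀ j ≤ 2, ∀ F : SimpleGraph (Fin j), embCount F H = embCount F G) : DegLeTwo H := by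
  let I : Fintype G.ConnectedComponent := Fintype.ofFinite _
  obtain ⟨t, ht⟩ := largeEnough_of_kNumber_le hG hk
  obtain ⟨t', h1, h2, h3, h4, h5⟩ := exists_largest G
  have hpath : ∀ c : G.ConnectedComponent, Nat.card c ≤ 2 → ¬ IsCyc c.toSimpleGraph := by
    intro c hc h
    have : 3 ≤ Nat.card c := h.1
    omega
  -- `k_G ≤ 2` leaves at most one edge, or at most three vertices; neither has room for a vertex of
  -- degree 3.
  have key : embCount (pathGraph 2) G ≤ 2 ∨ Fintype.card V ≤ 3 := by
    rcases h4 with h4 | ⟨u, hu, hu'⟩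
    · right
      have huniq : ∀ c, c = t' := by
        intro c
        by_contra hne
        have := h3 c hne
        have := card_component_pos c
        omega
      obtain ⟨e⟩ := iso_component_of_unique huniq
      have hcard : Fintype.card V = Nat.card t' := by
        rw [← Nat.card_eq_fintype_card]; exact Nat.card_congr e.toEquiv
      by_cases hc : IsCyc t'.toSimpleGraph
      · have hc3 : 3 ≤ Nat.card t' := hc.1
        obtain ⟨e'⟩ := hc.2
        have : ¬ Nat.card t' < 6 := fun h => hcycle _ hc3 h ⟨e.trans e'⟩
        have := ht.half
        omega
      · have := ht.half_path ⟨t', hc, h1⟩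
        omega
    · left
      have hq2 := ht.second
      have hpos := card_component_pos u
      have hup := hpath u (by omega)
      have hm2 : secondOrder G = 1 ∧ largestOrder G ≤ 2 := by
        rcases Nat.lt_trichotomy (secondOrder G + 1) (largestOrder G) with hm | hm | hm
        · have := ht.second_path hm ⟨u, hup, hu'⟩
          omega
        · have := ht.second_path_pred hm ⟨u, hup, hu'⟩
          omega
        · by_contra hcon
          have := ht.second_twice (by omega)
            ⟨u, t', hu, ⟨hup, by omega⟩, hpath t' (by omega), h1⟩
          omega
      rw [embCount_path_eq_pathTotal hG (by omega), pathTotal,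
        Finset.sum_eq_single t']
      · unfold pathNum
        rw [if_neg (hpath t' (by omega)), if_neg (by omega)]
        omega
      · intro c _ hc
        have := h3 c hc
        unfold pathNum
        rw [if_neg (hpath c (by omega))]
        omega
      · simp
  have hn : Fintype.card V' = Fintype.card V := by
    have := h 1 (by omega) (pathGraph 1)
    rw [embCount_path_one, embCount_path_one] at this
    simpa using this
  have he := h 2 le_rfl (pathGraph 2)
  rw [embCount_path_two_eq_sum] at he
  rw [degLeTwo_iff_degree]
  intro v
  by_contra hv
  rcases key with key | key
  · have hle : ∑ v, H.degree v ≥ H.degree v :=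
      Finset.single_le_sum (f := fun v => H.degree v) (fun _ _ => Nat.zero_le _) (Finset.mem_univ v)
    omega
  · have := H.degree_lt_card_verts v
    omega

open Classical in
-- The left side is twice the second difference of the path totals at 1, corrected by the triangles,
-- hence twice the paths with at least one vertex minus those with at least two. In the degree sum
-- of `sum_degree_eq` this is the value 2 of `(d-1)(d-2)` at `d = 0` and 0 at `d = 1, 2`.
theorem sum_degree_eq_of_degLeTwo [Fintype G.ConnectedComponent] (hG : DegLeTwo G) :
    ((embCount (pathGraph 3) G + embCount (cycleGraph 3) G : ℕ) : ℤ) -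
      2 * embCount (pathGraph 2) G + 2 * Fintype.card V =
    2 * shapeCount (fun c : G.ConnectedComponent => Nat.card c)
      (fun c => IsCyc c.toSimpleGraph) 1 False := by
  have e1 := longPaths_add (fun c : G.ConnectedComponent => Nat.card c)
      (fun c => IsCyc c.toSimpleGraph) 1
  have e2 := longPaths_add (fun c : G.ConnectedComponent => Nat.card c)
      (fun c => IsCyc c.toSimpleGraph) 2
  have e3 := shapeCount_add_longPaths (fun c : G.ConnectedComponent => Nat.card c)
      (fun c => IsCyc c.toSimpleGraph) 1
  have e4 : shapeCount (fun c : G.ConnectedComponent => Nat.card c)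
      (fun c => IsCyc c.toSimpleGraph) 2 True = 0 := by
    rw [shapeCount, Finset.card_eq_zero, Finset.filter_eq_empty_iff]
    rintro c - ⟨h, h'⟩
    have : 3 ≤ Nat.card c := (h'.2 trivial).1
    omega
  have e5 : shapeCount (fun c : G.ConnectedComponent => Nat.card c)
      (fun c => IsCyc c.toSimpleGraph) 3 True = cycleTotal G 3 := by
    simp only [shapeCount, cycleTotal, iff_true, and_comm]
  have f1 : Fintype.card V = pathTotal G 1 := by
    have := embCount_path_eq_pathTotal hG (le_refl 1)
    rw [embCount_path_one] at this
    simpa using this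
  have f2 := embCount_path_eq_pathTotal hG (show 1 ≤ 2 by omega)
  have f3 := embCount_path_eq_pathTotal hG (show 1 ≤ 3 by omega)
  have f4 := embCount_cycle_eq_cycleTotal hG (le_refl 3)
  rw [embCount_cycle_three_self] at f4
  change _ + pathTotal G 2 + _ = pathTotal G 1 at e1
  change _ + pathTotal G 3 + _ = pathTotal G 2 at e2
  simp only [Nat.reduceAdd, Nat.reduceEqDiff, if_false] at e1 e2 e3 f2 f3
  rw [f1, f2, f3, f4]
  omega

open Classical in
-- With at most one induced `P_3`, a vertex and any three of its neighbours form a `K_4`. It has 24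
-- labelled triangles, and each of its four vertices contributes at least `2 * 1` to the degree sum.
theorem not_degLeTwo_bounds (hH : ¬ DegLeTwo H) (hp : embCount (pathGraph 3) H ≤ 2) :
    24 ≤ embCount (cycleGraph 3) H ∧
      8 ≤ ∑ v, ((H.degree v : ℤ) - 1) * ((H.degree v : ℤ) - 2) := by
  obtain ⟨v, a, b, c, ha, hb, hc, hab, hac, hbc⟩ := exists_three_of_not_degLeTwo hH
  rw [embCount_path_three, Nat.card_eq_fintype_card, Fintype.card_subtype] at hp
  have three : ∀ p q r : V' × V' × V', p ≠ q → p ≠ r → q ≠ r →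
      (∀ s ∈ [p, q, r], H.Adj s.1 s.2.1 ∧ H.Adj s.1 s.2.2 ∧ s.2.1 ≠ s.2.2 ∧
        ¬ H.Adj s.2.1 s.2.2) → False := by
    intro p q r hpq hpr hqr hs
    have : 2 < (Finset.univ.filter fun s : V' × V' × V' => H.Adj s.1 s.2.1 ∧ H.Adj s.1 s.2.2 ∧
        s.2.1 ≠ s.2.2 ∧ ¬ H.Adj s.2.1 s.2.2).card := by
      rw [Finset.two_lt_card]
      refine ⟨p, ?_, q, ?_, r, ?_, hpq, hpr, hqr⟩
      all_goals
        rw [Finset.mem_filter]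
        exact ⟨Finset.mem_univ _, hs _ (by simp)⟩
    omega
  -- If `x`, `y` are not adjacent, `x v y` is induced in two labellings. A third labelled copy is `x
  -- z y` if `z` is adjacent to both, and otherwise `v` with `z` and a non-neighbour of `z` among
  -- `x`, `y`.
  have hadj : ∀ x y z, H.Adj v x → H.Adj v y → H.Adj v z → x ≠ y → x ≠ z → y ≠ z → H.Adj x y := by
    intro x y z hx hy hz hxy hxz hyz
    by_contra hn
    have hn' : ¬ H.Adj y x := fun h => hn h.symm
    by_cases hzx : H.Adj z x
    · by_cases hzy : H.Adj z y
      · refine three (v, x, y) (v, y, x) (z, x, y) ?_ ?_ ?_ ?_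
        · simp [hxy]
        · simp [hz.ne]
        · simp [hz.ne]
        · simp [hx, hy, hxy, hn, hn', hxy.symm, hzx, hzy]
      · refine three (v, x, y) (v, y, x) (v, y, z) ?_ ?_ ?_ ?_
        · simp [hxy]
        · simp [hxy]
        · simp [hxz]
        · have : ¬ H.Adj y z := fun h => hzy h.symm
          simp [hx, hy, hz, hxy, hn, hn', hxy.symm, hyz, this]
    · refine three (v, x, y) (v, y, x) (v, x, z) ?_ ?_ ?_ ?_
      · simp [hxy]
      · simp [hyz]
      · simp [hxy.symm]
      · have : ¬ H.Adj x z := fun h => hzx h.symm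
        simp [hx, hy, hz, hxy, hn, hn', hxy.symm, hxz, this]
  have h1 := hadj a b c ha hb hc hab hac hbc
  have h2 := hadj a c b ha hc hb hac hab hbc.symm
  have h3 := hadj b c a hb hc ha hbc hab.symm hac.symm
  have hinj := injective_vec_four ha.ne hb.ne hc.ne hab hac hbc
  let f : (⊤ : SimpleGraph (Fin 4)) ↪g H := ⟨⟨_, hinj⟩, by
    intro x y
    change H.Adj (![v, a, b, c] x) (![v, a, b, c] y) ↔ _
    fin_cases x <;> fin_cases y <;>
      simp [ha, hb, hc, h1, h2, h3, ha.symm, hb.symm, hc.symm, h1.symm, h2.symm, h3.symm]⟩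
  constructor
  · have := embCount_le_of_embedding (cycleGraph 3) f
    rw [cycleGraph_three_eq_top, embCount_top] at this
    rw [cycleGraph_three_eq_top]
    exact this
  · have hnn : ∀ d : ℕ, 0 ≤ ((d : ℤ) - 1) * ((d : ℤ) - 2) := by
      intro d
      rcases lt_or_ge d 2 with h | h
      · interval_cases d <;> norm_num
      · exact mul_nonneg (by omega) (by omega)
    have hdeg : ∀ i, 3 ≤ H.degree (f i) := by
      intro i
      rw [← H.card_neighborFinset_eq_degree]
      have : ((Finset.univ.erase i).map f.toEmbedding) ⊆ H.neighborFinset (f i) := by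
        intro x hx
        simp only [Finset.mem_map, Finset.mem_erase, Finset.mem_univ, and_true] at hx
        obtain ⟨j, hj, rfl⟩ := hx
        rw [mem_neighborFinset]
        exact f.map_adj_iff.2 hj.symm
      simpa using Finset.card_le_card this
    calc (8 : ℤ) = ∑ _i : Fin 4, 2 := by simp
      _ ≤ ∑ i : Fin 4, ((H.degree (f i) : ℤ) - 1) * ((H.degree (f i) : ℤ) - 2) := by
          refine Finset.sum_le_sum fun i _ => ?_
          have := hdeg i
          have h1 : (2 : ℤ) ≤ (H.degree (f i) : ℤ) - 1 := by omega
          have h2 : (1 : ℤ) ≤ (H.degree (f i) : ℤ) - 2 := by omega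
          nlinarith
      _ = ∑ v ∈ Finset.univ.map f.toEmbedding, ((H.degree v : ℤ) - 1) * ((H.degree v : ℤ) - 2) := by
          rw [Finset.sum_map]
          rfl
      _ ≤ _ := Finset.sum_le_sum_of_subset_of_nonneg (Finset.subset_univ _)
          fun v _ _ => hnn (H.degree v)

open Classical in
theorem degLeTwo_of_three [Nonempty V] (hG : DegLeTwo G) (hk : kNumber G ≤ 3)
    (hF : ¬ InExceptionalFamily G)
    (h : ∀ j ≤ 3, ∀ F : SimpleGraph (Fin j), embCount F H = embCount F G) : DegLeTwo H := by
  let I : Fintype G.ConnectedComponent := Fintype.ofFinite _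
  obtain ⟨t, ht⟩ := largeEnough_of_kNumber_le hG hk
  obtain ⟨t', h1, h2, h3, h4, h5⟩ := exists_largest G
  have hn : Fintype.card V' = Fintype.card V := by
    have := h 1 (by omega) (pathGraph 1)
    rw [embCount_path_one, embCount_path_one] at this
    simpa using this
  have hsum := sum_degree_eq H
  rw [h 3 le_rfl, h 3 le_rfl, h 2 (by omega), hn, sum_degree_eq_of_degLeTwo hG] at hsum
  by_contra hcon
  set i := shapeCount (fun c : G.ConnectedComponent => Nat.card c)
      (fun c => IsCyc c.toSimpleGraph) 1 False with hi
  have hnn : ∀ d : ℕ, 0 ≤ ((d : ℤ) - 1) * ((d : ℤ) - 2) := by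
    intro d
    rcases lt_or_ge d 2 with h | h
    · interval_cases d <;> norm_num
    · exact mul_nonneg (by omega) (by omega)
  -- Without isolated vertices in `G` the nonnegative terms `(d-1)(d-2)` of `H` sum to 0, so all
  -- degrees are 1 or 2.
  by_cases hi0 : i = 0
  · apply hcon
    rw [degLeTwo_iff_degree]
    intro v
    rw [hi0, Nat.cast_zero, mul_zero, Finset.sum_eq_zero_iff_of_nonneg fun v _ => hnn _] at hsum
    have := hsum v (Finset.mem_univ v)
    rcases mul_eq_zero.1 this with h | h <;> omega
  have hP1 : HasComponent G (pathGraph 1) := by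
    rw [hasComponent_path_iff hG]
    obtain ⟨c, hc⟩ := Finset.card_pos.1 (Nat.pos_of_ne_zero (hi ▸ hi0))
    simp only [Finset.mem_filter, Finset.mem_univ, true_and, iff_false] at hc
    exact ⟨c, hc.2, hc.1⟩
  simp only [InExceptionalFamily, hP1, true_and, not_or, not_exists, not_le] at hF
  obtain ⟨hF1, hF2, hF3, hF4⟩ := hF
  rw [hasComponent_cycle_iff (by omega)] at hF2
  rw [hasComponent_cycle_iff (le_refl 3)] at hF3
  rw [hasComponent_path_iff hG] at hF3 hP1
  rw [componentCount_cycle (le_refl 3), componentCount_path hG, ← hi] at hF4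
  have hF1' : ∀ c : G.ConnectedComponent, Nat.card c < 5 := hF1
  have e5 : shapeCount (fun c : G.ConnectedComponent => Nat.card c)
      (fun c => IsCyc c.toSimpleGraph) 3 True = cycleTotal G 3 := by
    simp only [shapeCount, cycleTotal, iff_true, and_comm]
  rw [e5] at hF4
  have f3 := embCount_path_eq_pathTotal hG (show 1 ≤ 3 by omega)
  have f4 := embCount_cycle_eq_cycleTotal hG (le_refl 3)
  rw [embCount_cycle_three_self] at f4
  rw [if_neg (by omega)] at f3
  have hcard4 : ∀ c : G.ConnectedComponent, IsCyc c.toSimpleGraph → Nat.card c = 3 := by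
    intro c hc
    have h3 : 3 ≤ Nat.card c := hc.1
    have h5 := hF1' c
    have : Nat.card c ≠ 4 := fun h => hF2 ⟨c, hc, h⟩
    omega
  obtain ⟨s, hsp, hs1⟩ := hP1
  -- With a `P_4` there is no cycle, and `k_G ≤ 3` makes all other components isolated vertices.
  -- Then the degrees of `H` satisfy `∑ d(d-1) = 4`, less than the 6 of a vertex of degree 3.
  by_cases hP4 : ∃ c : G.ConnectedComponent, ¬ IsCyc c.toSimpleGraph ∧ Nat.card c = 4
  · have hnocyc : ∀ c : G.ConnectedComponent, ¬ IsCyc c.toSimpleGraph :=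
      fun c hc => hF3 ⟨hP4, c, hc, hcard4 c hc⟩
    obtain ⟨w, -, hw⟩ := hP4
    have hm : largestOrder G = 4 := by
      have := h2 w
      have := hF1' t'
      omega
    have hq : secondOrder G ≤ 1 := by
      rcases h4 with h4 | ⟨u, hu, hu'⟩
      · omega
      · by_contra hq
        have := ht.second
        by_cases h' : secondOrder G = 3
        · have := ht.second_path_pred (by omega) ⟨u, hnocyc u, hu'⟩
          omega
        · have := ht.second_path (by omega) ⟨u, hnocyc u, hu'⟩
          omega
    have hp3 : pathTotal G 3 = 2 := by
      rw [pathTotal, Finset.sum_eq_single t']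
      · unfold pathNum
        rw [if_neg (hnocyc t')]
        omega
      · intro c _ hc
        have := h3 c hc
        unfold pathNum
        rw [if_neg (hnocyc c)]
        omega
      · simp
    have hc3 : cycleTotal G 3 = 0 := by
      rw [cycleTotal, Finset.card_eq_zero, Finset.filter_eq_empty_iff]
      rintro c - ⟨hc, -⟩
      exact hnocyc c hc
    have hsum3 := embCount_three_eq_sum H
    rw [h 3 le_rfl, h 3 le_rfl, f3, f4, hp3, hc3] at hsum3
    apply hcon
    rw [degLeTwo_iff_degree]
    intro v
    by_contra hv
    have hle := Finset.single_le_sum (f := fun v => H.degree v * H.degree v - H.degree v)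
      (fun _ _ => Nat.zero_le _) (Finset.mem_univ v)
    simp only [← hsum3] at hle
    have : 3 * H.degree v ≤ H.degree v * H.degree v := Nat.mul_le_mul_right _ (by omega)
    omega
  -- Here `G` has at most one `P_3`, so `not_degLeTwo_bounds` would give four triangles and four
  -- isolated vertices, which the last exceptional case excludes.
  · have hm : ∀ c : G.ConnectedComponent, Nat.card c ≤ 3 := by
      intro c
      have := hF1' c
      by_cases hc : IsCyc c.toSimpleGraph
      · exact (hcard4 c hc).le
      · have : Nat.card c ≠ 4 := fun h => hP4 ⟨c, hc, h⟩
        omega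
    have hp3 : pathTotal G 3 ≤ 1 := by
      have : pathTotal G 3 = (Finset.univ.filter fun c : G.ConnectedComponent =>
          ¬ IsCyc c.toSimpleGraph ∧ Nat.card c = 3).card := by
        rw [pathTotal, Finset.card_filter]
        refine Finset.sum_congr rfl fun c _ => ?_
        have := hm c
        unfold pathNum
        by_cases hc : IsCyc c.toSimpleGraph
        · simp only [hc, if_true, not_true_eq_false, false_and, if_false]
          rw [if_neg (by omega)]
        · simp only [hc, if_false, not_false_eq_true, true_and]
          split_ifs <;> omega
      rw [this, Finset.card_le_one]
      intro a ha b hb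
      simp only [Finset.mem_filter, Finset.mem_univ, true_and] at ha hb
      by_contra hab
      have hmt : largestOrder G = 3 := by
        have := h2 a
        have := hm t'
        omega
      have hq : secondOrder G = 3 := by
        by_cases hat : a = t'
        · have := h3 b (fun hbt => hab (hat.trans hbt.symm))
          omega
        · have := h3 a hat
          omega
      have := ht.second_twice (by omega) ⟨a, b, hab, ⟨ha.1, by omega⟩, hb.1, by omega⟩
      omega
    obtain ⟨g1, g2⟩ := not_degLeTwo_bounds hcon (by rw [h 3 le_rfl, f3]; omega)
    rw [h 3 le_rfl, f4] at g1
    rw [hsum] at g2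
    have := hF4 (by omega)
    omega

end Upper

/-! ### Exchanging components without changing small decks -/

section Replace

variable {V : Type*} [Fintype V] {G : SimpleGraph V} {U : Type*} [Fintype U]

open Classical in
/-- The disjoint union of `B` with all components of `G` outside `T`. -/
abbrev replaceComponents (G : SimpleGraph V) [Fintype G.ConnectedComponent]
    (T : Finset G.ConnectedComponent) (B : SimpleGraph U) :
    SimpleGraph (U ⊕ {v | G.connectedComponentMk v ∈ Tᶜ}) :=
  B ⊕g G.induce {v | G.connectedComponentMk v ∈ Tᶜ}

theorem embCount_replaceComponents [Fintype G.ConnectedComponent] (T : Finset G.ConnectedComponent)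
    (B : SimpleGraph U) {W : Type*} [Finite W] {F : SimpleGraph W} (hF : F.Connected) :
    embCount F (replaceComponents G T B) + ∑ c ∈ T, embCount F c.toSimpleGraph =
      embCount F B + embCount F G := by
  classical
  rw [replaceComponents, embCount_sum hF, embCount_induce_components hF,
    embCount_eq_sum_components hF G, ← Finset.sum_add_sum_compl T]
  rw [add_assoc, add_comm (∑ c ∈ T, _)]

/-- Replacing some components by a graph with the same numbers of small connected induced
subgraphs does not change the decks. -/
theorem not_deckReconstructible_of_replace [Fintype G.ConnectedComponent]
    (T : Finset G.ConnectedComponent) (B : SimpleGraph U) {k : ℕ}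
    (heq : ∀ j ≤ k, ∀ F : SimpleGraph (Fin j), F.Connected →
      embCount F B = ∑ c ∈ T, embCount F c.toSimpleGraph)
    (hne : ¬ Nonempty (replaceComponents G T B ≃g G)) {j : ℕ} (hj : j ≤ k) :
    ¬ DeckReconstructible G j := by
  classical
  intro hrec
  let X := U ⊕ {v | G.connectedComponentMk v ∈ Tᶜ}
  have hfin : Fintype X := Fintype.ofFinite X
  let e := Fintype.equivFin X
  let i : replaceComponents G T B ≃g (replaceComponents G T B).map e.toEmbedding :=
    Iso.map e _
  obtain ⟨i'⟩ := hrec _ ((replaceComponents G T B).map e.toEmbedding)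
    (kDeck_eq_of_connected (fun l hl F hF => by
      rw [← embCount_congr_right F i]
      have h1 := embCount_replaceComponents T B hF
      have h2 := heq l hl F hF
      omega) hj)
  exact hne ⟨i.trans i'⟩

/-- A graph with the numbers of induced paths and cycles of a path (`b = false`) or a
cycle (`b = true`) with `o` vertices. -/
structure HasKind {U : Type*} (X : SimpleGraph U) (o : ℕ) (b : Bool) : Prop where
  degLeTwo : DegLeTwo X
  path : ∀ j, 1 ≤ j →
    embCount (pathGraph j) X = (if j = 1 then 1 else 2) * pathNum j o (b = true)
  cycle : ∀ j, 3 ≤ j → embCount (cycleGraph j) X =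
    (if b = true ∧ o = j then 1 else 0) * embCount (cycleGraph j) (cycleGraph j)

open Classical in
theorem hasKind_of_connected {X : SimpleGraph U} (hX : X.Connected) (hd : DegLeTwo X) :
    HasKind X (Nat.card U) (decide (IsCyc X)) where
  degLeTwo := hd
  path j hj := by
    rw [embCount_path hX hd hj]
    congr 1
    unfold pathNum
    simp only [decide_eq_true_eq]
  cycle j hj := by
    rw [embCount_cycle hX hd hj]
    simp only [decide_eq_true_eq]

/-- Order 0 is allowed although the empty graph is not connected: it lets every exchange have
exactly two new pieces, one possibly empty. -/
theorem hasKind_path (a : ℕ) : HasKind (pathGraph a) a false := by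
  classical
  rcases Nat.eq_zero_or_pos a with rfl | ha
  · have hzero : ∀ j, 1 ≤ j → ∀ F : SimpleGraph (Fin j), embCount F (pathGraph 0) = 0 := by
      intro j hj F
      have : IsEmpty (F ↪g pathGraph 0) := ⟨fun f => Fin.elim0 (f ⟨0, hj⟩)⟩
      exact Nat.card_of_isEmpty
    refine ⟨pathGraph_degLeTwo 0, fun j hj => ?_, fun j hj => ?_⟩
    · rw [hzero j hj]
      simp only [pathNum, Bool.false_eq_true, if_false]
      rw [show 0 + 1 - j = 0 by omega, mul_zero]
    · rw [hzero j (by omega)]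
      simp
  · have h := hasKind_of_connected (pathGraph_connected' ha) (pathGraph_degLeTwo a)
    rw [decide_eq_false (not_isCyc_of_iso_path ⟨RelIso.refl _⟩), Nat.card_eq_fintype_card,
      Fintype.card_fin] at h
    exact h

theorem hasKind_cycle {a : ℕ} (ha : 3 ≤ a) : HasKind (cycleGraph a) a true := by
  classical
  have h := hasKind_of_connected (cycleGraph_connected' (by omega)) (cycleGraph_degLeTwo ha)
  rw [decide_eq_true ((iso_cycle_iff ha).1 ⟨RelIso.refl _⟩).1, Nat.card_eq_fintype_card,
    Fintype.card_fin] at h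
  exact h

theorem embCount_eq_zero_of_not_degLeTwo {W X : Type*} {F : SimpleGraph W} {Y : SimpleGraph X}
    (hF : ¬ DegLeTwo F) (hY : DegLeTwo Y) : embCount F Y = 0 := by
  have : IsEmpty (F ↪g Y) := ⟨fun f => hF (hY.of_embedding f)⟩
  exact Nat.card_of_isEmpty

open Classical in
-- Reduces an exchange of the components in `T` for two pieces to arithmetic. Equality of path and
-- cycle numbers is needed only up to `k`; a difference at any size shows that the graphs are not
-- isomorphic.
theorem not_deckReconstructible_of_kinds [Fintype G.ConnectedComponent] (hG : DegLeTwo G)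
    (T : Finset G.ConnectedComponent) {U₁ U₂ : Type} [Fintype U₁] [Fintype U₂]
    {X : SimpleGraph U₁} {Y : SimpleGraph U₂}
    {o₁ o₂ : ℕ} {b₁ b₂ : Bool} (hX : HasKind X o₁ b₁) (hY : HasKind Y o₂ b₂) {k : ℕ}
    (hp : ∀ j, 1 ≤ j → j ≤ k → ∑ c ∈ T, pathNum j (Nat.card c) (IsCyc c.toSimpleGraph) =
      pathNum j o₁ (b₁ = true) + pathNum j o₂ (b₂ = true))
    (hc : ∀ j, 3 ≤ j → j ≤ k →
      (∑ c ∈ T, if IsCyc c.toSimpleGraph ∧ Nat.card c = j then 1 else 0) =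
      (if b₁ = true ∧ o₁ = j then 1 else 0) + if b₂ = true ∧ o₂ = j then 1 else 0)
    (hne : (∃ j, 1 ≤ j ∧ ∑ c ∈ T, pathNum j (Nat.card c) (IsCyc c.toSimpleGraph) ≠
        pathNum j o₁ (b₁ = true) + pathNum j o₂ (b₂ = true)) ∨
      ∃ j, 3 ≤ j ∧ (∑ c ∈ T, if IsCyc c.toSimpleGraph ∧ Nat.card c = j then 1 else 0) ≠
        (if b₁ = true ∧ o₁ = j then 1 else 0) + if b₂ = true ∧ o₂ = j then 1 else 0)
    {j : ℕ} (hj : j ≤ k) : ¬ DeckReconstructible G j := by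
  have hpath : ∀ j, 1 ≤ j → (embCount (pathGraph j) (X ⊕g Y) =
      ∑ c ∈ T, embCount (pathGraph j) c.toSimpleGraph ↔
      ∑ c ∈ T, pathNum j (Nat.card c) (IsCyc c.toSimpleGraph) =
      pathNum j o₁ (b₁ = true) + pathNum j o₂ (b₂ = true)) := by
    intro j hj
    rw [embCount_sum (pathGraph_connected' hj), hX.path j hj, hY.path j hj, ← mul_add,
      Finset.sum_congr rfl fun c _ =>
        embCount_path c.connected_toSimpleGraph (hG.component c) hj, ← Finset.mul_sum]
    rw [Nat.mul_right_inj (by split_ifs <;> omega), eq_comm]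
  have hcycle : ∀ j, 3 ≤ j → (embCount (cycleGraph j) (X ⊕g Y) =
      ∑ c ∈ T, embCount (cycleGraph j) c.toSimpleGraph ↔
      (∑ c ∈ T, if IsCyc c.toSimpleGraph ∧ Nat.card c = j then 1 else 0) =
      (if b₁ = true ∧ o₁ = j then 1 else 0) + if b₂ = true ∧ o₂ = j then 1 else 0) := by
    intro j hj
    rw [embCount_sum (cycleGraph_connected' (by omega)), hX.cycle j hj, hY.cycle j hj, ← add_mul,
      Finset.sum_congr rfl fun c _ =>
        embCount_cycle c.connected_toSimpleGraph (hG.component c) hj, ← Finset.sum_mul]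
    rw [Nat.mul_left_inj (embCount_cycle_self_pos j).ne', eq_comm]
  refine not_deckReconstructible_of_replace T (X ⊕g Y) (k := k) ?_ ?_ hj
  · intro l hl F hF
    by_cases hd : DegLeTwo F
    · refine forall_connected_of_path_cycle
        (p := fun j F => embCount F (X ⊕g Y) = ∑ c ∈ T, embCount F c.toSimpleGraph)
        ?_ (fun j h1 h2 => (hpath j h1).2 (hp j h1 h2))
        (fun j h1 h2 => (hcycle j h1).2 (hc j h1 h2)) hl F hF hd
      rintro j F F' ⟨e⟩ h
      simpa only [embCount_congr_left e] using h
    · rw [embCount_sum hF, embCount_eq_zero_of_not_degLeTwo hd hX.degLeTwo,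
        embCount_eq_zero_of_not_degLeTwo hd hY.degLeTwo]
      exact (Finset.sum_eq_zero fun c _ =>
        embCount_eq_zero_of_not_degLeTwo hd (hG.component c)).symm
  · rintro ⟨e⟩
    rcases hne with ⟨j, hj, h⟩ | ⟨j, hj, h⟩
    · have := embCount_replaceComponents T (X ⊕g Y) (pathGraph_connected' hj)
      rw [embCount_congr_right _ e] at this
      exact h ((hpath j hj).1 (by omega))
    · have := embCount_replaceComponents T (X ⊕g Y) (cycleGraph_connected' (show 1 ≤ j by omega))
      rw [embCount_congr_right _ e] at this
      exact h ((hcycle j hj).1 (by omega))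

variable {t u : G.ConnectedComponent} {a b k j : ℕ}

/-- `P_a + P_b` becomes `P_{a+1} + P_{b-1}`. The number `o + 1 - j` is linear in `o` for `j ≤ o +
1`, which for the shorter new path means `j ≤ b`. -/
theorem not_deckReconstructible_paths_up (hG : DegLeTwo G) (htu : t ≠ u)
    (ht : ¬ IsCyc t.toSimpleGraph) (hu : ¬ IsCyc u.toSimpleGraph) (hta : Nat.card t = a)
    (hub : Nat.card u = b) (hab : b ≤ a) (hk : k ≤ b) (hj : j ≤ k) :
    ¬ DeckReconstructible G j := by
  classical
  let I : Fintype G.ConnectedComponent := Fintype.ofFinite _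
  have hb : 1 ≤ b := hub ▸ card_component_pos u
  refine not_deckReconstructible_of_kinds hG {t, u} (hasKind_path (a + 1)) (hasKind_path (b - 1))
    ?_ ?_ (Or.inl ⟨a + 1, by omega, ?_⟩) hj
  · intro j h1 h2
    simp only [Finset.sum_pair htu, pathNum, ht, hu, hta, hub, if_false, Bool.false_eq_true]
    omega
  · intro j h1 h2
    simp [Finset.sum_pair htu, ht, hu]
  · simp only [Finset.sum_pair htu, pathNum, ht, hu, hta, hub, if_false, Bool.false_eq_true]
    omega

/-- The reverse shift, to `P_{a-1} + P_{b+1}`. Linearity is now limited by the old `P_b`, which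
gains one more value, `k = b + 1`. -/
theorem not_deckReconstructible_paths_down (hG : DegLeTwo G)
    (ht : ¬ IsCyc t.toSimpleGraph) (hu : ¬ IsCyc u.toSimpleGraph) (hta : Nat.card t = a)
    (hub : Nat.card u = b) (hab : b + 2 ≤ a) (hk : k ≤ b + 1) (hj : j ≤ k) :
    ¬ DeckReconstructible G j := by
  classical
  let I : Fintype G.ConnectedComponent := Fintype.ofFinite _
  have htu : t ≠ u := by
    rintro rfl
    omega
  refine not_deckReconstructible_of_kinds hG {t, u} (hasKind_path (a - 1)) (hasKind_path (b + 1))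
    ?_ ?_ (Or.inl ⟨a, by omega, ?_⟩) hj
  · intro j h1 h2
    simp only [Finset.sum_pair htu, pathNum, ht, hu, hta, hub, if_false, Bool.false_eq_true]
    omega
  · intro j h1 h2
    simp [Finset.sum_pair htu, ht, hu]
  · simp only [Finset.sum_pair htu, pathNum, ht, hu, hta, hub, if_false, Bool.false_eq_true]
    omega

/-- The cycle is opened and joined to the path: `C_a + P_b` becomes `P_{a+b}`, and `a + (b + 1 - j)
= (a + b) + 1 - j` for `j < a`, `j ≤ b + 1`. -/
theorem not_deckReconstructible_cycle_path (hG : DegLeTwo G)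
    (ht : IsCyc t.toSimpleGraph) (hu : ¬ IsCyc u.toSimpleGraph) (hta : Nat.card t = a)
    (hub : Nat.card u = b) (hk : k ≤ b + 1) (hka : k < a) (hj : j ≤ k) :
    ¬ DeckReconstructible G j := by
  classical
  let I : Fintype G.ConnectedComponent := Fintype.ofFinite _
  have ha : 3 ≤ a := hta ▸ ht.1
  have htu : t ≠ u := by
    rintro rfl
    exact hu ht
  refine not_deckReconstructible_of_kinds hG {t, u} (hasKind_path (a + b)) (hasKind_path 0)
    ?_ ?_ (Or.inr ⟨a, ha, ?_⟩) hj
  · intro j h1 h2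
    simp only [Finset.sum_pair htu, pathNum, ht, hu, hta, hub, if_false, Bool.false_eq_true,
      if_true]
    split_ifs <;> omega
  · intro j h1 h2
    simp only [Finset.sum_pair htu, ht, hu, hta, true_and, false_and, if_false,
      Bool.false_eq_true]
    split_ifs <;> omega
  · simp [Finset.sum_pair htu, ht, hu, hta, -Nat.card_eq_fintype_card]

/-- `C_a + C_b` becomes `C_{a+b}`. -/
theorem not_deckReconstructible_cycles (hG : DegLeTwo G) (htu : t ≠ u)
    (ht : IsCyc t.toSimpleGraph) (hu : IsCyc u.toSimpleGraph) (hta : Nat.card t = a)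
    (hub : Nat.card u = b) (hka : k < a) (hkb : k < b) (hj : j ≤ k) :
    ¬ DeckReconstructible G j := by
  classical
  let I : Fintype G.ConnectedComponent := Fintype.ofFinite _
  have ha : 3 ≤ a := hta ▸ ht.1
  have hb : 3 ≤ b := hub ▸ hu.1
  refine not_deckReconstructible_of_kinds hG {t, u} (hasKind_cycle (a := a + b) (by omega))
    (hasKind_path 0) ?_ ?_ (Or.inr ⟨a, ha, ?_⟩) hj
  · intro j h1 h2
    simp only [Finset.sum_pair htu, pathNum, ht, hu, hta, hub, if_false, Bool.false_eq_true,
      if_true]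
    split_ifs <;> omega
  · intro j h1 h2
    simp only [Finset.sum_pair htu, ht, hu, hta, hub, true_and, false_and, if_false,
      Bool.false_eq_true]
    split_ifs <;> omega
  · simp only [Finset.sum_pair htu, ht, hu, hta, hub, true_and, false_and, if_false,
      Bool.false_eq_true, if_true]
    split_ifs <;> omega

theorem not_deckReconstructible_path (hG : DegLeTwo G) (ht : ¬ IsCyc t.toSimpleGraph)
    (hta : Nat.card t = a) (hk : k ≤ a / 2) (hj : j ≤ k) : ¬ DeckReconstructible G j := by
  classical
  let I : Fintype G.ConnectedComponent := Fintype.ofFinite _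
  have ha : 1 ≤ a := hta ▸ card_component_pos t
  -- In general `P_a` becomes a cycle on `⌈a/2⌉ + 1` vertices and a path on the other `⌊a/2⌋ - 1`.
  -- For `a ≤ 2` that cycle would be too short, and two isolated vertices serve instead.
  rcases le_or_gt a 2 with ha2 | ha2
  · refine not_deckReconstructible_of_kinds hG {t} (hasKind_path 1) (hasKind_path 1)
      (k := k) ?_ ?_ (Or.inl ⟨a, by omega, ?_⟩) hj
    · intro j h1 h2
      simp only [Finset.sum_singleton, pathNum, ht, hta, if_false, Bool.false_eq_true]
      omega
    · intro j h1 h2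
      simp [ht]
    · simp only [Finset.sum_singleton, pathNum, ht, hta, if_false, Bool.false_eq_true]
      omega
  · refine not_deckReconstructible_of_kinds hG {t}
      (hasKind_cycle (a := (a + 1) / 2 + 1) (by omega)) (hasKind_path (a / 2 - 1))
      (k := k) ?_ ?_ (Or.inr ⟨(a + 1) / 2 + 1, by omega, ?_⟩) hj
    · intro j h1 h2
      simp only [Finset.sum_singleton, pathNum, ht, hta, if_false, Bool.false_eq_true, if_true]
      split_ifs <;> omega
    · intro j h1 h2
      simp only [Finset.sum_singleton, ht, false_and, if_false, Bool.false_eq_true, true_and]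
      split_ifs <;> omega
    · simp only [Finset.sum_singleton, ht, false_and, if_false, if_true, Bool.false_eq_true,
        true_and]
      omega

/-- The cycle is split into two halves, which are cycles because `a ≥ 6`. -/
theorem not_deckReconstructible_cycle (hG : DegLeTwo G) (ht : IsCyc t.toSimpleGraph)
    (hta : Nat.card t = a) (ha : 6 ≤ a) (hk : k < a / 2) (hj : j ≤ k) :
    ¬ DeckReconstructible G j := by
  classical
  let I : Fintype G.ConnectedComponent := Fintype.ofFinite _
  refine not_deckReconstructible_of_kinds hG {t}
    (hasKind_cycle (a := a / 2) (by omega)) (hasKind_cycle (a := a - a / 2) (by omega))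
    (k := k) ?_ ?_ (Or.inr ⟨a, by omega, ?_⟩) hj
  · intro j h1 h2
    simp only [Finset.sum_singleton, pathNum, ht, hta, if_true]
    split_ifs <;> omega
  · intro j h1 h2
    simp only [Finset.sum_singleton, ht, hta, true_and]
    split_ifs <;> omega
  · simp only [Finset.sum_singleton, ht, hta, true_and]
    split_ifs <;> omega

end Replace

/-! ### The lower bound `k_G` -/

section Lower

variable {V : Type*} [Fintype V] [Nonempty V] {G : SimpleGraph V} {j : ℕ}

theorem not_deckReconstructible_of_lt_second (hG : DegLeTwo G)
    (hj : j < secondOrder G + epsTwo G) : ¬ DeckReconstructible G j := by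
  obtain ⟨t, h1, h2, h3, h4, h5⟩ := exists_largest G
  simp only [epsTwo] at hj
  split_ifs at hj with ha hb
  · rw [hasComponent_path_iff hG] at ha
    obtain ⟨hlt, w, hw, hwq⟩ := ha
    by_cases ht : IsCyc t.toSimpleGraph
    · exact not_deckReconstructible_cycle_path hG ht hw h1 hwq (k := secondOrder G + 1)
        (by omega) (by omega) (by omega)
    · exact not_deckReconstructible_paths_down hG ht hw h1 hwq (k := secondOrder G + 1)
        (by omega) (by omega) (by omega)
  · rw [hasComponent_path_iff hG, hasComponent_path_iff hG, two_le_componentCount_iff hG] at hb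
    rcases hb with ⟨hlt, w, hw, hwq⟩ | ⟨hlt, ⟨w, hw, hwq⟩, -⟩ | ⟨hq, w, w', hne, hw, hw'⟩
    · by_cases ht : IsCyc t.toSimpleGraph
      · exact not_deckReconstructible_cycle_path hG ht hw h1 hwq (k := secondOrder G)
          (by omega) (by omega) (by omega)
      · have htw : t ≠ w := by
          rintro rfl
          omega
        exact not_deckReconstructible_paths_up hG htw ht hw h1 hwq (k := secondOrder G)
          (by omega) (by omega) (by omega)
    · have hpos := card_component_pos w
      by_cases ht : IsCyc t.toSimpleGraph
      · exact not_deckReconstructible_cycle_path hG ht hw h1 hwq (k := secondOrder G)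
          (by omega) (by omega) (by omega)
      · exact not_deckReconstructible_paths_down hG ht hw h1 hwq (k := secondOrder G)
          (by omega) (by omega) (by omega)
    · exact not_deckReconstructible_paths_up hG hne hw.1 hw'.1 hw.2 hw'.2 (k := secondOrder G)
        (by omega) (by omega) (by omega)
  · rcases h4 with h4 | ⟨u, hu, hu'⟩
    · omega
    by_cases ht : IsCyc t.toSimpleGraph <;> by_cases hcu : IsCyc u.toSimpleGraph
    · exact not_deckReconstructible_cycles hG hu.symm ht hcu h1 hu' (k := secondOrder G - 1)
        (by omega) (by omega) (by omega)
    · exact not_deckReconstructible_cycle_path hG ht hcu h1 hu' (k := secondOrder G - 1)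
        (by omega) (by omega) (by omega)
    · exact not_deckReconstructible_cycle_path hG hcu ht hu' h1 (k := secondOrder G - 1)
        (by omega) (by omega) (by omega)
    · exact not_deckReconstructible_paths_up hG hu.symm ht hcu h1 hu' (k := secondOrder G - 1)
        (by omega) (by omega) (by omega)

theorem not_deckReconstructible_of_lt_first (hG : DegLeTwo G)
    (hcycle : ∀ j : ℕ, 3 ≤ j → j < 6 → ¬ Nonempty (G ≃g cycleGraph j))
    (hj : j < largestOrder G / 2 + epsOne G) : ¬ DeckReconstructible G j := by
  obtain ⟨t, h1, h2, h3, h4, h5⟩ := exists_largest G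
  rw [epsOne, hasComponent_path_iff hG] at hj
  split_ifs at hj with h
  · obtain ⟨w, hw, hw'⟩ := h
    exact not_deckReconstructible_path hG hw hw' le_rfl (by omega)
  · have ht : IsCyc t.toSimpleGraph := by
      by_contra ht
      exact h ⟨t, ht, h1⟩
    have ht3 : 3 ≤ Nat.card t := ht.1
    by_cases hm : 6 ≤ largestOrder G
    · exact not_deckReconstructible_cycle hG ht h1 hm (k := largestOrder G / 2 - 1)
        (by omega) (by omega)
    -- For `C_3`, `C_4`, `C_5` half the order is at most 2. There is a further component, and it
    -- already yields `q + ε' ≥ 2`.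
    apply not_deckReconstructible_of_lt_second hG
    rcases h4 with h4 | ⟨u, hu, hu'⟩
    · exfalso
      have huniq : ∀ c, c = t := by
        intro c
        by_contra hne
        have := h3 c hne
        have := card_component_pos c
        omega
      obtain ⟨e⟩ := iso_component_of_unique huniq
      obtain ⟨e'⟩ := ht.2
      exact hcycle _ ht3 (by omega) ⟨e.trans e'⟩
    · have hpos := card_component_pos u
      by_cases hq : 2 ≤ secondOrder G
      · omega
      · have hup : ¬ IsCyc u.toSimpleGraph := by
          intro hc
          have : 3 ≤ Nat.card u := hc.1
          omega
        have : epsTwo G = 2 := by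
          simp only [epsTwo]
          rw [if_pos ⟨by omega, (hasComponent_path_iff hG _).2 ⟨u, hup, hu'⟩⟩]
        omega

theorem not_deckReconstructible_of_lt (hG : DegLeTwo G)
    (hcycle : ∀ j : ℕ, 3 ≤ j → j < 6 → ¬ Nonempty (G ≃g cycleGraph j))
    (hj : j < kNumber G) : ¬ DeckReconstructible G j := by
  rw [kNumber, lt_max_iff] at hj
  exact hj.elim (not_deckReconstructible_of_lt_first hG hcycle)
    (not_deckReconstructible_of_lt_second hG)

end Lower

/-! ### The exceptional family at `k = 3` -/

section Exceptional

variable {V : Type*} [Fintype V] {G : SimpleGraph V}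

theorem degLeTwo_of_card_le_three {j : ℕ} (hj : j ≤ 3) (F : SimpleGraph (Fin j)) : DegLeTwo F := by
  by_contra h
  obtain ⟨v, a, b, c, ha, hb, hc, hab, hac, hbc⟩ := exists_three_of_not_degLeTwo h
  have := Fintype.card_le_of_injective _ (injective_vec_four ha.ne hb.ne hc.ne hab hac hbc)
  simp at this
  omega

/-- Replacing some components by a graph with a vertex of degree three, with equal numbers of
vertices, edges, induced paths with three vertices, and triangles. -/
theorem not_deckReconstructible_three (hG : DegLeTwo G) [Fintype G.ConnectedComponent]
    (T : Finset G.ConnectedComponent) {n : ℕ} {U : Type} [Fintype U] (B : SimpleGraph U)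
    (hB : ¬ DegLeTwo B)
    (hp : ∀ j, 1 ≤ j → j ≤ 3 →
      embCount (pathGraph j) B = ∑ c ∈ T, embCount (pathGraph j) c.toSimpleGraph)
    (hc : embCount (cycleGraph 3) B = ∑ c ∈ T, embCount (cycleGraph 3) c.toSimpleGraph)
    (hn : n ≤ 3) : ¬ DeckReconstructible G n := by
  refine not_deckReconstructible_of_replace T B (k := 3) ?_ ?_ hn
  · intro l hl F hF
    refine forall_connected_of_path_cycle
      (p := fun j F => embCount F B = ∑ c ∈ T, embCount F c.toSimpleGraph)
      ?_ hp (fun j h1 h2 => ?_) hl F hF (degLeTwo_of_card_le_three hl F)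
    · rintro j F F' ⟨e⟩ h
      simpa only [embCount_congr_left e] using h
    · obtain rfl : j = 3 := by omega
      exact hc
  · rintro ⟨e⟩
    exact hB ((hG.of_embedding e.toEmbedding).of_embedding Embedding.sumInl)

/-- The path with `n - 1` vertices with a further leaf attached to its second vertex. -/
def broom (n : ℕ) : SimpleGraph (Fin n) where
  Adj u v := (u.val + 1 = v.val ∧ v.val + 1 < n) ∨ (v.val + 1 = u.val ∧ u.val + 1 < n) ∨
    (u.val = 1 ∧ v.val + 1 = n ∧ 3 < n) ∨ (v.val = 1 ∧ u.val + 1 = n ∧ 3 < n)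
  symm := ⟨fun u v h => by omega⟩
  loopless := ⟨fun u h => by omega⟩

instance (n : ℕ) : DecidableRel (broom n).Adj := fun u v => by
  unfold broom
  infer_instance

/-- The triangle with a pendant edge. -/
def paw : SimpleGraph (Fin 4) where
  Adj u v := u ≠ v ∧ (v.val < 3 ∧ u.val < 3 ∨ u.val = 0 ∨ v.val = 0) ∧
    ¬ (u.val = 3 ∧ v.val ≠ 0) ∧ ¬ (v.val = 3 ∧ u.val ≠ 0)
  symm := ⟨fun u v h => by omega⟩
  loopless := ⟨fun u h => by omega⟩

instance : DecidableRel paw.Adj := fun u v => by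
  unfold paw
  infer_instance

theorem broom_not_degLeTwo {n : ℕ} (hn : 4 ≤ n) : ¬ DegLeTwo (broom n) := by
  intro h
  have := h ⟨1, by omega⟩ ⟨0, by omega⟩ ⟨2, by omega⟩ ⟨n - 1, by omega⟩
  simp [broom] at this
  omega

/-- The numbers of vertices, edges, induced paths with three vertices, and triangles, where all
but the first are counted with labels. -/
structure HasCounts {U : Type*} (B : SimpleGraph U) (n₁ n₂ n₃ n₄ : ℕ) : Prop where
  one : embCount (pathGraph 1) B = n₁
  two : embCount (pathGraph 2) B = n₂
  three : embCount (pathGraph 3) B = n₃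
  cycle : embCount (cycleGraph 3) B = n₄

theorem HasCounts.sum {U U' : Type*} [Finite U] [Finite U'] {B : SimpleGraph U}
    {B' : SimpleGraph U'} {n₁ n₂ n₃ n₄ l₁ l₂ l₃ l₄ : ℕ} (h : HasCounts B n₁ n₂ n₃ n₄)
    (h' : HasCounts B' l₁ l₂ l₃ l₄) :
    HasCounts (B ⊕g B') (n₁ + l₁) (n₂ + l₂) (n₃ + l₃) (n₄ + l₄) where
  one := by rw [embCount_sum (pathGraph_connected' le_rfl), h.one, h'.one]
  two := by rw [embCount_sum (pathGraph_connected' (by omega)), h.two, h'.two]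
  three := by rw [embCount_sum (pathGraph_connected' (by omega)), h.three, h'.three]
  cycle := by rw [embCount_sum (cycleGraph_connected' (by omega)), h.cycle, h'.cycle]

theorem HasKind.hasCounts {U : Type*} {X : SimpleGraph U} {o : ℕ} {b : Bool} (h : HasKind X o b) :
    HasCounts X (pathNum 1 o (b = true)) (2 * pathNum 2 o (b = true))
      (2 * pathNum 3 o (b = true)) (if b = true ∧ o = 3 then 6 else 0) where
  one := by simpa using h.path 1 le_rfl
  two := by simpa using h.path 2 (by omega)
  three := by simpa using h.path 3 (by omega)
  cycle := by
    rw [h.cycle 3 le_rfl, embCount_cycle_three_self]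
    split_ifs <;> rfl

set_option maxRecDepth 100000 in
-- The broom has `n - 1` edges and `3 + (n - 4)` induced `P_3`, as many as `C_{n-1} + P_1`. Cycles
-- up to `C_7` suffice since `k_G ≤ 3` gives `m ≤ 7`; `n = 4` is the claw.
theorem hasCounts_broom : ∀ n ∈ [4, 5, 6, 7, 8],
    HasCounts (broom n) n (2 * n - 2) (2 * n - 2) 0 := by
  have key : ∀ n ∈ [4, 5, 6, 7, 8],
      Fintype.card {p : Fin n × Fin n // (broom n).Adj p.1 p.2} = 2 * n - 2 ∧
      Fintype.card {p : Fin n × Fin n × Fin n // (broom n).Adj p.1 p.2.1 ∧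
        (broom n).Adj p.1 p.2.2 ∧ p.2.1 ≠ p.2.2 ∧ ¬ (broom n).Adj p.2.1 p.2.2} = 2 * n - 2 ∧
      Fintype.card {p : Fin n × Fin n × Fin n // (broom n).Adj p.1 p.2.1 ∧
        (broom n).Adj p.1 p.2.2 ∧ p.2.1 ≠ p.2.2 ∧ (broom n).Adj p.2.1 p.2.2} = 0 := by
    decide +kernel
  intro n hn
  obtain ⟨h1, h2, h3⟩ := key n hn
  refine ⟨?_, ?_, ?_, ?_⟩
  · rw [embCount_path_one, Nat.card_eq_fintype_card, Fintype.card_fin]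
  · rw [embCount_path_two, Nat.card_eq_fintype_card, h1]
  · rw [embCount_path_three, Nat.card_eq_fintype_card, h2]
  · rw [embCount_cycle_three, Nat.card_eq_fintype_card, h3]

set_option maxRecDepth 100000 in
theorem hasCounts_paw : HasCounts paw 4 8 4 6 := by
  have h1 : Fintype.card {p : Fin 4 × Fin 4 // paw.Adj p.1 p.2} = 8 := by decide +kernel
  have h2 : Fintype.card {p : Fin 4 × Fin 4 × Fin 4 // paw.Adj p.1 p.2.1 ∧ paw.Adj p.1 p.2.2 ∧
      p.2.1 ≠ p.2.2 ∧ ¬ paw.Adj p.2.1 p.2.2} = 4 := by decide +kernel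
  have h3 : Fintype.card {p : Fin 4 × Fin 4 × Fin 4 // paw.Adj p.1 p.2.1 ∧ paw.Adj p.1 p.2.2 ∧
      p.2.1 ≠ p.2.2 ∧ paw.Adj p.2.1 p.2.2} = 6 := by decide +kernel
  refine ⟨?_, ?_, ?_, ?_⟩
  · rw [embCount_path_one, Nat.card_eq_fintype_card, Fintype.card_fin]
  · rw [embCount_path_two, Nat.card_eq_fintype_card, h1]
  · rw [embCount_path_three, Nat.card_eq_fintype_card, h2]
  · rw [embCount_cycle_three, Nat.card_eq_fintype_card, h3]

theorem hasCounts_top_four : HasCounts (⊤ : SimpleGraph (Fin 4)) 4 12 0 24 where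
  one := by rw [embCount_path_one, Nat.card_eq_fintype_card, Fintype.card_fin]
  two := by rw [pathGraph_two_eq_top, embCount_top]; rfl
  three := by
    rw [embCount_path_three]
    have : IsEmpty {p : Fin 4 × Fin 4 × Fin 4 // (⊤ : SimpleGraph (Fin 4)).Adj p.1 p.2.1 ∧
        (⊤ : SimpleGraph (Fin 4)).Adj p.1 p.2.2 ∧
        p.2.1 ≠ p.2.2 ∧ ¬ (⊤ : SimpleGraph (Fin 4)).Adj p.2.1 p.2.2} :=
      ⟨fun p => p.2.2.2.2 p.2.2.2.1⟩
    exact Nat.card_of_isEmpty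
  cycle := by rw [cycleGraph_three_eq_top, embCount_top]; rfl

theorem hasCounts_edge : HasCounts (pathGraph 2) 2 2 0 0 := by
  simpa [pathNum] using (hasKind_path 2).hasCounts

theorem not_degLeTwo_sum {U U' : Type*} {B : SimpleGraph U} (h : ¬ DegLeTwo B)
    (B' : SimpleGraph U') : ¬ DegLeTwo (B ⊕g B') :=
  fun H => h (H.of_embedding Embedding.sumInl)

open Classical in
theorem not_deckReconstructible_of_hasCounts (hG : DegLeTwo G) [Fintype G.ConnectedComponent]
    (T : Finset G.ConnectedComponent) {n : ℕ} {U : Type} [Fintype U] {B : SimpleGraph U}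
    (hB : ¬ DegLeTwo B) {n₁ n₂ n₃ n₄ : ℕ} (h : HasCounts B n₁ n₂ n₃ n₄)
    (h1 : ∑ c ∈ T, pathNum 1 (Nat.card c) (IsCyc c.toSimpleGraph) = n₁)
    (h2 : ∑ c ∈ T, 2 * pathNum 2 (Nat.card c) (IsCyc c.toSimpleGraph) = n₂)
    (h3 : ∑ c ∈ T, 2 * pathNum 3 (Nat.card c) (IsCyc c.toSimpleGraph) = n₃)
    (h4 : ∑ c ∈ T, (if IsCyc c.toSimpleGraph ∧ Nat.card c = 3 then 6 else 0) = n₄)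
    (hn : n ≤ 3) : ¬ DeckReconstructible G n := by
  have hc : ∀ c : G.ConnectedComponent, HasCounts c.toSimpleGraph
      (pathNum 1 (Nat.card c) (IsCyc c.toSimpleGraph))
      (2 * pathNum 2 (Nat.card c) (IsCyc c.toSimpleGraph))
      (2 * pathNum 3 (Nat.card c) (IsCyc c.toSimpleGraph))
      (if IsCyc c.toSimpleGraph ∧ Nat.card c = 3 then 6 else 0) := by
    intro c
    have := (hasKind_of_connected c.connected_toSimpleGraph (hG.component c)).hasCounts
    simpa only [pathNum, decide_eq_true_eq] using this
  refine not_deckReconstructible_three hG T B hB ?_ ?_ hn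
  · intro j hj1 hj3
    interval_cases j
    · rw [h.one, ← h1]
      exact Finset.sum_congr rfl fun c _ => (hc c).one.symm
    · rw [h.two, ← h2]
      exact Finset.sum_congr rfl fun c _ => (hc c).two.symm
    · rw [h.three, ← h3]
      exact Finset.sum_congr rfl fun c _ => (hc c).three.symm
  · rw [h.cycle, ← h4]
    exact Finset.sum_congr rfl fun c _ => (hc c).cycle.symm

theorem not_deckReconstructible_cycle_isolated (hG : DegLeTwo G) {w s : G.ConnectedComponent}
    (hw : IsCyc w.toSimpleGraph) (hs : ¬ IsCyc s.toSimpleGraph) (hs1 : Nat.card s = 1) {a : ℕ}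
    (hwa : Nat.card w = a) (ha : 4 ≤ a) (ha' : a ≤ 7) {n : ℕ} (hn : n ≤ 3) :
    ¬ DeckReconstructible G n := by
  classical
  let I : Fintype G.ConnectedComponent := Fintype.ofFinite _
  have hws : w ≠ s := by
    rintro rfl
    exact hs hw
  have hmem : a + 1 ∈ [4, 5, 6, 7, 8] := by
    interval_cases a <;> simp
  refine not_deckReconstructible_of_hasCounts hG {w, s} (broom_not_degLeTwo (n := a + 1) (by omega))
    (hasCounts_broom _ hmem) ?_ ?_ ?_ ?_ hn
  all_goals
    simp only [Finset.sum_pair hws, pathNum, hw, hs, hwa, hs1, if_true, if_false, true_and,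
      false_and]
    split_ifs <;> omega

theorem not_deckReconstructible_exceptional [Nonempty V] (hG : DegLeTwo G) (hk : kNumber G ≤ 3)
    (hF : InExceptionalFamily G) {n : ℕ} (hn : n ≤ 3) : ¬ DeckReconstructible G n := by
  classical
  let I : Fintype G.ConnectedComponent := Fintype.ofFinite _
  obtain ⟨t, ht⟩ := largeEnough_of_kNumber_le hG hk
  have hm := ht.half
  obtain ⟨hP1, hF⟩ := hF
  rw [hasComponent_path_iff hG] at hP1
  obtain ⟨s, hs, hs1⟩ := hP1
  rw [hasComponent_cycle_iff (by omega), hasComponent_path_iff hG,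
    hasComponent_cycle_iff le_rfl] at hF
  rcases hF with ⟨w, hw⟩ | ⟨w, hw, hw4⟩ | ⟨⟨w, hw, hw4⟩, z, hz, hz3⟩ | ⟨h3, h1⟩
  · have hw : 5 ≤ Nat.card w := hw
    have hwm : Nat.card w ≤ largestOrder G := ht.le_top w
    by_cases hc : IsCyc w.toSimpleGraph
    · exact not_deckReconstructible_cycle_isolated hG hc hs hs1 rfl (by omega) (by omega) hn
    -- A path with five or more vertices must be the largest component because `q ≤ 3`; then `⌊m/2⌋
    -- + 1 ≤ 3` leaves only `P_5`.
    · have hwt : w = t := by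
        by_contra hne
        have h1 : Nat.card w ≤ secondOrder G := ht.le_second w hne
        have h2 := ht.second
        omega
      have htop : Nat.card w = largestOrder G := hwt ▸ ht.top
      have hh := ht.half_path ⟨w, hc, htop⟩
      have hw5 : Nat.card w = 5 := by omega
      have hws : w ≠ s := by
        rintro rfl
        omega
      -- `P_5 + P_1` is exchanged for the claw and an edge.
      refine not_deckReconstructible_of_hasCounts hG {w, s}
        (not_degLeTwo_sum (broom_not_degLeTwo le_rfl) (pathGraph 2))
        ((hasCounts_broom 4 (by simp)).sum hasCounts_edge) ?_ ?_ ?_ ?_ hn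
      all_goals
        simp [Finset.sum_pair hws, pathNum, hc, hs, hw5, hs1, -Nat.card_eq_fintype_card]
  · exact not_deckReconstructible_cycle_isolated hG hw hs hs1 hw4 le_rfl (by omega) hn
  · have hwz : w ≠ z := by
      rintro rfl
      exact hw hz
    have hws : w ≠ s := by
      rintro rfl
      omega
    have hzs : z ≠ s := by
      rintro rfl
      exact hs hz
    have hwzs : w ∉ ({z, s} : Finset G.ConnectedComponent) := by simp [hwz, hws]
    have hpaw : ¬ DegLeTwo paw := by
      intro h
      have := h 0 1 2 3 (by decide) (by decide) (by decide)
      revert this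
      decide
    -- `P_4 + C_3 + P_1` is exchanged for the paw and two edges.
    refine not_deckReconstructible_of_hasCounts hG {w, z, s}
      (not_degLeTwo_sum hpaw (pathGraph 2 ⊕g pathGraph 2))
      (hasCounts_paw.sum (hasCounts_edge.sum hasCounts_edge)) ?_ ?_ ?_ ?_ hn
    all_goals
      simp [Finset.sum_insert hwzs, Finset.sum_pair hzs, pathNum, hw, hz, hs, hw4, hz3, hs1,
        -Nat.card_eq_fintype_card]
  · rw [componentCount_cycle le_rfl, shapeCount] at h3
    rw [componentCount_path hG, shapeCount] at h1
    obtain ⟨T₁, hT₁, hc₁⟩ := Finset.exists_subset_card_eq h3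
    obtain ⟨T₂, hT₂, hc₂⟩ := Finset.exists_subset_card_eq h1
    have m₁ : ∀ c ∈ T₁, IsCyc c.toSimpleGraph ∧ Nat.card c = 3 := by
      intro c hc
      have := hT₁ hc
      simp only [Finset.mem_filter, Finset.mem_univ, true_and, iff_true] at this
      exact this.symm
    have m₂ : ∀ c ∈ T₂, ¬ IsCyc c.toSimpleGraph ∧ Nat.card c = 1 := by
      intro c hc
      have := hT₂ hc
      simp only [Finset.mem_filter, Finset.mem_univ, true_and, iff_false] at this
      exact this.symm
    have hdisj : Disjoint T₁ T₂ := by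
      rw [Finset.disjoint_left]
      intro c h h'
      exact (m₂ c h').1 (m₁ c h).1
    have hsum : ∀ (f : G.ConnectedComponent → ℕ) (x y : ℕ), (∀ c ∈ T₁, f c = x) →
        (∀ c ∈ T₂, f c = y) → ∑ c ∈ T₁ ∪ T₂, f c = 4 * x + 4 * y := by
      intro f x y hx hy
      rw [Finset.sum_union hdisj, Finset.sum_congr rfl hx, Finset.sum_congr rfl hy]
      simp [hc₁, hc₂]
    have htop : ¬ DegLeTwo (⊤ : SimpleGraph (Fin 4)) := by
      intro h
      have := h 0 1 2 3 (by simp) (by simp) (by simp)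
      simp at this
    have e3 := hasCounts_edge.sum (hasCounts_edge.sum hasCounts_edge)
    -- Four `C_3` and four `P_1` are exchanged for `K_4` and six edges.
    refine not_deckReconstructible_of_hasCounts hG (T₁ ∪ T₂) (not_degLeTwo_sum htop _)
      (hasCounts_top_four.sum (e3.sum e3)) ?_ ?_ ?_ ?_ hn
    · rw [hsum _ 3 1 (fun c hc => by simp [pathNum, m₁ c hc, -Nat.card_eq_fintype_card])
        (fun c hc => by simp [pathNum, m₂ c hc, -Nat.card_eq_fintype_card])]
    · rw [hsum _ 6 0 (fun c hc => by simp [pathNum, m₁ c hc, -Nat.card_eq_fintype_card])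
        (fun c hc => by simp [pathNum, m₂ c hc, -Nat.card_eq_fintype_card])]
    · rw [hsum _ 0 0 (fun c hc => by simp [pathNum, m₁ c hc, -Nat.card_eq_fintype_card])
        (fun c hc => by simp [pathNum, m₂ c hc, -Nat.card_eq_fintype_card])]
    · rw [hsum _ 6 0 (fun c hc => by simp [m₁ c hc, -Nat.card_eq_fintype_card])
        (fun c hc => by simp [m₂ c hc, -Nat.card_eq_fintype_card])]

end Exceptional

/-! ### Assembling the bounds -/

section Main

variable {V : Type*} [Fintype V] [Nonempty V] {G : SimpleGraph V}

/-- If `k` is at least `k_G` and the `k`-deck forces maximum degree at most two, then `G` is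
determined by its `k`-deck. -/
theorem deckReconstructible_of_degLeTwo (hG : DegLeTwo G) {k : ℕ} (hk : kNumber G ≤ k)
    (hk2 : 2 ≤ k) (hkV : k ≤ Fintype.card V)
    (h : ∀ (n : ℕ) (H : SimpleGraph (Fin n)),
      (∀ j ≤ k, ∀ F : SimpleGraph (Fin j), embCount F H = embCount F G) → DegLeTwo H) :
    DeckReconstructible G k := by
  intro n H hH
  have hcount : ∀ j ≤ k, ∀ F : SimpleGraph (Fin j), embCount F H = embCount F G :=
    fun j hj F => embCount_eq_of_kDeck_eq_of_le (by omega) hkV hH hj F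
  exact iso_of_embCount_eq hG (h n H hcount) hk2 hk hcount

theorem deckReconstructible_of_card_eq_one {V : Type*} [Fintype V] {G : SimpleGraph V}
    (hV : Fintype.card V = 1) : DeckReconstructible G 1 := by
  intro n H hH
  have hn := card_eq_of_kDeck_eq le_rfl hV.ge hH
  have : Subsingleton V := Fintype.card_le_one_iff_subsingleton.1 hV.le
  have : Subsingleton (Fin n) := Fintype.card_le_one_iff_subsingleton.1 (by omega)
  refine ⟨⟨Fintype.equivOfCardEq hn, fun {a b} => ?_⟩⟩
  rw [Subsingleton.elim a b]
  simp

theorem deckReconstructible_kNumber (hG : DegLeTwo G)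
    (hcycle : ∀ j : ℕ, 3 ≤ j → j < 6 → ¬ Nonempty (G ≃g cycleGraph j))
    (hF : ¬ (kNumber G = 3 ∧ InExceptionalFamily G)) : DeckReconstructible G (kNumber G) := by
  have hle := kNumber_le_card (G := G)
  have hpos : 1 ≤ Fintype.card V := Fintype.card_pos
  -- A single vertex has `k_G = 1`, below the range `k ≥ 2` of the general argument.
  rcases hpos.eq_or_lt with hV | hV
  · have h0 : kNumber G ≠ 0 := by
      obtain ⟨t, h1, h2, -⟩ := exists_largest G
      have hpos := card_component_pos t
      have ht : ¬ IsCyc t.toSimpleGraph := by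
        intro h
        have h3 : 3 ≤ Nat.card t := h.1
        have := Nat.card_le_card_of_injective (Subtype.val : t → V) Subtype.val_injective
        rw [Nat.card_eq_fintype_card (α := V)] at this
        omega
      have : epsOne G = 1 := by
        rw [epsOne, if_pos ((hasComponent_path_iff hG _).2 ⟨t, ht, h1⟩)]
      rw [kNumber, this]
      have := le_max_left (largestOrder G / 2 + 1) (secondOrder G + epsTwo G)
      omega
    rw [show kNumber G = 1 by omega]
    exact deckReconstructible_of_card_eq_one hV.symm
  · have h2 := two_le_kNumber hG hcycle hV
    refine deckReconstructible_of_degLeTwo hG le_rfl h2 hle fun n H hcount => ?_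
    by_cases hk4 : 4 ≤ kNumber G
    · exact degLeTwo_of_four hG (hcount 4 hk4)
    by_cases hk3 : kNumber G = 3
    · exact degLeTwo_of_three hG hk3.le (fun h => hF ⟨hk3, h⟩) (hk3 ▸ hcount)
    · have hk2 : kNumber G = 2 := by omega
      exact degLeTwo_of_two hG hcycle hk2.le (hk2 ▸ hcount)

/-- Ensures that the 4-deck is nonempty, so that reconstruction at `k = 4` applies. -/
theorem four_le_card_of_exceptional {V : Type*} [Fintype V] {G : SimpleGraph V}
    (hG : DegLeTwo G) (hF : InExceptionalFamily G) :
    4 ≤ Fintype.card V := by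
  classical
  let I : Fintype G.ConnectedComponent := Fintype.ofFinite _
  obtain ⟨-, hF⟩ := hF
  have hcomp : ∀ c : G.ConnectedComponent, 4 ≤ Nat.card c → 4 ≤ Fintype.card V := by
    intro c hc
    have := Nat.card_le_card_of_injective (Subtype.val : c → V) Subtype.val_injective
    rw [Nat.card_eq_fintype_card (α := V)] at this
    omega
  rcases hF with ⟨w, hw⟩ | h | ⟨h, -⟩ | ⟨-, h⟩
  · have hw : 5 ≤ Nat.card w := hw
    exact hcomp w (by omega)
  · obtain ⟨w, -, hw⟩ := (hasComponent_cycle_iff (by omega)).1 h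
    exact hcomp w hw.ge
  · obtain ⟨w, -, hw⟩ := (hasComponent_path_iff hG 4).1 h
    exact hcomp w hw.ge
  · calc 4 ≤ componentCount G (pathGraph 1) := h
      _ ≤ Nat.card G.ConnectedComponent := Nat.card_le_card_of_injective _ Subtype.val_injective
      _ ≤ Nat.card V := Nat.card_le_card_of_surjective G.connectedComponentMk Quot.mk_surjective
      _ = Fintype.card V := Nat.card_eq_fintype_card

theorem degLeTwo_of_maxDegree {V : Type*} [Fintype V] {G : SimpleGraph V}
    [DecidableRel G.Adj] (h : G.maxDegree ≤ 2) : DegLeTwo G := by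
  rw [degLeTwo_iff_degree]
  exact fun v => (G.degree_le_maxDegree v).trans h

end Main

end DeckReconstruction

open DeckReconstruction

theorem theorem4p8 {V : Type*} [Fintype V] [Nonempty V] (G : SimpleGraph V) [DecidableRel G.Adj]
    (hdeg : G.maxDegree ≤ 2)
    (hcycle : ∀ j : ℕ, 3 ≤ j → j < 6 → ¬ Nonempty (G ≃g SimpleGraph.cycleGraph j)) :
    (kNumber G = 3 ∧ InExceptionalFamily G → IsRho G 4) ∧
      (¬ (kNumber G = 3 ∧ InExceptionalFamily G) → IsRho G (kNumber G)) := by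
  have hG := degLeTwo_of_maxDegree hdeg
  constructor
  · rintro ⟨hk, hF⟩
    refine ⟨deckReconstructible_of_degLeTwo hG (by omega) (by omega)
      (four_le_card_of_exceptional hG hF) fun n H hcount => degLeTwo_of_four hG (hcount 4 le_rfl),
      fun j hj => ?_⟩
    by_contra hlt
    exact not_deckReconstructible_exceptional hG hk.le hF (by omega) hj
  · intro hF
    refine ⟨deckReconstructible_kNumber hG hcycle hF, fun j hj => ?_⟩
    by_contra hlt
    exact not_deckReconstructible_of_lt hG hcycle (by omega) hj
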